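/- Let $n\ge 1$ and $m\ge 3$ be integers, let $M_0$ be a compact, connected (Hausdorff, boundaryless) $n$-dimensional manifold of class $C^m$, and let $x:M_0\to S^{n+1}\subset\mathbb R^{n+2}$ be an immersion of class $C^m$, assumed injective if $n=1$ (for $n\ge 2$ injectivity is not assumed), which is strictly convex: at every point the second fundamental form with respect to a suitable unit normal in $TS^{n+1}$ is positive definite. For an immersion $X$ with unit normal $\nu$ (tangent to $S^{n+1}$), in local coordinates $(\xi^i)$, let $g_{ij}=\langle X_i,X_j\rangle$, let $X_{;ij}=\partial_i\partial_jX-\Gamma^k_{ij}X_k$ be the covariant second derivatives with respect to $g_{ij}$, and let $h_{ij}=-\langle \partial_i\partial_jX,\nu\rangle$ be the second fundamental form belonging to $\nu$; the principal curvatures $\kappa_i$ are the eigenvalues of $g^{ik}h_{kj}$, counted with multiplicity. A unit normal $\nu$ at $p$ is called exterior if $\langle x(q),\nu\rangle\le 0$ for all $q\in M_0$, i.e. if the hypersurface (and so the convex body it bounds) lies in the closed hemisphere opposite to $\nu$. Then $x$ is an embedding, at every $p\in M_0$ there is exactly one exterior unit normal $\tilde x(p)\in S^{n+1}$, and the following holds.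 (1) The Gauss map $\tilde x:M_0\to S^{n+1}$ is an embedding and an immersion of class $C^{m-1}$, and $\tilde M=\tilde x(M_0)$ is a closed, connected, strictly convex hypersurface of class $C^{m-1}$. (2) For every $p$ the unique exterior unit normal of $\tilde M$ at $\tilde x(p)$ is $x(p)$; hence the Gauss map of $\tilde x$ is $x$, i.e. $\tilde{\tilde x}=x$. (3) In arbitrary local $C^m$ coordinates of $M_0$, let $g_{ij},h_{ij},\kappa_i$ belong to $x$ with normal $\tilde x$ and $\tilde g_{ij},\tilde h_{ij},\tilde\kappa_i$ to $\tilde x$ with normal $x$. Then $$x_{;ij}=-g_{ij}x-h_{ij}\tilde x,\qquad \tilde x_{;ij}=-\tilde g_{ij}\tilde x-\tilde h_{ij}x,$$ where the covariant derivatives are taken with respect to $g_{ij}$ and $\tilde g_{ij}$ respectively; $(h_{ij})$ is positive definite, $$h_{ij}=\tilde h_{ij}=\langle\tilde x_i,x_j\rangle ,$$ and $\tilde\kappa_i=\kappa_i^{-1}$ with multiplicities. -/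

import Mathlib

open scoped Manifold ContDiff InnerProductSpace

noncomputable section

namespace SphericalGauss

/-- Euclidean space `ℝᵏ`. -/
abbrev Euc (k : ℕ) : Type := EuclideanSpace ℝ (Fin k)

/-- The unit sphere `S^{n+1}` in `ℝ^{n+2}`. -/
abbrev Sph (n : ℕ) : Type := Metric.sphere (0 : Euc (n + 2)) 1

section Local

variable {n : ℕ} {F : Type*} [NormedAddCommGroup F]

/-- The partial derivative `∂f/∂ξ^i`. -/
def pd [NormedSpace ℝ F] (i : Fin n) (f : Euc n → F) (u : Euc n) : F :=
  fderiv ℝ f u (EuclideanSpace.single i 1)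

variable [InnerProductSpace ℝ F]

/-- The induced metric `g_ij = ⟨X_i, X_j⟩` of a local parametrization `X`. -/
def metric (X : Euc n → F) (u : Euc n) : Matrix (Fin n) (Fin n) ℝ :=
  Matrix.of fun i j => ⟪pd i X u, pd j X u⟫_ℝ

/-- The Christoffel symbols `Γ^k_ij` of the induced metric. -/
def christoffel (X : Euc n → F) (u : Euc n) (k i j : Fin n) : ℝ :=
  1 / 2 * ∑ l, (metric X u)⁻¹ k l *
    (pd i (fun w => metric X w j l) u + pd j (fun w => metric X w i l) u
      - pd l (fun w => metric X w i j) u)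

/-- The second covariant derivatives
`X_{;ij} = ∂²X/∂ξ^i∂ξ^j - Γ^k_ij ∂X/∂ξ^k` with respect to the induced metric; the ambient space
is Euclidean, so it contributes no Christoffel symbols. -/
def covHess (X : Euc n → F) (u : Euc n) (i j : Fin n) : F :=
  pd i (pd j X) u - ∑ k, christoffel X u k i j • pd k X u

/-- The second fundamental form `h_ij` belonging to the normal vector `ν` at the point `X u`,
with the sign convention that `-h_ij ν` is the component along `ν` of the second derivative
`X_ij`.  The ordinary and the covariant second derivatives differ by tangential terms, which are
orthogonal to `ν`. -/
def secondFF (X : Euc n → F) (ν : F) (u : Euc n) : Matrix (Fin n) (Fin n) ℝ :=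
  Matrix.of fun i j => -⟪pd i (pd j X) u, ν⟫_ℝ

/-- The principal curvatures, with multiplicity: the eigenvalues of the mixed tensor
`h^i_j = g^{ik} h_kj`. -/
def principalCurvatures (X : Euc n → F) (ν : F) (u : Euc n) : Multiset ℝ :=
  ((metric X u)⁻¹ * secondFF X ν u).charpoly.roots

end Local

section Global

variable {n : ℕ} {M : Type*} [TopologicalSpace M] [ChartedSpace (Euc n) M]

/-- The representation `ξ ↦ x(ξ) ∈ ℝ^{n+2}` of `x : M → S^{n+1}` in the local coordinates given
by the chart `e`. -/
def localRep (x : M → Sph n) (e : OpenPartialHomeomorph M (Euc n)) : Euc n → Euc (n + 2) :=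
  fun u => (x (e.symm u) : Euc (n + 2))

/-- `v` is a unit normal vector at `p` of the hypersurface `x` of the sphere: it lies in
`T_{x(p)} S^{n+1}`, viewed as a subspace of `ℝ^{n+2}`, and is orthogonal to the image of the
differential of `x` at `p`. -/
def IsUnitNormal (x : M → Sph n) (p : M) (v : Sph n) : Prop :=
  ⟪(x p : Euc (n + 2)), (v : Euc (n + 2))⟫_ℝ = 0 ∧
    ∀ ξ : TangentSpace (𝓡 n) p,
      ⟪mvfderiv (𝓡 n) (fun q => (x q : Euc (n + 2))) p ξ, (v : Euc (n + 2))⟫_ℝ = 0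

/-- `x : M → S^{n+1}` is an immersed strictly convex hypersurface of class `C^m`: an immersion of
class `C^m` such that at every point the second fundamental form belonging to a suitable unit
normal is positive definite. -/
structure IsStrictlyConvexHypersurface (m : ℕ) (x : M → Sph n) : Prop where
  contMDiff : ContMDiff (𝓡 n) (𝓡 (n + 1)) (m : ℕ∞ω) x
  immersion : ∀ p, Function.Injective (mfderiv (𝓡 n) (𝓡 (n + 1)) x p)
  convex : ∀ p, ∃ v : Sph n, IsUnitNormal x p v ∧
    (secondFF (localRep x (chartAt (Euc n) p)) (v : Euc (n + 2)) (chartAt (Euc n) p p)).PosDef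

/-- The exterior unit normal: the hypersurface (and hence the convex body it bounds) lies in the
closed hemisphere opposite to `v`. -/
def IsExteriorNormal (x : M → Sph n) (p : M) (v : Sph n) : Prop :=
  IsUnitNormal x p v ∧ ∀ q, ⟪(x q : Euc (n + 2)), (v : Euc (n + 2))⟫_ℝ ≤ 0

open Classical in
/-- The Gauss map `x ↦ x̃`: it sends `p` to the exterior unit normal at `p`, viewed as a point of
`S^{n+1}`.  If there is no exterior unit normal at `p`, the value is irrelevant. -/
def gaussMap (x : M → Sph n) (p : M) : Sph n :=
  if h : ∃ v, IsExteriorNormal x p v then h.choose else x p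

end Global

end SphericalGauss

end

open SphericalGauss

open scoped Manifold ContDiff InnerProductSpace

/-! Write ν for the field of definite unit normals. Differentiating ⟨x,ν⟩ = 0 and ⟨dx,ν⟩ = 0 gives
⟨dν,x⟩ = 0 and ⟨d²x,ν⟩ = -⟨dx,dν⟩ = ⟨d²ν,x⟩. These relations are symmetric in x and ν: the swapped
pair is again a hypersurface with a normal, it has the same second fundamental form, and
definiteness forces dν to be injective (`IsDualPair.symm`). Everything local, including the Gauss
formulas and the reciprocal curvatures, is then linear algebra in the frame (dx, x, ν).

The global content is one inequality, ⟨x(q),ν(p)⟩ < 0 for q ≠ p (`IsDualMap.inner_neg`). It makes ν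
the exterior normal and x injective, and it is invariant under the swap, so the Gauss map of ν is x.

Near p the inequality is Taylor's formula. To globalise it, consider a locally convex compact set Z
over the sphere. Its intersections with open half spaces are path connected
(`IsLocallyConvex.joinedIn`): whether two points can be joined does not change while the half space
moves, and moving the end point as well reduces the claim to a constant path. If the supporting
great sphere at y had another point of Z on it or beyond it, a slightly tilted half space would cut
out a piece near y cut off from the rest (`IsLocallyConvex.inner_neg_of_isStrictSupport`).

For n ≥ 2 one takes Z = M, since deleting a point does not disconnect M locally. For n = 1 this
fails, and a doubly covered circle shows that injectivity must enter; there Z is the closed region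
bounded by the curve (`IsDualMap.exists_isRegion`). That the two sides of the curve lie in different
components is a winding number argument: at a transversal crossing the argument of (ζ-a)/(ζ-b) jumps
by 2π, which a continuous logarithm on M forbids once the crossing is at a non-cut point. -/

namespace SphericalGauss

open Set Filter Topology

/-! ### General topology: joining through accessible points, and non-cut points -/

/-- A preconnected set that is locally accessible from `O` by path connected pieces does not
connect different path components of `O`. -/
theorem joinedIn_of_isPreconnected {T : Type*} [TopologicalSpace T] {K O : Set T}
    (hK : IsPreconnected K)
    (h : ∀ y ∈ K, y ∈ closure O ∧ ∃ W ∈ 𝓝 y, IsPathConnected (W ∩ O))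
    {p q : T} (hpK : p ∈ K) (hqK : q ∈ K) (hpO : p ∈ O) (hqO : q ∈ O) : JoinedIn O p q := by
  -- The relation compares whole neighbourhoods, so that it makes sense at points of `K` outside
  -- `O`. Transitivity uses that `O` accumulates at the middle point.
  have key := hK.induction₂' (fun y y' => ∃ W ∈ 𝓝 y, ∃ W' ∈ 𝓝 y', ∀ w ∈ W ∩ O, ∀ w' ∈ W' ∩ O,
    JoinedIn O w w') ?_ ?_ hpK hqK
  · obtain ⟨W, hW, W', hW', H⟩ := key
    exact H p ⟨mem_of_mem_nhds hW, hpO⟩ q ⟨mem_of_mem_nhds hW', hqO⟩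
  · intro y hy
    obtain ⟨-, W, hW, hc⟩ := h y hy
    filter_upwards [mem_nhdsWithin_of_mem_nhds (eventually_mem_nhds_iff.2 hW)] with y' hy'
    have : ∀ w ∈ W ∩ O, ∀ w' ∈ W ∩ O, JoinedIn O w w' := fun w hw w' hw' =>
      (hc.joinedIn w hw w' hw').mono inter_subset_right
    exact ⟨⟨W, hW, W, hy', this⟩, ⟨W, hy', W, hW, this⟩⟩
  · rintro y y' y'' - hy' - ⟨W, hW, W', hW', H⟩ ⟨V, hV, V', hV', H'⟩
    obtain ⟨z, hz, hzO⟩ := mem_closure_iff_nhds.1 (h y' hy').1 _ (inter_mem hW' hV)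
    exact ⟨W, hW, V', hV', fun w hw w' hw' => (H w hw z ⟨hz.1, hzO⟩).trans
      (H' z ⟨hz.2, hzO⟩ w' hw')⟩

/-- Only `p` can be a frontier point of `U`. If `u`, `v` separate `Uᶜ` and `p ∈ u`, then `v ∩ Uᶜ` is
clopen in the whole space and misses `p`, hence is empty. -/
theorem isPreconnected_compl_of_isClosed_insert {T : Type*} [TopologicalSpace T]
    [PreconnectedSpace T] {U : Set T} {p : T} (hU : IsOpen U) (hp : p ∉ U)
    (hc : IsClosed (insert p U)) : IsPreconnected Uᶜ := by
  have main : ∀ u v : Set T, IsClosed u → IsClosed v → Uᶜ ⊆ u ∪ v → Disjoint u v → p ∈ u →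
      Uᶜ ⊆ u := by
    intro u v hu hv huv hd hpu
    have hclopen : IsClopen (v ∩ Uᶜ) := by
      refine ⟨hv.inter hU.isClosed_compl, ?_⟩
      have : v ∩ Uᶜ = (u ∪ insert p U)ᶜ := by
        ext z
        have h1 : z ∈ v → z ∉ u := fun h h' => disjoint_left.1 hd h' h
        have h2 : z ∉ U → z ∈ u ∨ z ∈ v := fun h => huv h
        have h3 : z = p → z ∈ u := fun h => h ▸ hpu
        simp only [mem_inter_iff, mem_compl_iff, mem_union, mem_insert_iff]
        tauto
      rw [this]
      exact (hu.union hc).isOpen_compl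
    rcases isClopen_iff.1 hclopen with h | h
    · intro z hz
      rcases huv hz with h' | h'
      · exact h'
      · exact absurd (h ▸ ⟨h', hz⟩ : z ∈ (∅ : Set T)) (notMem_empty z)
    · exact absurd (h ▸ mem_univ p : p ∈ v ∩ Uᶜ).1 (disjoint_left.1 hd hpu)
  rw [isPreconnected_iff_subset_of_fully_disjoint_closed hU.isClosed_compl]
  intro u v hu hv huv hd
  rcases huv hp with h | h
  · exact Or.inl (main u v hu hv huv hd h)
  · exact Or.inr (main v u hv hu (by rwa [union_comm]) hd.symm h)

/-- In a compact connected Hausdorff space some point does not disconnect the space. -/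
theorem exists_isPreconnected_compl_singleton {T : Type*} [TopologicalSpace T] [T2Space T]
    [CompactSpace T] [ConnectedSpace T] : ∃ p : T, IsPreconnected ({p}ᶜ : Set T) := by
  by_contra! hcut
  -- Pairs of a point and a nonempty relatively clopen part of its complement, ordered by nesting.
  -- Zorn gives an innermost pair, but any point inside it would cut off a smaller one.
  let 𝒮 := {A : T × Set T // IsOpen A.2 ∧ A.2.Nonempty ∧ A.1 ∉ A.2 ∧ IsClosed (insert A.1 A.2)}
  let r : 𝒮 → 𝒮 → Prop := fun A B => A = B ∨ insert B.1.1 B.1.2 ⊆ A.1.2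
  have hr : Std.Refl r := ⟨fun A => Or.inl rfl⟩
  -- The union of the outer parts `Uᶜ` is connected and misses `q`, so it avoids one of the two
  -- pieces into which `q` cuts the space. That piece is nested inside the whole chain.
  have step : ∀ (q : T) (c : Set 𝒮), (∀ A ∈ c, q ∈ A.1.2) → IsChain r c →
      ∃ B : 𝒮, ∀ A ∈ c, insert B.1.1 B.1.2 ⊆ A.1.2 := by
    intro q c hq hc
    have hD : IsPreconnected (⋃ A ∈ c, A.1.2ᶜ) := by
      refine isPreconnected_of_forall_pair ?_
      intro y hy z hz
      simp only [mem_iUnion] at hy hz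
      obtain ⟨A, hA, hyA⟩ := hy
      obtain ⟨B, hB, hzB⟩ := hz
      have hcon : ∀ A : 𝒮, IsPreconnected A.1.2ᶜ := fun A =>
        isPreconnected_compl_of_isClosed_insert A.2.1 A.2.2.2.1 A.2.2.2.2
      have hmono : ∀ A B : 𝒮, r A B → A.1.2ᶜ ⊆ B.1.2ᶜ := by
        rintro A B (rfl | h)
        · exact subset_rfl
        · exact compl_subset_compl.2 ((subset_insert _ _).trans h)
      rcases hc.total hA hB with h | h
      · exact ⟨_, subset_biUnion_of_mem (u := fun A : 𝒮 => A.1.2ᶜ) hB, hmono _ _ h hyA, hzB, hcon B⟩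
      · exact ⟨_, subset_biUnion_of_mem (u := fun A : 𝒮 => A.1.2ᶜ) hA, hyA, hmono _ _ h hzB, hcon A⟩
    have hDq : (⋃ A ∈ c, A.1.2ᶜ) ⊆ ({q}ᶜ : Set T) := by
      intro z hz
      simp only [mem_iUnion] at hz
      obtain ⟨A, hA, hzA⟩ := hz
      rintro rfl
      exact hzA (hq A hA)
    have build : ∀ u v : Set T, IsOpen u → IsOpen v → ({q}ᶜ : Set T) ⊆ u ∪ v →
        (({q}ᶜ : Set T) ∩ u).Nonempty → ¬ (({q}ᶜ : Set T) ∩ (u ∩ v)).Nonempty →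
        ¬ ((⋃ A ∈ c, A.1.2ᶜ) ∩ u).Nonempty → ∃ B : 𝒮, ∀ A ∈ c, insert B.1.1 B.1.2 ⊆ A.1.2 := by
      intro u v hu hv huv hun hd hDu
      refine ⟨⟨(q, {q}ᶜ ∩ u), isOpen_compl_singleton.inter hu, hun, fun h => h.1 rfl, ?_⟩, ?_⟩
      · have : insert q (({q}ᶜ : Set T) ∩ u) = ({q}ᶜ ∩ v)ᶜ := by
          ext z
          have h1 : z ≠ q → z ∈ u ∨ z ∈ v := fun h => huv h
          have h2 : z ≠ q → z ∈ u → z ∉ v := fun h h' h'' => hd ⟨z, h, h', h''⟩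
          simp only [mem_insert_iff, mem_inter_iff, mem_compl_iff, mem_singleton_iff]
          tauto
        change IsClosed (insert q (({q}ᶜ : Set T) ∩ u))
        rw [this]
        exact (isOpen_compl_singleton.inter hv).isClosed_compl
      · intro A hA
        refine insert_subset (hq A hA) ?_
        rintro z ⟨-, hz⟩
        by_contra hzA
        exact hDu ⟨z, mem_biUnion hA hzA, hz⟩
    have hnot := hcut q
    unfold IsPreconnected at hnot
    push Not at hnot
    obtain ⟨u, v, hu, hv, huv, hun, hvn, hd⟩ := hnot
    by_cases hDu : ((⋃ A ∈ c, A.1.2ᶜ) ∩ u).Nonempty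
    · by_cases hDv : ((⋃ A ∈ c, A.1.2ᶜ) ∩ v).Nonempty
      · obtain ⟨z, hz, hz'⟩ := hD u v hu hv (hDq.trans huv) hDu hDv
        exact absurd (hd ▸ ⟨hDq hz, hz'⟩ : z ∈ (∅ : Set T)) (notMem_empty z)
      · exact build v u hv hu (by rwa [union_comm]) hvn
          (by rw [inter_comm v u, hd]; exact not_nonempty_empty) hDv
    · exact build u v hu hv huv hun (by rw [hd]; exact not_nonempty_empty) hDu
  have hchain : ∀ c : Set 𝒮, IsChain r c → ∃ ub, ∀ a ∈ c, r a ub := by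
    intro c hc
    rcases c.eq_empty_or_nonempty with rfl | hcne
    · obtain ⟨p⟩ : Nonempty T := inferInstance
      have hne : ({p}ᶜ : Set T).Nonempty := by
        by_contra h
        exact hcut p (by rw [not_nonempty_iff_eq_empty.1 h]; exact isPreconnected_empty)
      exact ⟨⟨(p, {p}ᶜ), isOpen_compl_singleton, hne, fun h => h rfl, by
        change IsClosed (insert p ({p}ᶜ : Set T))
        rw [insert_eq, union_compl_self]; exact isClosed_univ⟩, by simp⟩
    have : Nonempty c := hcne.to_subtype
    have hint : (⋂ A : c, insert A.1.1.1 A.1.1.2).Nonempty := by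
      refine IsCompact.nonempty_iInter_of_directed_nonempty_isCompact_isClosed _ ?_
        (fun A => ⟨_, mem_insert _ _⟩) (fun A => A.1.2.2.2.2.isCompact) (fun A => A.1.2.2.2.2)
      rintro ⟨A, hA⟩ ⟨B, hB⟩
      have hmono : ∀ A B : 𝒮, r A B → insert B.1.1 B.1.2 ⊆ insert A.1.1 A.1.2 := by
        rintro A B (rfl | h)
        · exact subset_rfl
        · exact h.trans (subset_insert _ _)
      rcases hc.total hA hB with h | h
      · exact ⟨⟨B, hB⟩, hmono _ _ h, subset_rfl⟩
      · exact ⟨⟨A, hA⟩, subset_rfl, hmono _ _ h⟩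
    obtain ⟨q, hq⟩ := hint
    replace hq : ∀ A ∈ c, q ∈ insert A.1.1 A.1.2 := fun A hA => mem_iInter.1 hq ⟨A, hA⟩
    -- Otherwise `q` is the cut point of some `A₀` in the chain, and `A₀` is already an upper bound.
    by_cases hall : ∀ A ∈ c, q ∈ A.1.2
    · obtain ⟨B, hB⟩ := step q c hall hc
      exact ⟨B, fun A hA => Or.inr (hB A hA)⟩
    · push Not at hall
      obtain ⟨A₀, hA₀, hqA⟩ := hall
      refine ⟨A₀, fun A hA => ?_⟩
      rcases hc.total hA hA₀ with h | h | h
      · exact h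
      · exact Or.inl h.symm
      · exact absurd (h (hq A hA)) hqA
  obtain ⟨A, hA⟩ := exists_maximal_of_chains_bounded hchain (by
    rintro A B C (rfl | h1) (rfl | h2)
    · exact Or.inl rfl
    · exact Or.inr h2
    · exact Or.inr h1
    · exact Or.inr (h2.trans ((subset_insert _ _).trans h1)))
  obtain ⟨q, hq⟩ := A.2.2.1
  obtain ⟨B, hB⟩ := step q {A} (by simpa using hq) (by simp [IsChain])
  have h1 := hB A rfl
  rcases hA B (Or.inr h1) with h | h
  · subst h; exact B.2.2.2.1 (h1 (mem_insert _ _))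
  · exact B.2.2.2.1 (h1 (mem_insert _ _)|> fun h' => (h (mem_insert_of_mem _ h')) )

/-! ### From local to global convexity by moving half spaces -/

section Connectivity

variable {T : Type*} [TopologicalSpace T] {E : Type*} [NormedAddCommGroup E]
  [InnerProductSpace ℝ E]

/-- The part of `Z` lying in the open half space `⟨·, a⟩ > 0`. -/
def posPart (ι : T → E) (Z : Set T) (a : E) : Set T := {y | y ∈ Z ∧ 0 < ⟪ι y, a⟫_ℝ}

/-- Near `y`, the hyperplane `a⊥` supports `Z` and meets it only at `y`. -/
def IsStrictSupport (ι : T → E) (Z : Set T) (y : T) (a : E) : Prop :=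
  ⟪ι y, a⟫_ℝ = 0 ∧ ∀ᶠ z in 𝓝 y, z ∈ Z → z ≠ y → ⟪ι z, a⟫_ℝ < 0

/-- Compact sets over the unit sphere whose intersections with open half spaces are locally
connected up to the boundary, except at points of strict support. -/
structure IsLocallyConvex (ι : T → E) (Z : Set T) : Prop where
  isCompact : IsCompact Z
  continuous : Continuous ι
  norm_eq : ∀ y ∈ Z, ‖ι y‖ = 1
  local_conn : ∀ a ≠ 0, ∀ y ∈ Z, 0 ≤ ⟪ι y, a⟫_ℝ → IsStrictSupport ι Z y a ∨
    (y ∈ closure (posPart ι Z a) ∧ ∃ W ∈ 𝓝 y, IsPathConnected (W ∩ posPart ι Z a))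
  preconn : ∀ y₀ ∈ Z, IsPreconnected (Z \ {y | ι y = -ι y₀})
  support_unique : ∀ y ∈ Z, ∀ a ≠ 0, ∀ w, IsStrictSupport ι Z y a → ⟪ι y, w⟫_ℝ = 0 → w ∉ ℝ ∙ a →
    y ∈ closure (posPart ι Z (a + w))

variable {ι : T → E} {Z : Set T}

theorem eventually_forall_inner_pos (hι : Continuous ι) {K : Set T} (hK : IsCompact K) {a : E}
    (h : ∀ z ∈ K, 0 < ⟪ι z, a⟫_ℝ) : ∀ᶠ a' in 𝓝 a, ∀ z ∈ K, 0 < ⟪ι z, a'⟫_ℝ := by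
  refine hK.eventually_forall_of_forall_eventually fun z hz => ?_
  have hc : Continuous fun p : E × T => ⟪ι p.2, p.1⟫_ℝ :=
    (hι.comp continuous_snd).inner continuous_fst
  exact hc.continuousAt.eventually_const_lt (h z hz)

theorem eventually_forall_inner_neg (hι : Continuous ι) {K : Set T} (hK : IsCompact K) {a : E}
    (h : ∀ z ∈ K, ⟪ι z, a⟫_ℝ < 0) : ∀ᶠ a' in 𝓝 a, ∀ z ∈ K, ⟪ι z, a'⟫_ℝ < 0 := by
  refine hK.eventually_forall_of_forall_eventually fun z hz => ?_
  have hc : Continuous fun p : E × T => ⟪ι p.2, p.1⟫_ℝ :=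
    (hι.comp continuous_snd).inner continuous_fst
  exact hc.continuousAt.eventually_lt_const (h z hz)

/-- The bisector supplies a half space in which two non-antipodal points can be compared. -/
theorem inner_add_pos_of_ne_neg {v w : E} (hv : ‖v‖ = 1) (hw : ‖w‖ = 1) (h : w ≠ -v) :
    0 < ⟪v, v + w⟫_ℝ ∧ 0 < ⟪w, v + w⟫_ℝ := by
  have h1 : -1 < ⟪v, w⟫_ℝ := by
    have h2 := abs_real_inner_le_norm v w
    rw [hv, hw, mul_one] at h2
    refine lt_of_le_of_ne (abs_le.1 h2).1 fun h3 => h ?_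
    have h4 : ⟪v, -w⟫_ℝ = 1 := by rw [inner_neg_right, ← h3, neg_neg]
    rw [(inner_eq_one_iff_of_norm_eq_one hv (by rwa [norm_neg])).1 h4, neg_neg]
  have h2 := real_inner_comm v w
  rw [inner_add_right, inner_add_right, real_inner_self_eq_norm_sq, real_inner_self_eq_norm_sq,
    hv, hw]
  constructor <;> linarith

variable [T2Space T]

/-- A point of strict support is isolated in the closed half space, so the connected set `K` through
`q₀` cannot contain it. At all other points `local_conn` pushes `K` into the open half space. -/
theorem IsLocallyConvex.joinedIn_of_closed_conn (h : IsLocallyConvex ι Z) {a : E} {q₀ q₁ : T}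
    (h₀ : q₀ ∈ posPart ι Z a) (h₁ : q₁ ∈ posPart ι Z a) {K : Set T} (hK : IsPreconnected K)
    (hKZ : K ⊆ {z ∈ Z | 0 ≤ ⟪ι z, a⟫_ℝ}) (hq₀ : q₀ ∈ K) (hq₁ : q₁ ∈ K) :
    JoinedIn (posPart ι Z a) q₀ q₁ := by
  have ha : a ≠ 0 := by
    rintro rfl
    simpa using h₀.2
  refine joinedIn_of_isPreconnected hK (fun y hy => ?_) hq₀ hq₁ h₀ h₁
  rcases h.local_conn a ha y (hKZ hy).1 (hKZ hy).2 with ⟨h1, h2⟩ | h'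
  · exfalso
    obtain ⟨u, hu, huo, hyu⟩ := mem_nhds_iff.1 h2
    have hne : q₀ ≠ y := by
      rintro rfl
      exact h₀.2.ne' h1
    obtain ⟨z, hz, hzu, hzy⟩ := hK u {y}ᶜ huo isOpen_compl_singleton
      (fun z _ => by
        by_cases hzy : z = y
        · exact Or.inl (hzy ▸ hyu)
        · exact Or.inr hzy) ⟨y, hy, hyu⟩ ⟨q₀, hq₀, hne⟩
    exact not_lt.2 (hKZ hz).2 (hu hzu (hKZ hz).1 hzy)
  · exact h'

/-- The admissible directions form a convex set, so local constancy in the direction suffices. A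
path survives small motions by compactness. If there is no path, a clopen set separates the points
in the compact closed half space, and its thickening to disjoint open sets survives small motions
too. -/
theorem IsLocallyConvex.joinedIn_congr (h : IsLocallyConvex ι Z) {q₀ q₁ : T} {a a' : E}
    (ha₀ : q₀ ∈ posPart ι Z a) (ha₁ : q₁ ∈ posPart ι Z a)
    (ha₀' : q₀ ∈ posPart ι Z a') (ha₁' : q₁ ∈ posPart ι Z a') :
    JoinedIn (posPart ι Z a) q₀ q₁ ↔ JoinedIn (posPart ι Z a') q₀ q₁ := by
  have hconv : Convex ℝ {a : E | 0 < ⟪ι q₀, a⟫_ℝ ∧ 0 < ⟪ι q₁, a⟫_ℝ} := by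
    intro b hb c hc s t hs ht hst
    simp only [mem_ofPred_eq, inner_add_right, inner_smul_right] at hb hc ⊢
    constructor
    · rcases hs.eq_or_lt with rfl | hs
      · have : t = 1 := by linarith
        subst this; simpa using hc.1
      · nlinarith [mul_pos hs hb.1, mul_nonneg ht hc.1.le]
    · rcases hs.eq_or_lt with rfl | hs
      · have : t = 1 := by linarith
        subst this; simpa using hc.2
      · nlinarith [mul_pos hs hb.2, mul_nonneg ht hc.2.le]
  refine hconv.isPreconnected.induction₂ (fun a a' => JoinedIn (posPart ι Z a) q₀ q₁ ↔
    JoinedIn (posPart ι Z a') q₀ q₁) ?_ (fun _ _ _ _ _ _ => Iff.trans)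
    (fun _ _ _ _ => Iff.symm) ⟨ha₀.2, ha₁.2⟩ ⟨ha₀'.2, ha₁'.2⟩
  rintro b ⟨hb₀, hb₁⟩
  refine mem_nhdsWithin_of_mem_nhds ?_
  by_cases hJ : JoinedIn (posPart ι Z b) q₀ q₁
  · obtain ⟨γ, hγ⟩ := hJ
    have hev := eventually_forall_inner_pos h.continuous (isCompact_range γ.continuous) (a := b)
      (by rintro _ ⟨t, rfl⟩; exact (hγ t).2)
    filter_upwards [hev] with b' hb'
    exact ⟨fun _ => ⟨γ, fun t => ⟨(hγ t).1, hb' _ ⟨t, rfl⟩⟩⟩, fun _ => ⟨γ, hγ⟩⟩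
  · have hFc : IsCompact {z ∈ Z | 0 ≤ ⟪ι z, b⟫_ℝ} := by
      have hcl : IsClosed {z | 0 ≤ ⟪ι z, b⟫_ℝ} :=
        isClosed_le continuous_const (h.continuous.inner continuous_const)
      exact h.isCompact.inter_right hcl
    set F : Set T := {z ∈ Z | 0 ≤ ⟪ι z, b⟫_ℝ} with hF
    have : CompactSpace F := isCompact_iff_compactSpace.1 hFc
    let x₀ : F := ⟨q₀, ha₀.1, hb₀.le⟩
    let x₁ : F := ⟨q₁, ha₁.1, hb₁.le⟩
    have hx : x₁ ∉ connectedComponent x₀ := fun hx => hJ <|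
      h.joinedIn_of_closed_conn ⟨ha₀.1, hb₀⟩ ⟨ha₁.1, hb₁⟩
        (isPreconnected_connectedComponent.image _ continuous_subtype_val.continuousOn)
        (by rintro _ ⟨z, -, rfl⟩; exact z.2) ⟨x₀, mem_connectedComponent, rfl⟩ ⟨x₁, hx, rfl⟩
    rw [connectedComponent_eq_iInter_isClopen] at hx
    simp only [mem_iInter, not_forall] at hx
    obtain ⟨⟨V, hV, hx₀⟩, hx₁⟩ := hx
    obtain ⟨A, B, hA, hB, hVA, hVB, hAB⟩ := SeparatedNhds.of_isCompact_isCompact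
      (hV.1.isCompact.image continuous_subtype_val)
      (hV.compl.1.isCompact.image continuous_subtype_val)
      ((disjoint_image_iff Subtype.val_injective).2 disjoint_compl_right)
    have hcov : F ⊆ A ∪ B := fun z hz => by
      by_cases hzV : (⟨z, hz⟩ : F) ∈ V
      · exact Or.inl (hVA ⟨_, hzV, rfl⟩)
      · exact Or.inr (hVB ⟨_, hzV, rfl⟩)
    have hev := eventually_forall_inner_neg h.continuous
      (h.isCompact.diff (hA.union hB)) (a := b) (fun z hz => by
        by_contra hneg
        exact hz.2 (hcov ⟨hz.1, not_lt.1 hneg⟩))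
    filter_upwards [hev] with b' hb'
    refine ⟨fun h' => absurd h' hJ, fun ⟨γ, hγ⟩ => ?_⟩
    exfalso
    have hsub : range γ ⊆ A ∪ B := by
      rintro _ ⟨t, rfl⟩
      by_contra hneg
      exact (hb' _ ⟨(hγ t).1, hneg⟩).not_gt (hγ t).2
    obtain ⟨z, -, hzA, hzB⟩ := (isPreconnected_range γ.continuous) A B hA hB hsub
      ⟨q₀, ⟨0, γ.source⟩, hVA ⟨x₀, hx₀, rfl⟩⟩ ⟨q₁, ⟨1, γ.target⟩, hVB ⟨x₁, hx₁, rfl⟩⟩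
    exact disjoint_left.1 hAB hzA hzB

/-- Intersections of locally convex sets with open half spaces are path connected. -/
theorem IsLocallyConvex.joinedIn (h : IsLocallyConvex ι Z) {a : E} {q₀ q₁ : T}
    (h₀ : q₀ ∈ posPart ι Z a) (h₁ : q₁ ∈ posPart ι Z a) : JoinedIn (posPart ι Z a) q₀ q₁ := by
  have hne : ∀ {q : T} {b : E}, q₀ ∈ posPart ι Z b → q ∈ posPart ι Z b → ι q ≠ -ι q₀ := by
    intro q b hb hb' heq
    have := hb'.2
    rw [heq, inner_neg_left] at this
    linarith [hb.2]
  -- The end point moves over `Z` without the antipodes of `q₀`. The bisector half space at `q` also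
  -- contains nearby `q'`, and `joinedIn_congr` makes the choice of half space immaterial.
  have key := (h.preconn q₀ h₀.1).induction₂
    (fun q q' => (∀ b, q₀ ∈ posPart ι Z b → q ∈ posPart ι Z b → JoinedIn (posPart ι Z b) q₀ q) ↔
      (∀ b, q₀ ∈ posPart ι Z b → q' ∈ posPart ι Z b → JoinedIn (posPart ι Z b) q₀ q'))
    ?_ (fun _ _ _ _ _ _ => Iff.trans) (fun _ _ _ _ => Iff.symm) ⟨h₀.1, hne h₀ h₀⟩
    ⟨h₁.1, hne h₀ h₁⟩
  · exact key.1 (fun b hb _ => JoinedIn.refl hb) a h₀ h₁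
  rintro q ⟨hqZ, hq⟩
  obtain ⟨hp₀, hp⟩ := inner_add_pos_of_ne_neg (h.norm_eq _ h₀.1) (h.norm_eq _ hqZ) hq
  have hc0 : ι q₀ + ι q ≠ 0 := by
    intro h0
    rw [h0, inner_zero_right] at hp₀
    exact lt_irrefl _ hp₀
  set c := ι q₀ + ι q
  rcases h.local_conn c hc0 q hqZ hp.le with h' | ⟨-, W, hW, hWc⟩
  · exact absurd h'.1 hp.ne'
  have hev : ∀ᶠ z in 𝓝 q, 0 < ⟪ι z, c⟫_ℝ :=
    (h.continuous.inner continuous_const).continuousAt.eventually_const_lt hp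
  filter_upwards [mem_nhdsWithin_of_mem_nhds hW, mem_nhdsWithin_of_mem_nhds hev,
    self_mem_nhdsWithin] with q' hq'W hq'c hq'Z
  have hJ : JoinedIn (posPart ι Z c) q q' := (hWc.joinedIn q ⟨mem_of_mem_nhds hW, hqZ, hp⟩ q'
    ⟨hq'W, hq'Z.1, hq'c⟩).mono inter_subset_right
  constructor
  · intro H b hb hb'
    exact (h.joinedIn_congr ⟨h₀.1, hp₀⟩ ⟨hq'Z.1, hq'c⟩ hb hb').1
      ((H c ⟨h₀.1, hp₀⟩ ⟨hqZ, hp⟩).trans hJ)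
  · intro H b hb hb'
    exact (h.joinedIn_congr ⟨h₀.1, hp₀⟩ ⟨hqZ, hp⟩ hb hb').1
      ((H c ⟨h₀.1, hp₀⟩ ⟨hq'Z.1, hq'c⟩).trans hJ.symm)

/-- For locally convex sets, local strict support is global. -/
theorem IsLocallyConvex.inner_neg_of_isStrictSupport [CompactSpace T] [FiniteDimensional ℝ E]
    (hE : 3 ≤ Module.finrank ℝ E) (h : IsLocallyConvex ι Z) {y q : T} {a : E} (ha : a ≠ 0)
    (hy : y ∈ Z) (hq : q ∈ Z) (hs : IsStrictSupport ι Z y a) (hqy : q ≠ y) :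
    ⟪ι q, a⟫_ℝ < 0 := by
  by_contra! hneg
  obtain ⟨U, hUo, hyU, hUcl⟩ : ∃ U, IsOpen U ∧ y ∈ U ∧
      closure U ⊆ {z | z ≠ q ∧ (z ∈ Z → z ≠ y → ⟪ι z, a⟫_ℝ < 0)} := by
    have hmem : {z | z ≠ q ∧ (z ∈ Z → z ≠ y → ⟪ι z, a⟫_ℝ < 0)} ∈ 𝓝 y :=
      Filter.inter_mem (isOpen_ne.mem_nhds hqy.symm) hs.2
    obtain ⟨V, hV, hVc, hVs⟩ := exists_mem_nhds_isClosed_subset hmem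
    exact ⟨interior V, isOpen_interior, mem_interior_iff_mem_nhds.2 hV,
      (closure_minimal interior_subset hVc).trans hVs⟩
  have hqU : q ∈ (closure U)ᶜ := fun hq' => (hUcl hq').1 rfl
  -- On the part of `Z` in the frontier of `U` the height over `a⊥` is negative, also after a small
  -- tilt. A path in the tilted half space cannot cross this frontier.
  have hev : ∀ᶠ b in 𝓝 a, ∀ p' ∈ U ∩ posPart ι Z b, ∀ q' ∈ (closure U)ᶜ ∩ posPart ι Z b,
      False := by
    filter_upwards [eventually_forall_inner_neg h.continuous
      (h.isCompact.inter_right (isClosed_frontier (s := U))) (a := a) (fun z hz => (hUcl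
        (frontier_subset_closure hz.2)).2 hz.1 (by
          rintro rfl
          rw [hUo.frontier_eq] at hz
          exact hz.2.2 hyU))] with b hb p' hp' q' hq'
    obtain ⟨γ, hγ⟩ := h.joinedIn hp'.2 hq'.2
    obtain ⟨z, -, hzA, hzB⟩ := (isPreconnected_range γ.continuous) U (closure U)ᶜ hUo
      isClosed_closure.isOpen_compl (by
        rintro _ ⟨t, rfl⟩
        by_contra hcon
        simp only [mem_union, mem_compl_iff, not_or, not_not] at hcon
        have := hb (γ t) ⟨(hγ t).1, by rw [hUo.frontier_eq]; exact ⟨hcon.2, hcon.1⟩⟩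
        exact this.not_gt (hγ t).2) ⟨p', ⟨0, γ.source⟩, hp'.1⟩ ⟨q', ⟨1, γ.target⟩, hq'.1⟩
    exact hzB (subset_closure hzA)
  have htend : ∀ w : E, ∃ ε : ℝ, 0 < ε ∧ ∀ p' ∈ U ∩ posPart ι Z (a + ε • w),
      ∀ q' ∈ (closure U)ᶜ ∩ posPart ι Z (a + ε • w), False := by
    intro w
    have hc : Tendsto (fun ε : ℝ => a + ε • w) (𝓝[>] 0) (𝓝 a) := by
      have : Continuous fun ε : ℝ => a + ε • w := by fun_prop
      simpa using (this.tendsto 0).mono_left nhdsWithin_le_nhds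
    obtain ⟨ε, h1, h2⟩ := ((hc.eventually hev).and self_mem_nhdsWithin).exists
    exact ⟨ε, h2, h1⟩
  -- Tilting towards the bisector of `ι y` and `ι q'` makes both heights positive.
  have main : ∀ q' ∈ Z, q' ∈ (closure U)ᶜ → 0 ≤ ⟪ι q', a⟫_ℝ → ι q' ≠ -ι y → False := by
    intro q' hq'Z hq'U hq'a hne
    obtain ⟨h1, h2⟩ := inner_add_pos_of_ne_neg (h.norm_eq _ hy) (h.norm_eq _ hq'Z) hne
    obtain ⟨ε, hε, H⟩ := htend (ι y + ι q')
    refine H y ⟨hyU, hy, ?_⟩ q' ⟨hq'U, hq'Z, ?_⟩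
    · rw [inner_add_right, inner_smul_right, hs.1]
      linarith [mul_pos hε h1]
    · rw [inner_add_right, inner_smul_right]
      linarith [mul_pos hε h2]
  rcases h.local_conn a ha q hq hneg with hsq | ⟨hcl, -⟩
  -- No tilt makes antipodal points both positive. Instead one tilts along a vector orthogonal to
  -- both and independent of `a`, which exists in dimension at least 3; `support_unique` then gives
  -- positive points near each.
  · by_cases hne : ι q = -ι y
    · obtain ⟨w, hwy, hwa⟩ : ∃ w : E, ⟪ι y, w⟫_ℝ = 0 ∧ w ∉ ℝ ∙ a := by
        have hfin : Module.finrank ℝ (Submodule.span ℝ {ι y, a}) ≤ 2 := by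
          classical
          have := finrank_span_finset_le_card (R := ℝ) ({ι y, a} : Finset E)
          rw [Set.finrank, Finset.coe_pair] at this
          exact this.trans Finset.card_le_two
        have hsum := (Submodule.span ℝ {ι y, a}).finrank_add_finrank_orthogonal
        obtain ⟨w, hw⟩ : ∃ w : (Submodule.span ℝ {ι y, a})ᗮ, w ≠ 0 := by
          have : Nontrivial (Submodule.span ℝ {ι y, a})ᗮ :=
            Module.finrank_pos_iff.1 (by omega : 0 < Module.finrank ℝ _)
          exact exists_ne 0
        refine ⟨w, w.2 _ (Submodule.subset_span (by simp)), fun hwa => hw ?_⟩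
        obtain ⟨c, hc⟩ := Submodule.mem_span_singleton.1 hwa
        have h1 : ⟪a, (w : E)⟫_ℝ = 0 := w.2 _ (Submodule.subset_span (by simp))
        have h2 : ⟪(w : E), (w : E)⟫_ℝ = 0 := by
          nth_rewrite 1 [← hc]
          rw [inner_smul_left, h1, mul_zero]
        exact Subtype.ext (inner_self_eq_zero.1 h2)
      obtain ⟨ε, hε, H⟩ := htend w
      have hwa' : ε • w ∉ ℝ ∙ a := fun hmem => hwa (by
        have := Submodule.smul_mem _ ε⁻¹ hmem
        rwa [smul_smul, inv_mul_cancel₀ hε.ne', one_smul] at this)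
      have hwy' : ⟪ι y, ε • w⟫_ℝ = 0 := by rw [inner_smul_right, hwy, mul_zero]
      have hwq' : ⟪ι q, ε • w⟫_ℝ = 0 := by rw [hne, inner_neg_left, hwy', neg_zero]
      obtain ⟨p', hp'⟩ := mem_closure_iff.1 (h.support_unique y hy a ha _ hs hwy' hwa') U hUo hyU
      obtain ⟨q', hq'⟩ := mem_closure_iff.1 (h.support_unique q hq a ha _ hsq hwq' hwa')
        _ isClosed_closure.isOpen_compl hqU
      exact H p' hp' q' hq'
    · exact main q hq hqU hneg hne
  -- A nearby point of positive height is not antipodal to `y`, whose height is zero.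
  · obtain ⟨q', hq'U, hq'Z, hq'⟩ := mem_closure_iff.1 hcl _ isClosed_closure.isOpen_compl hqU
    refine main q' hq'Z hq'U hq'.le fun heq => ?_
    rw [heq, inner_neg_left, hs.1, neg_zero] at hq'
    exact lt_irrefl _ hq'

end Connectivity

/-! ### Adapted frames and smooth local normals -/

section Frame

variable {n : ℕ}

/-- The linear map `(w, r, t) ↦ D w + r x + t v`. -/
noncomputable def frameMap (D : Euc n →L[ℝ] Euc (n + 2)) (x v : Euc (n + 2)) :
    (Euc n × ℝ × ℝ) →L[ℝ] Euc (n + 2) :=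
  D.coprod ((ContinuousLinearMap.toSpanSingleton ℝ x).coprod
    (ContinuousLinearMap.toSpanSingleton ℝ v))

@[simp] theorem frameMap_apply (D : Euc n →L[ℝ] Euc (n + 2)) (x v : Euc (n + 2))
    (p : Euc n × ℝ × ℝ) : frameMap D x v p = D p.1 + (p.2.1 • x + p.2.2 • v) := rfl

variable {D : Euc n →L[ℝ] Euc (n + 2)} {x v : Euc (n + 2)}

theorem frameMap_injective (hD : Function.Injective D) (hx : ‖x‖ = 1) (hv : ‖v‖ = 1)
    (hxv : ⟪x, v⟫_ℝ = 0) (hDx : ∀ w, ⟪D w, x⟫_ℝ = 0) (hDv : ∀ w, ⟪D w, v⟫_ℝ = 0) :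
    Function.Injective (frameMap D x v) := by
  rw [injective_iff_map_eq_zero]
  rintro ⟨w, r, t⟩ h
  rw [frameMap_apply] at h
  have hx2 : ⟪x, x⟫_ℝ = 1 := by rw [real_inner_self_eq_norm_sq, hx, one_pow]
  have hv2 : ⟪v, v⟫_ℝ = 1 := by rw [real_inner_self_eq_norm_sq, hv, one_pow]
  have hr : r = 0 := by
    have := congrArg (fun z => ⟪z, x⟫_ℝ) h
    simpa [inner_add_left, inner_smul_left, hDx, hx, real_inner_comm x v, hxv] using this
  have ht : t = 0 := by
    have := congrArg (fun z => ⟪z, v⟫_ℝ) h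
    simpa [inner_add_left, inner_smul_left, hDv, hv, hxv] using this
  subst hr ht
  simp only [zero_smul, add_zero] at h
  rw [hD (h.trans (map_zero D).symm)]
  rfl

/-- The frame map of an adapted frame as a linear equivalence. -/
noncomputable def frameEquiv (h : Function.Injective (frameMap D x v)) :
    (Euc n × ℝ × ℝ) ≃L[ℝ] Euc (n + 2) :=
  (LinearMap.linearEquivOfInjective (frameMap D x v).toLinearMap h (by
    simp [Module.finrank_prod])).toContinuousLinearEquiv

theorem coe_frameEquiv (h : Function.Injective (frameMap D x v)) :
    (frameEquiv h : (Euc n × ℝ × ℝ) →L[ℝ] Euc (n + 2)) = frameMap D x v := by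
  rfl

theorem eq_zero_of_orthogonal_frame (h : Function.Injective (frameMap D x v))
    {z : Euc (n + 2)} (hzx : ⟪z, x⟫_ℝ = 0) (hzv : ⟪z, v⟫_ℝ = 0) (hzD : ∀ w, ⟪z, D w⟫_ℝ = 0) :
    z = 0 := by
  obtain ⟨p, hp⟩ := (frameEquiv h).surjective z
  have hp' : frameMap D x v p = z := hp
  have : ⟪z, frameMap D x v p⟫_ℝ = 0 := by
    rw [frameMap_apply, inner_add_right, inner_add_right, inner_smul_right, inner_smul_right,
      hzx, hzv, hzD]
    simp
  rw [hp'] at this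
  exact inner_self_eq_zero.1 this

theorem eq_smul_of_orthogonal (hD : Function.Injective D) (hx : ‖x‖ = 1) (hv : ‖v‖ = 1)
    (hxv : ⟪x, v⟫_ℝ = 0) (hDx : ∀ w, ⟪D w, x⟫_ℝ = 0) (hDv : ∀ w, ⟪D w, v⟫_ℝ = 0)
    {z : Euc (n + 2)} (hzx : ⟪z, x⟫_ℝ = 0) (hzD : ∀ w, ⟪D w, z⟫_ℝ = 0) :
    z = ⟪z, v⟫_ℝ • v := by
  have h := frameMap_injective hD hx hv hxv hDx hDv
  refine sub_eq_zero.1 (eq_zero_of_orthogonal_frame h ?_ ?_ fun w => ?_)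
  · rw [inner_sub_left, inner_smul_left, hzx, real_inner_comm x v, hxv]; simp
  · rw [inner_sub_left, inner_smul_left, real_inner_self_eq_norm_sq, hv]; simp
  · rw [inner_sub_left, inner_smul_left, real_inner_comm, hzD, real_inner_comm (D w) v, hDv]; simp

/-- An immersion into the sphere has a smooth local unit normal with prescribed value. -/
theorem exists_local_unit_normal {X : Euc n → Euc (n + 2)} {u₀ : Euc n} {k : ℕ}
    (hX : ContDiffAt ℝ (k + 1 : ℕ) X u₀) (hnorm : ∀ᶠ u in 𝓝 u₀, ‖X u‖ = 1)
    (hinj : Function.Injective (fderiv ℝ X u₀)) (hDx : ∀ w, ⟪fderiv ℝ X u₀ w, X u₀⟫_ℝ = 0)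
    (hv : ‖v‖ = 1) (hxv : ⟪X u₀, v⟫_ℝ = 0) (hDv : ∀ w, ⟪fderiv ℝ X u₀ w, v⟫_ℝ = 0) :
    ∃ N : Euc n → Euc (n + 2), ContDiffAt ℝ k N u₀ ∧ N u₀ = v ∧
      ∀ᶠ u in 𝓝 u₀, ‖N u‖ = 1 ∧ ⟪X u, N u⟫_ℝ = 0 ∧ ∀ w, ⟪fderiv ℝ X u w, N u⟫_ℝ = 0 := by
  have hinj0 := frameMap_injective hinj hnorm.self_of_nhds hv hxv hDx hDv
  let A : Euc n → (Euc n × ℝ × ℝ) →L[ℝ] Euc (n + 2) := fun u => frameMap (fderiv ℝ X u) (X u) v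
  have hA : ContDiffAt ℝ k A u₀ := by
    have h1 : ContDiffAt ℝ k (fderiv ℝ X) u₀ := hX.fderiv_right (by norm_cast)
    have h2 : ContDiffAt ℝ k X u₀ := hX.of_le (by exact_mod_cast Nat.le_succ k)
    have hEq : A = fun u => (fderiv ℝ X u).comp (ContinuousLinearMap.fst ℝ _ _) +
        (((ContinuousLinearMap.fst ℝ ℝ ℝ).comp (ContinuousLinearMap.snd ℝ (Euc n) (ℝ × ℝ))).smulRight
          (X u) + ((ContinuousLinearMap.snd ℝ ℝ ℝ).comp
          (ContinuousLinearMap.snd ℝ (Euc n) (ℝ × ℝ))).smulRight v) := by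
      funext u
      refine ContinuousLinearMap.ext fun p => ?_
      simp [A]
    rw [hEq]
    exact (h1.clm_comp contDiffAt_const).add
      ((contDiffAt_const.smulRight h2).add contDiffAt_const)
  have hA0 : A u₀ = (frameEquiv hinj0 : _ →L[ℝ] _) := (coe_frameEquiv hinj0).symm
  let τ : (Euc n × ℝ × ℝ) →L[ℝ] ℝ :=
    (ContinuousLinearMap.snd ℝ ℝ ℝ).comp (ContinuousLinearMap.snd ℝ (Euc n) (ℝ × ℝ))
  -- The vector representing the last coordinate of the frame `(dX, X, v)`: orthogonal to `X` and
  -- `dX`, with product 1 with `v`. It is smooth because inversion of linear maps is; only its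
  -- length needs correction.
  let N₀ : Euc n → Euc (n + 2) := fun u =>
    (InnerProductSpace.toDual ℝ (Euc (n + 2))).symm (τ.comp (A u).inverse)
  have hN₀ : ContDiffAt ℝ k N₀ u₀ := by
    refine (InnerProductSpace.toDual ℝ (Euc (n + 2))).symm.contDiff.contDiffAt.comp u₀ ?_
    refine contDiffAt_const.clm_comp ?_
    exact ContDiffAt.comp u₀ (hA0 ▸ contDiffAt_map_inverse (frameEquiv hinj0)) hA
  have hNinner : ∀ u z, ⟪N₀ u, z⟫_ℝ = τ ((A u).inverse z) := fun u z => by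
    simp only [N₀, InnerProductSpace.toDual_symm_apply]
    rfl
  have hev : ∀ᶠ u in 𝓝 u₀, ∃ e : (Euc n × ℝ × ℝ) ≃L[ℝ] Euc (n + 2), (e : _ →L[ℝ] _) = A u := by
    have hopen := ContinuousLinearEquiv.nhds (frameEquiv hinj0)
    rw [← hA0] at hopen
    filter_upwards [hA.continuousAt hopen] with u hu
    exact hu
  have hprop : ∀ᶠ u in 𝓝 u₀, ∀ p, ⟪N₀ u, A u p⟫_ℝ = p.2.2 := by
    filter_upwards [hev] with u ⟨e, he⟩ p
    rw [hNinner, ← he, ContinuousLinearMap.inverse_equiv]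
    simp [τ]
  have hN₀v : N₀ u₀ = v := by
    have h1 := hprop.self_of_nhds
    have hx0 : ⟪N₀ u₀, X u₀⟫_ℝ = 0 := by simpa [A] using h1 (0, 1, 0)
    have hw0 : ∀ w, ⟪fderiv ℝ X u₀ w, N₀ u₀⟫_ℝ = 0 := fun w => by
      rw [real_inner_comm]; simpa [A] using h1 (w, 0, 0)
    have hv0 : ⟪N₀ u₀, v⟫_ℝ = 1 := by simpa [A] using h1 (0, 0, 1)
    rw [eq_smul_of_orthogonal hinj hnorm.self_of_nhds hv hxv hDx hDv hx0 hw0, hv0, one_smul]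
  have hne : ∀ᶠ u in 𝓝 u₀, N₀ u ≠ 0 := hN₀.continuousAt.eventually_ne (by
    rw [hN₀v]; rintro rfl; simp at hv)
  refine ⟨fun u => ‖N₀ u‖⁻¹ • N₀ u, ?_, ?_, ?_⟩
  · exact ((hN₀.norm ℝ hne.self_of_nhds).inv (norm_ne_zero_iff.2 hne.self_of_nhds)).smul hN₀
  · simp [hN₀v, hv]
  · filter_upwards [hprop, hne] with u hu hu0
    refine ⟨?_, ?_, fun w => ?_⟩
    · rw [norm_smul, norm_inv, norm_norm, inv_mul_cancel₀ (norm_ne_zero_iff.2 hu0)]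
    · rw [inner_smul_right, real_inner_comm]
      have : ⟪N₀ u, X u⟫_ℝ = 0 := by simpa [A] using hu (0, 1, 0)
      rw [this, mul_zero]
    · rw [inner_smul_right, real_inner_comm]
      have : ⟪N₀ u, fderiv ℝ X u w⟫_ℝ = 0 := by simpa [A] using hu (w, 0, 0)
      rw [this, mul_zero]

end Frame

/-! ### Local duality of parametrized hypersurfaces -/

section DualPair

variable {n : ℕ}

/-- A pair of parametrized hypersurfaces of the sphere, normal to each other, with definite second
fundamental form. -/
structure IsDualPair (X N : Euc n → Euc (n + 2)) (U : Set (Euc n)) : Prop where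
  isOpen : IsOpen U
  left : ContDiffOn ℝ 2 X U
  right : ContDiffOn ℝ 2 N U
  norm_left : ∀ u ∈ U, ‖X u‖ = 1
  norm_right : ∀ u ∈ U, ‖N u‖ = 1
  inner_eq : ∀ u ∈ U, ⟪X u, N u⟫_ℝ = 0
  normal : ∀ u ∈ U, ∀ w, ⟪fderiv ℝ X u w, N u⟫_ℝ = 0
  neg : ∀ u ∈ U, ∀ w ≠ 0, ⟪fderiv ℝ (fderiv ℝ X) u w w, N u⟫_ℝ < 0

theorem inner_fderiv_add_eq_zero {F : Type*} [NormedAddCommGroup F] [InnerProductSpace ℝ F]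
    {E : Type*} [NormedAddCommGroup E] [NormedSpace ℝ E] {f g : E → F} {u : E} {c : ℝ}
    (hf : DifferentiableAt ℝ f u) (hg : DifferentiableAt ℝ g u)
    (h : ∀ᶠ v in 𝓝 u, ⟪f v, g v⟫_ℝ = c) (w : E) :
    ⟪f u, fderiv ℝ g u w⟫_ℝ + ⟪fderiv ℝ f u w, g u⟫_ℝ = 0 := by
  rw [← fderiv_inner_apply ℝ hf hg w]
  have h' : (fun v => ⟪f v, g v⟫_ℝ) =ᶠ[𝓝 u] fun _ => c := h
  rw [h'.fderiv_eq]
  simp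

theorem inner_fderiv_self {E : Type*} [NormedAddCommGroup E] [NormedSpace ℝ E]
    {F : Type*} [NormedAddCommGroup F] [InnerProductSpace ℝ F] {f : E → F} {u : E} {c : ℝ}
    (hf : DifferentiableAt ℝ f u) (h : ∀ᶠ v in 𝓝 u, ‖f v‖ = c) (w : E) :
    ⟪fderiv ℝ f u w, f u⟫_ℝ = 0 := by
  have := inner_fderiv_add_eq_zero hf hf (c := c ^ 2)
    (h.mono fun v hv => by rw [real_inner_self_eq_norm_sq, hv]) w
  rw [real_inner_comm] at this
  linarith

/-- Compactness of the unit sphere of directions. The two base points vary independently, because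
later the Hessian runs along a segment while the normal stays at its end. -/
theorem eventually_forall_second_neg {X N : Euc n → Euc (n + 2)} {u₀ : Euc n}
    (hX : ContDiffAt ℝ 2 X u₀) (hN : ContinuousAt N u₀)
    (h : ∀ w ≠ 0, ⟪fderiv ℝ (fderiv ℝ X) u₀ w w, N u₀⟫_ℝ < 0) :
    ∀ᶠ p in 𝓝 (u₀, u₀), ∀ w ≠ 0, ⟪fderiv ℝ (fderiv ℝ X) p.1 w w, N p.2⟫_ℝ < 0 := by
  have hcont : ContinuousAt (fderiv ℝ (fderiv ℝ X)) u₀ :=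
    ((hX.fderiv_right (m := 1) (by norm_num)).fderiv_right (m := 0) (by norm_num)).continuousAt
  have h1 : ∀ᶠ p in 𝓝 (u₀, u₀), ∀ w ∈ Metric.sphere (0 : Euc n) 1,
      ⟪fderiv ℝ (fderiv ℝ X) p.1 w w, N p.2⟫_ℝ < 0 := by
    refine (isCompact_sphere 0 1).eventually_forall_of_forall_eventually fun w hw => ?_
    have hc : ContinuousAt (fun q : (Euc n × Euc n) × Euc n =>
        ⟪fderiv ℝ (fderiv ℝ X) q.1.1 q.2 q.2, N q.1.2⟫_ℝ) ((u₀, u₀), w) := by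
      have e1 : ContinuousAt (fun q : (Euc n × Euc n) × Euc n => fderiv ℝ (fderiv ℝ X) q.1.1)
          ((u₀, u₀), w) :=
        ContinuousAt.comp (f := fun q : (Euc n × Euc n) × Euc n => q.1.1) hcont
          (continuous_fst.comp continuous_fst).continuousAt
      have e2 : ContinuousAt (fun q : (Euc n × Euc n) × Euc n => N q.1.2) ((u₀, u₀), w) :=
        ContinuousAt.comp (f := fun q : (Euc n × Euc n) × Euc n => q.1.2) hN
          (continuous_snd.comp continuous_fst).continuousAt
      exact ((e1.clm_apply continuousAt_snd).clm_apply continuousAt_snd).inner e2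
    refine hc.eventually_lt_const (h w ?_)
    rintro rfl
    simp at hw
  filter_upwards [h1] with p hp w hw
  have hn : 0 < ‖w‖ := norm_pos_iff.2 hw
  have := hp (‖w‖⁻¹ • w) (by simp [norm_smul, hn.ne'])
  simp only [map_smul, smul_apply, inner_smul_left] at this
  have hinv : 0 < ‖w‖⁻¹ := inv_pos.2 hn
  simp only [conj_trivial] at this
  nlinarith [mul_pos hinv hinv]

namespace IsDualPair

variable {X N : Euc n → Euc (n + 2)} {U : Set (Euc n)}

section

variable (h : IsDualPair X N U) {u : Euc n} (hu : u ∈ U)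
include h hu

theorem contDiffAt_left : ContDiffAt ℝ 2 X u := h.left.contDiffAt (h.isOpen.mem_nhds hu)

theorem contDiffAt_right : ContDiffAt ℝ 2 N u := h.right.contDiffAt (h.isOpen.mem_nhds hu)

theorem differentiableAt_left : DifferentiableAt ℝ X u :=
  (h.contDiffAt_left hu).differentiableAt (by simp)

theorem differentiableAt_right : DifferentiableAt ℝ N u :=
  (h.contDiffAt_right hu).differentiableAt (by simp)

theorem differentiableAt_fderiv_left : DifferentiableAt ℝ (fderiv ℝ X) u :=
  ((h.contDiffAt_left hu).fderiv_right (m := 1) (by norm_num)).differentiableAt (by simp)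

theorem differentiableAt_fderiv_right : DifferentiableAt ℝ (fderiv ℝ N) u :=
  ((h.contDiffAt_right hu).fderiv_right (m := 1) (by norm_num)).differentiableAt (by simp)

theorem tangent_left (w : Euc n) : ⟪fderiv ℝ X u w, X u⟫_ℝ = 0 :=
  inner_fderiv_self (h.differentiableAt_left hu)
    (by filter_upwards [h.isOpen.mem_nhds hu] with v hv using h.norm_left v hv) w

theorem conormal (w : Euc n) : ⟪fderiv ℝ N u w, X u⟫_ℝ = 0 := by
  have := inner_fderiv_add_eq_zero (h.differentiableAt_left hu) (h.differentiableAt_right hu)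
    (by filter_upwards [h.isOpen.mem_nhds hu] with v hv using h.inner_eq v hv) w
  rw [h.normal u hu, add_zero, real_inner_comm] at this
  exact this

/-- Differentiate the normality relation `⟪dX w', N⟫ = 0` along `w`. -/
theorem second_left (w w' : Euc n) :
    ⟪fderiv ℝ (fderiv ℝ X) u w w', N u⟫_ℝ = -⟪fderiv ℝ X u w', fderiv ℝ N u w⟫_ℝ := by
  have hd : HasFDerivAt (fun v => fderiv ℝ X v w') ((fderiv ℝ (fderiv ℝ X) u).flip w') u := by
    simpa using (h.differentiableAt_fderiv_left hu).hasFDerivAt.clm_apply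
      (hasFDerivAt_const w' u)
  have := inner_fderiv_add_eq_zero hd.differentiableAt (h.differentiableAt_right hu)
    (by filter_upwards [h.isOpen.mem_nhds hu] with v hv using h.normal v hv w') w
  rw [hd.fderiv, ContinuousLinearMap.flip_apply] at this
  linarith

theorem second_right (w w' : Euc n) :
    ⟪fderiv ℝ (fderiv ℝ N) u w w', X u⟫_ℝ = -⟪fderiv ℝ N u w', fderiv ℝ X u w⟫_ℝ := by
  have hd : HasFDerivAt (fun v => fderiv ℝ N v w') ((fderiv ℝ (fderiv ℝ N) u).flip w') u := by
    simpa using (h.differentiableAt_fderiv_right hu).hasFDerivAt.clm_apply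
      (hasFDerivAt_const w' u)
  have := inner_fderiv_add_eq_zero hd.differentiableAt (h.differentiableAt_left hu)
    (by filter_upwards [h.isOpen.mem_nhds hu] with v hv using h.conormal hv w') w
  rw [hd.fderiv, ContinuousLinearMap.flip_apply] at this
  linarith

theorem second_symm (w w' : Euc n) :
    fderiv ℝ (fderiv ℝ X) u w w' = fderiv ℝ (fderiv ℝ X) u w' w :=
  (h.contDiffAt_left hu).isSymmSndFDerivAt (by simp) w w'

/-- A kernel vector of `dX` would be null for the definite form. After swapping, the same argument
shows that the Gauss map is an immersion. -/
theorem injective_left : Function.Injective (fderiv ℝ X u) := by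
  rw [injective_iff_map_eq_zero]
  intro w hw
  by_contra hne
  have := h.neg u hu w hne
  rw [h.second_left hu, hw, inner_zero_left, neg_zero] at this
  exact lt_irrefl _ this

end

/-- The core of the duality: both second fundamental forms are the pairing of `dX` with `dN`, so
definiteness passes to the swapped pair. -/
theorem symm (h : IsDualPair X N U) : IsDualPair N X U where
  isOpen := h.isOpen
  left := h.right
  right := h.left
  norm_left := h.norm_right
  norm_right := h.norm_left
  inner_eq u hu := by rw [real_inner_comm, h.inner_eq u hu]
  normal u hu w := h.conormal hu w
  neg u hu w hw := by
    rw [h.second_right hu, real_inner_comm, ← h.second_left hu]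
    exact h.neg u hu w hw

theorem frame_injective (h : IsDualPair X N U) {u : Euc n} (hu : u ∈ U) :
    Function.Injective (frameMap (fderiv ℝ X u) (X u) (N u)) :=
  frameMap_injective (h.injective_left hu) (h.norm_left u hu) (h.norm_right u hu)
    (h.inner_eq u hu) (h.tangent_left hu) (h.normal u hu)

theorem eq_smul_normal (h : IsDualPair X N U) {u : Euc n} (hu : u ∈ U) {z : Euc (n + 2)}
    (hzx : ⟪z, X u⟫_ℝ = 0) (hzD : ∀ w, ⟪fderiv ℝ X u w, z⟫_ℝ = 0) : z = ⟪z, N u⟫_ℝ • N u :=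
  eq_smul_of_orthogonal (h.injective_left hu) (h.norm_left u hu) (h.norm_right u hu)
    (h.inner_eq u hu) (h.tangent_left hu) (h.normal u hu) hzx hzD

/-- Locally, each tangent hyperplane strictly supports the hypersurface. -/
theorem eventually_inner_neg (h : IsDualPair X N U) {u₀ : Euc n} (hu₀ : u₀ ∈ U) :
    ∀ᶠ p in 𝓝 (u₀, u₀), p.1 ≠ p.2 → ⟪X p.1, N p.2⟫_ℝ < 0 := by
  have h1 := eventually_forall_second_neg (h.contDiffAt_left hu₀)
    (h.contDiffAt_right hu₀).continuousAt (h.neg u₀ hu₀)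
  obtain ⟨r, hr, hball⟩ := Metric.eventually_nhds_iff_ball.1
    (h1.and ((h.isOpen.prod h.isOpen).mem_nhds (⟨hu₀, hu₀⟩ : (u₀, u₀) ∈ U ×ˢ U)))
  filter_upwards [Metric.ball_mem_nhds _ hr] with p hp hne
  obtain ⟨u, v⟩ := p
  simp only [← ball_prod_same] at hp hball
  obtain ⟨hpu, hpv⟩ := hp
  simp only at hne hpu hpv ⊢
  have hline : ∀ s ∈ Icc (0 : ℝ) 1, v + s • (u - v) ∈ Metric.ball u₀ r := fun s hs => by
    have := (convex_ball u₀ r).add_smul_sub_mem hpv hpu hs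
    exact this
  have hd : u - v ≠ 0 := sub_ne_zero.2 hne
  set d := u - v with hd_def
  have hneg : ∀ s ∈ Icc (0 : ℝ) 1,
      ⟪fderiv ℝ (fderiv ℝ X) (v + s • d) d d, N v⟫_ℝ < 0 := by
    exact fun s hs => (hball (v + s • d, v) ⟨hline s hs, hpv⟩).1 d hd
  have hU : ∀ s ∈ Icc (0 : ℝ) 1, v + s • d ∈ U := fun s hs =>
    (hball (v + s • d, v) ⟨hline s hs, hpv⟩).2.1
  have hl : ∀ s : ℝ, HasDerivAt (fun s : ℝ => v + s • d) d s := fun s => by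
    simpa using ((hasDerivAt_id s).smul_const d).const_add v
  have hφ : ∀ s ∈ Icc (0 : ℝ) 1, HasDerivAt (fun s : ℝ => ⟪X (v + s • d), N v⟫_ℝ)
      ⟪fderiv ℝ X (v + s • d) d, N v⟫_ℝ s := fun s hs => by
    have := ((h.differentiableAt_left (hU s hs)).hasFDerivAt.comp_hasDerivAt s (hl s)).inner ℝ
      (hasDerivAt_const s (N v))
    simpa using this
  have hφ' : ∀ s ∈ Icc (0 : ℝ) 1, HasDerivAt (fun s : ℝ => ⟪fderiv ℝ X (v + s • d) d, N v⟫_ℝ)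
      ⟪fderiv ℝ (fderiv ℝ X) (v + s • d) d d, N v⟫_ℝ s := fun s hs => by
    have h2 := ((h.differentiableAt_fderiv_left (hU s hs)).hasFDerivAt.comp_hasDerivAt s (hl s))
    have := (h2.clm_apply (hasDerivAt_const s d)).inner ℝ (hasDerivAt_const s (N v))
    simpa using this
  have hv : v ∈ U := by simpa using hU 0 (by simp)
  -- Along the segment from `v` to `u` the height over the tangent hyperplane at `v` is strictly
  -- concave, with value and slope zero at the start.
  have anti' : StrictAntiOn (fun s : ℝ => ⟪fderiv ℝ X (v + s • d) d, N v⟫_ℝ) (Icc 0 1) := by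
    refine strictAntiOn_of_deriv_neg (convex_Icc 0 1)
      (fun s hs => (hφ' s hs).continuousAt.continuousWithinAt) fun s hs => ?_
    rw [interior_Icc] at hs
    rw [(hφ' s (Ioo_subset_Icc_self hs)).deriv]
    exact hneg s (Ioo_subset_Icc_self hs)
  have anti : StrictAntiOn (fun s : ℝ => ⟪X (v + s • d), N v⟫_ℝ) (Icc 0 1) := by
    refine strictAntiOn_of_deriv_neg (convex_Icc 0 1)
      (fun s hs => (hφ s hs).continuousAt.continuousWithinAt) fun s hs => ?_
    rw [interior_Icc] at hs
    rw [(hφ s (Ioo_subset_Icc_self hs)).deriv]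
    have := anti' (by simp) (Ioo_subset_Icc_self hs) hs.1
    simp only [zero_smul, add_zero, h.normal v hv] at this
    exact this
  have := anti (by simp) (by simp) (zero_lt_one' ℝ)
  simpa [hd_def, h.inner_eq v hv] using this

end IsDualPair

end DualPair

/-! ### The second fundamental form as a quadratic form -/

section SecondForm

variable {n k : ℕ}

theorem fderiv_fderiv_apply_const {E F : Type*} [NormedAddCommGroup E] [NormedSpace ℝ E]
    [NormedAddCommGroup F] [NormedSpace ℝ F] {X : E → F} {u : E}
    (hX : ContDiffAt ℝ 2 X u) (w w' : E) :
    fderiv ℝ (fun v => fderiv ℝ X v w') u w = fderiv ℝ (fderiv ℝ X) u w w' := by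
  have hd : DifferentiableAt ℝ (fderiv ℝ X) u :=
    (hX.fderiv_right (m := 1) (by norm_num)).differentiableAt (by simp)
  have := (hd.hasFDerivAt.clm_apply (hasFDerivAt_const w' u)).fderiv
  rw [this]
  simp

theorem pd_pd {X : Euc n → Euc k} {u : Euc n} (hX : ContDiffAt ℝ 2 X u) (i j : Fin n) :
    pd i (pd j X) u = fderiv ℝ (fderiv ℝ X) u (EuclideanSpace.single i 1)
      (EuclideanSpace.single j 1) :=
  fderiv_fderiv_apply_const hX _ _

theorem toLp_eq_sum_single (c : Fin n → ℝ) :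
    (WithLp.toLp 2 c : Euc n) = ∑ i, c i • EuclideanSpace.single i (1 : ℝ) := by
  ext j
  simp [Finset.sum_apply, Pi.single_apply]

theorem eq_sum_single (w : Euc n) : w = ∑ i, w i • EuclideanSpace.single i (1 : ℝ) :=
  toLp_eq_sum_single (WithLp.ofLp w)

theorem secondFF_posDef_iff {X : Euc n → Euc k} {u : Euc n} (hX : ContDiffAt ℝ 2 X u)
    (v : Euc k) : (secondFF X v u).PosDef ↔
      ∀ w ≠ 0, ⟪fderiv ℝ (fderiv ℝ X) u w w, v⟫_ℝ < 0 := by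
  have hentry : ∀ i j, secondFF X v u i j = -⟪fderiv ℝ (fderiv ℝ X) u
      (EuclideanSpace.single i 1) (EuclideanSpace.single j 1), v⟫_ℝ := fun i j => by
    rw [← pd_pd hX]; rfl
  have hquad : ∀ c : Fin n → ℝ, star c ⬝ᵥ ((secondFF X v u).mulVec c) =
      -⟪fderiv ℝ (fderiv ℝ X) u (WithLp.toLp 2 c) (WithLp.toLp 2 c), v⟫_ℝ := by
    intro c
    rw [toLp_eq_sum_single]
    simp only [map_sum, map_smul, sum_apply, smul_apply, sum_inner,
      inner_smul_left, conj_trivial, dotProduct, Matrix.mulVec, hentry, Pi.star_apply,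
      star_trivial, Finset.mul_sum, ← Finset.sum_neg_distrib]
    rw [Finset.sum_comm]
    refine Finset.sum_congr rfl fun i _ => Finset.sum_congr rfl fun j _ => ?_
    ring
  have hherm : (secondFF X v u).IsHermitian := by
    ext i j
    rw [Matrix.conjTranspose_apply, star_trivial, hentry, hentry,
      (hX.isSymmSndFDerivAt (by simp)) (EuclideanSpace.single i 1)]
  rw [Matrix.posDef_iff_dotProduct_mulVec]
  constructor
  · rintro ⟨-, h⟩ w hw
    have h1 := h (x := WithLp.ofLp w) (fun h0 => hw (by ext i; simp [h0]))
    rw [hquad] at h1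
    simpa using h1
  · intro h
    refine ⟨hherm, fun c hc => ?_⟩
    rw [hquad]
    exact neg_pos.2 (h _ fun h0 => hc (by simpa using congrArg WithLp.ofLp h0))

/-- At a point with `Df(φ u) = 0` along `v`, second derivatives transform tensorially. -/
theorem inner_fderiv_fderiv_comp {E F G : Type*} [NormedAddCommGroup E] [NormedSpace ℝ E]
    [NormedAddCommGroup G] [NormedSpace ℝ G]
    [NormedAddCommGroup F] [InnerProductSpace ℝ F] {X : G → F} {φ : E → G} {u : E}
    (hX : ContDiffAt ℝ 2 X (φ u)) (hφ : ContDiffAt ℝ 2 φ u) {v : F}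
    (hv : ∀ w, ⟪fderiv ℝ X (φ u) w, v⟫_ℝ = 0) (w w' : E) :
    ⟪fderiv ℝ (fderiv ℝ (X ∘ φ)) u w w', v⟫_ℝ =
      ⟪fderiv ℝ (fderiv ℝ X) (φ u) (fderiv ℝ φ u w) (fderiv ℝ φ u w'), v⟫_ℝ := by
  have e1 : fderiv ℝ (X ∘ φ) =ᶠ[𝓝 u] fun z => (fderiv ℝ X (φ z)).comp (fderiv ℝ φ z) := by
    have h1 := hφ.continuousAt.eventually (hX.eventually (by simp))
    filter_upwards [h1, hφ.eventually (by simp)] with z hz1 hz2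
    exact fderiv_comp z (hz1.differentiableAt (by simp)) (hz2.differentiableAt (by simp))
  have hd1 : HasFDerivAt (fun z => fderiv ℝ X (φ z))
      ((fderiv ℝ (fderiv ℝ X) (φ u)).comp (fderiv ℝ φ u)) u :=
    ((hX.fderiv_right (m := 1) (by norm_num)).differentiableAt (by simp)).hasFDerivAt.comp u
      (hφ.differentiableAt (by simp)).hasFDerivAt
  have hd2 : HasFDerivAt (fderiv ℝ φ) (fderiv ℝ (fderiv ℝ φ) u) u :=
    ((hφ.fderiv_right (m := 1) (by norm_num)).differentiableAt (by simp)).hasFDerivAt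
  rw [e1.fderiv_eq, (hd1.clm_comp hd2).fderiv]
  -- The remaining term `dX (d²φ)` is tangential, hence killed by `v`.
  simp [inner_add_left, hv]

end SecondForm

/-! ### From manifold derivatives to chart representations -/

section Charts

variable {n m : ℕ} {M : Type*} [TopologicalSpace M] [ChartedSpace (Euc n) M]

theorem contDiffOn_comp_symm {k : ℕ∞ω} {F : Type*} [NormedAddCommGroup F] [NormedSpace ℝ F]
    {f : M → F} [IsManifold (𝓡 n) k M]
    (hf : ContMDiff (𝓡 n) 𝓘(ℝ, F) k f) {e : OpenPartialHomeomorph M (Euc n)}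
    (he : e ∈ IsManifold.maximalAtlas (𝓡 n) k M) : ContDiffOn ℝ k (f ∘ e.symm) e.target :=
  contMDiffOn_iff_contDiffOn.1 (hf.comp_contMDiffOn (contMDiffOn_symm_of_mem_maximalAtlas he))

theorem fact_finrank_euc (n : ℕ) : Fact (Module.finrank ℝ (Euc (n + 2)) = n + 1 + 1) :=
  ⟨finrank_euclideanSpace_fin⟩

theorem contMDiff_coe_comp {k : ℕ∞ω} {x : M → Sph n} (hx : ContMDiff (𝓡 n) (𝓡 (n + 1)) k x) :
    ContMDiff (𝓡 n) 𝓘(ℝ, Euc (n + 2)) k (fun q => (x q : Euc (n + 2))) := by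
  have := fact_finrank_euc n
  exact (contMDiff_coe_sphere (E := Euc (n + 2)) (n := n + 1)).comp hx

theorem contDiffOn_localRep {k : ℕ∞ω} [IsManifold (𝓡 n) k M]
    {x : M → Sph n} (hx : ContMDiff (𝓡 n) (𝓡 (n + 1)) k x) {e : OpenPartialHomeomorph M (Euc n)}
    (he : e ∈ IsManifold.maximalAtlas (𝓡 n) k M) : ContDiffOn ℝ k (localRep x e) e.target :=
  contDiffOn_comp_symm (contMDiff_coe_comp hx) he

theorem mdifferentiable_of_mem_maximalAtlas (hm : m ≠ 0) [IsManifold (𝓡 n) (m : ℕ∞ω) M]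
    {e : OpenPartialHomeomorph M (Euc n)}
    (he : e ∈ IsManifold.maximalAtlas (𝓡 n) (m : ℕ∞ω) M) : e.MDifferentiable (𝓡 n) (𝓡 n) :=
  ⟨(contMDiffOn_of_mem_maximalAtlas he).mdifferentiableOn (by exact_mod_cast hm),
    (contMDiffOn_symm_of_mem_maximalAtlas he).mdifferentiableOn (by exact_mod_cast hm)⟩

theorem mvfderiv_eq_fderiv {F : Type*} [NormedAddCommGroup F] [NormedSpace ℝ F]
    [IsManifold (𝓡 n) 1 M] {f : M → F} {e : OpenPartialHomeomorph M (Euc n)}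
    (he : e.MDifferentiable (𝓡 n) (𝓡 n))
    {p : M} (hp : p ∈ e.source) (hf : MDifferentiableAt (𝓡 n) 𝓘(ℝ, F) f p)
    (ξ : TangentSpace (𝓡 n) p) :
    mvfderiv (𝓡 n) f p ξ = fderiv ℝ (f ∘ e.symm) (e p) (mfderiv (𝓡 n) (𝓡 n) e p ξ) := by
  have hf' : MDifferentiableAt (𝓡 n) 𝓘(ℝ, F) f (e.symm (e p)) := by rwa [e.left_inv hp]
  have hd : DifferentiableAt ℝ (f ∘ e.symm) (e p) := mdifferentiableAt_iff_differentiableAt.1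
    (hf'.comp (e p) (he.mdifferentiableAt_symm (e.map_source hp)))
  have h1 : HasMFDerivAt (𝓡 n) 𝓘(ℝ, F) ((f ∘ e.symm) ∘ e) p
      ((fderiv ℝ (f ∘ e.symm) (e p)).comp (mfderiv (𝓡 n) (𝓡 n) e p)) :=
    hd.hasFDerivAt.hasMFDerivAt.comp p (he.mdifferentiableAt hp).hasMFDerivAt
  have h2 : f =ᶠ[𝓝 p] (f ∘ e.symm) ∘ e := by
    filter_upwards [e.open_source.mem_nhds hp] with q hq
    simp [e.left_inv hq]
  have h3 := (h1.congr_of_eventuallyEq h2).mfderiv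
  rw [mvfderiv, h3]
  rfl

theorem isUnitNormal_iff [IsManifold (𝓡 n) 1 M] {x : M → Sph n}
    (hx : ContMDiff (𝓡 n) (𝓡 (n + 1)) 1 x) {e : OpenPartialHomeomorph M (Euc n)}
    (he : e.MDifferentiable (𝓡 n) (𝓡 n)) {p : M} (hp : p ∈ e.source) {v : Sph n} :
    IsUnitNormal x p v ↔ ⟪(x p : Euc (n + 2)), (v : Euc (n + 2))⟫_ℝ = 0 ∧
      ∀ w, ⟪fderiv ℝ (localRep x e) (e p) w, (v : Euc (n + 2))⟫_ℝ = 0 := by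
  have hd := (contMDiff_coe_comp hx).mdifferentiable one_ne_zero p
  refine and_congr_right fun _ => ?_
  constructor
  · intro h w
    obtain ⟨ξ, hξ⟩ := he.mfderiv_surjective hp w
    have := h ξ
    rw [mvfderiv_eq_fderiv he hp hd ξ, hξ] at this
    exact this
  · intro h ξ
    rw [mvfderiv_eq_fderiv he hp hd ξ]
    exact h _

theorem injective_mfderiv_iff [IsManifold (𝓡 n) 1 M] {x : M → Sph n}
    (hx : ContMDiff (𝓡 n) (𝓡 (n + 1)) 1 x) {e : OpenPartialHomeomorph M (Euc n)}
    (he : e.MDifferentiable (𝓡 n) (𝓡 n)) {p : M} (hp : p ∈ e.source) :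
    Function.Injective (mfderiv (𝓡 n) (𝓡 (n + 1)) x p) ↔
      Function.Injective (fderiv ℝ (localRep x e) (e p)) := by
  have := fact_finrank_euc n
  have hd := (contMDiff_coe_comp hx).mdifferentiable one_ne_zero p
  have h1 : ∀ ξ, mvfderiv (𝓡 n) (fun q => (x q : Euc (n + 2))) p ξ =
      mvfderiv (𝓡 (n + 1)) (fun y : Sph n => (y : Euc (n + 2))) (x p)
        (mfderiv (𝓡 n) (𝓡 (n + 1)) x p ξ) := by
    intro ξ
    have hc : MDifferentiableAt (𝓡 (n + 1)) 𝓘(ℝ, Euc (n + 2))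
        (fun y : Sph n => (y : Euc (n + 2))) (x p) :=
      (contMDiff_coe_sphere (E := Euc (n + 2)) (n := n + 1) (m := 1)).mdifferentiable one_ne_zero _
    have h2 := mfderiv_comp p hc (hx.mdifferentiable one_ne_zero p)
    have h3 := congrArg (fun L => L ξ) h2
    exact h3
  have h2 : Function.Injective (mvfderiv (𝓡 (n + 1)) (fun y : Sph n => (y : Euc (n + 2))) (x p)) :=
    injective_mvfderiv_subtypeVal_sphere (E := Euc (n + 2)) (n := n + 1) (x p)
  constructor
  · intro h w w' hww
    obtain ⟨ξ, rfl⟩ := he.mfderiv_surjective hp w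
    obtain ⟨ξ', rfl⟩ := he.mfderiv_surjective hp w'
    have e1 := (mvfderiv_eq_fderiv he hp hd ξ).trans
      (hww.trans (mvfderiv_eq_fderiv he hp hd ξ').symm)
    rw [h1, h1] at e1
    rw [h (h2 e1)]
  · intro h ξ ξ' hξ
    apply he.mfderiv_injective hp
    apply h
    refine (mvfderiv_eq_fderiv he hp hd ξ).symm.trans (Eq.trans ?_ (mvfderiv_eq_fderiv he hp hd ξ'))
    rw [h1, h1, hξ]

end Charts

/-- Unit normals agree up to sign, and the sign is read off from the Hessian in one nonzero
direction, which exists because `n ≥ 1`. -/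
theorem eq_of_definite_unit_normals {n : ℕ} (hn : 1 ≤ n) {X : Euc n → Euc (n + 2)} {u : Euc n}
    {a b : Euc (n + 2)} (hD : Function.Injective (fderiv ℝ X u)) (hx : ‖X u‖ = 1)
    (hDx : ∀ w, ⟪fderiv ℝ X u w, X u⟫_ℝ = 0)
    (ha : ‖a‖ = 1) (hb : ‖b‖ = 1) (hxa : ⟪X u, a⟫_ℝ = 0) (hxb : ⟪X u, b⟫_ℝ = 0)
    (hDa : ∀ w, ⟪fderiv ℝ X u w, a⟫_ℝ = 0) (hDb : ∀ w, ⟪fderiv ℝ X u w, b⟫_ℝ = 0)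
    (hna : ∀ w ≠ 0, ⟪fderiv ℝ (fderiv ℝ X) u w w, a⟫_ℝ < 0)
    (hnb : ∀ w ≠ 0, ⟪fderiv ℝ (fderiv ℝ X) u w w, b⟫_ℝ < 0) : a = b := by
  have h1 := eq_smul_of_orthogonal hD hx hb hxb hDx hDb (z := a)
    (by rw [real_inner_comm]; exact hxa) hDa
  have h2 : ‖⟪a, b⟫_ℝ‖ = 1 := by
    have := congrArg norm h1
    rw [norm_smul, ha, hb, mul_one] at this
    exact this.symm
  have hw : (EuclideanSpace.single ⟨0, hn⟩ 1 : Euc n) ≠ 0 := by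
    intro h0
    simpa using congrArg norm h0
  have h3 := hna _ hw
  rw [h1, inner_smul_right] at h3
  have h4 := hnb _ hw
  rcases eq_or_eq_neg_of_abs_eq (h2 : |⟪a, b⟫_ℝ| = 1) with h5 | h5
  · rw [h1, h5, one_smul]
  · rw [h5] at h3
    linarith

/-! ### The global field of definite normals and its smoothness -/

section DualMap

variable {n : ℕ} {M : Type*} [TopologicalSpace M] [ChartedSpace (Euc n) M]

omit [ChartedSpace (Euc n) M] in
theorem localRep_apply {x : M → Sph n} {e : OpenPartialHomeomorph M (Euc n)} {p : M}
    (hp : p ∈ e.source) : localRep x e (e p) = x p := by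
  simp only [localRep, e.left_inv hp]

omit [ChartedSpace (Euc n) M] in
theorem norm_localRep (x : M → Sph n) (e : OpenPartialHomeomorph M (Euc n)) (u : Euc n) :
    ‖localRep x e u‖ = 1 := norm_eq_of_mem_sphere _

/-- Convexity is postulated in the preferred chart only. The Hessian along a normal is tensorial,
and the derivative of the transition map is injective because the injective derivative of `localRep
x e` factors through it. -/
theorem second_neg_of_chart {m : ℕ} (hm : 2 ≤ m) [IsManifold (𝓡 n) (m : ℕ∞ω) M] {x : M → Sph n}
    (hx : ContMDiff (𝓡 n) (𝓡 (n + 1)) (m : ℕ∞ω) x) {c e : OpenPartialHomeomorph M (Euc n)}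
    (hc : c ∈ IsManifold.maximalAtlas (𝓡 n) (m : ℕ∞ω) M)
    (he : e ∈ IsManifold.maximalAtlas (𝓡 n) (m : ℕ∞ω) M) {p : M} (hpc : p ∈ c.source)
    (hpe : p ∈ e.source) {v : Euc (n + 2)}
    (himm : Function.Injective (fderiv ℝ (localRep x e) (e p)))
    (hv : ∀ w, ⟪fderiv ℝ (localRep x c) (c p) w, v⟫_ℝ = 0)
    (h : ∀ w ≠ 0, ⟪fderiv ℝ (fderiv ℝ (localRep x c)) (c p) w w, v⟫_ℝ < 0) :
    ∀ w ≠ 0, ⟪fderiv ℝ (fderiv ℝ (localRep x e)) (e p) w w, v⟫_ℝ < 0 := by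
  have h2m : (2 : ℕ∞ω) ≤ m := by exact_mod_cast hm
  have hφ : ContDiffAt ℝ 2 (c ∘ e.symm) (e p) := by
    have h1 : ContMDiffAt (𝓡 n) (𝓡 n) (m : ℕ∞ω) e.symm (e p) :=
      contMDiffAt_symm_of_mem_maximalAtlas he (e.map_source hpe)
    have h2 : ContMDiffAt (𝓡 n) (𝓡 n) (m : ℕ∞ω) c (e.symm (e p)) :=
      contMDiffAt_of_mem_maximalAtlas hc (by rwa [e.left_inv hpe])
    exact (contMDiffAt_iff_contDiffAt.1 (h2.comp (e p) h1)).of_le h2m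
  have hφp : (c ∘ e.symm) (e p) = c p := by simp [e.left_inv hpe]
  have hX : ContDiffAt ℝ 2 (localRep x c) (c p) :=
    ((contDiffOn_localRep hx hc).contDiffAt (c.open_target.mem_nhds (c.map_source hpc))).of_le h2m
  have heq : localRep x e =ᶠ[𝓝 (e p)] localRep x c ∘ (c ∘ e.symm) := by
    have h1 : e.symm ⁻¹' c.source ∈ 𝓝 (e p) :=
      (e.continuousAt_symm (e.map_source hpe)) (by
        rw [e.left_inv hpe]; exact c.open_source.mem_nhds hpc)
    filter_upwards [h1] with z hz
    have hz' : e.symm z ∈ c.source := hz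
    simp [localRep, c.left_inv hz']
  intro w hw
  rw [heq.fderiv.fderiv_eq, inner_fderiv_fderiv_comp (by rwa [hφp]) hφ (by rwa [hφp]), hφp]
  refine h _ fun h0 => hw (himm ?_)
  rw [map_zero, heq.fderiv_eq, fderiv_comp _ (by
    rw [hφp]; exact hX.differentiableAt (by simp)) (hφ.differentiableAt (by simp)),
    ContinuousLinearMap.comp_apply, h0, map_zero]

/-- `ν` is a definite unit normal field of the hypersurface `x`, in every chart of class `C^m`. -/
structure IsDualMap (m : ℕ) (x ν : M → Sph n) : Prop where
  left : ContMDiff (𝓡 n) (𝓡 (n + 1)) 2 x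
  right : ContMDiff (𝓡 n) (𝓡 (n + 1)) 2 ν
  pair : ∀ e ∈ IsManifold.maximalAtlas (𝓡 n) (m : ℕ∞ω) M,
    IsDualPair (localRep x e) (localRep ν e) e.target

theorem IsDualMap.symm {m : ℕ} {x ν : M → Sph n} (h : IsDualMap m x ν) : IsDualMap m ν x :=
  ⟨h.right, h.left, fun e he => (h.pair e he).symm⟩

theorem contMDiff_of_contDiffOn_localRep {k : ℕ∞ω} [IsManifold (𝓡 n) k M] {ν : M → Sph n}
    (h : ∀ p, ContDiffAt ℝ k (localRep ν (chartAt (Euc n) p)) (chartAt (Euc n) p p)) :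
    ContMDiff (𝓡 n) (𝓡 (n + 1)) k ν := by
  have := fact_finrank_euc n
  have h1 : ContMDiff (𝓡 n) 𝓘(ℝ, Euc (n + 2)) k (fun q => (ν q : Euc (n + 2))) := by
    intro p
    set e := chartAt (Euc n) p
    have hp : p ∈ e.source := mem_chart_source _ p
    have h2 : ContMDiffAt (𝓡 n) (𝓡 n) k e p :=
      contMDiffAt_of_mem_maximalAtlas (IsManifold.chart_mem_maximalAtlas p) hp
    have h3 : ContMDiffAt (𝓡 n) 𝓘(ℝ, Euc (n + 2)) k (localRep ν e ∘ e) p :=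
      (h p).contMDiffAt.comp p h2
    refine h3.congr_of_eventuallyEq ?_
    filter_upwards [e.open_source.mem_nhds hp] with q hq
    exact (localRep_apply hq).symm
  exact h1.codRestrict_sphere (n := n + 1) fun q => (ν q).2

theorem exists_isDualMap {m : ℕ} (hn : 1 ≤ n) (hm : 3 ≤ m) [IsManifold (𝓡 n) (m : ℕ∞ω) M]
    {x : M → Sph n} (hx : IsStrictlyConvexHypersurface m x) :
    ∃ ν : M → Sph n, IsDualMap m x ν ∧ ContMDiff (𝓡 n) (𝓡 (n + 1)) ((m - 1 : ℕ) : ℕ∞ω) ν := by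
  have h1m : (1 : ℕ∞ω) ≤ m := by exact_mod_cast (by omega : 1 ≤ m)
  have h2m : (2 : ℕ∞ω) ≤ m := by exact_mod_cast (by omega : 2 ≤ m)
  -- Here `m ≥ 3` enters: the normal loses one derivative and must still be C² to have a second
  -- fundamental form.
  have h2k : (2 : ℕ∞ω) ≤ (m - 1 : ℕ) := by exact_mod_cast (by omega : 2 ≤ m - 1)
  have hkm : ((m - 1 : ℕ) : ℕ∞ω) ≤ m := by exact_mod_cast Nat.sub_le m 1
  have := IsManifold.of_le (I := 𝓡 n) (M := M) h1m
  have := IsManifold.of_le (I := 𝓡 n) (M := M) hkm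
  -- A pointwise choice; its smoothness comes from uniqueness of the definite normal.
  choose ν hν hpos using hx.convex
  have hX2 : ∀ e ∈ IsManifold.maximalAtlas (𝓡 n) (m : ℕ∞ω) M, ∀ u ∈ e.target,
      ContDiffAt ℝ m (localRep x e) u := fun e he u hu =>
    (contDiffOn_localRep hx.contMDiff he).contDiffAt (e.open_target.mem_nhds hu)
  have hmd : ∀ e ∈ IsManifold.maximalAtlas (𝓡 n) (m : ℕ∞ω) M, e.MDifferentiable (𝓡 n) (𝓡 n) :=
    fun e he => mdifferentiable_of_mem_maximalAtlas (by omega) he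
  have key : ∀ e ∈ IsManifold.maximalAtlas (𝓡 n) (m : ℕ∞ω) M, ∀ u ∈ e.target,
      Function.Injective (fderiv ℝ (localRep x e) u) ∧
      (∀ w, ⟪fderiv ℝ (localRep x e) u w, localRep x e u⟫_ℝ = 0) ∧
      ⟪localRep x e u, localRep ν e u⟫_ℝ = 0 ∧
      (∀ w, ⟪fderiv ℝ (localRep x e) u w, localRep ν e u⟫_ℝ = 0) ∧
      ∀ w ≠ 0, ⟪fderiv ℝ (fderiv ℝ (localRep x e)) u w w, localRep ν e u⟫_ℝ < 0 := by
    intro e he u hu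
    obtain ⟨p, hp, rfl⟩ : ∃ p ∈ e.source, e p = u :=
      ⟨e.symm u, e.map_target hu, e.right_inv hu⟩
    set c := chartAt (Euc n) p with hc_def
    have hc : c ∈ IsManifold.maximalAtlas (𝓡 n) (m : ℕ∞ω) M := IsManifold.chart_mem_maximalAtlas p
    have hpc : p ∈ c.source := mem_chart_source _ p
    have h1 := (isUnitNormal_iff (hx.contMDiff.of_le h1m) (hmd e he) hp).1 (hν p)
    have h2 := (isUnitNormal_iff (hx.contMDiff.of_le h1m) (hmd c hc) hpc).1 (hν p)
    have hinj := (injective_mfderiv_iff (hx.contMDiff.of_le h1m) (hmd e he) hp).1 (hx.immersion p)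
    refine ⟨hinj, inner_fderiv_self ((hX2 e he _ hu).differentiableAt (by simp; omega))
      (Eventually.of_forall fun v => norm_localRep x e v), ?_, ?_, ?_⟩
    · rw [localRep_apply hp, localRep_apply hp]; exact h1.1
    · rw [localRep_apply hp]; exact h1.2
    · rw [localRep_apply hp]
      exact second_neg_of_chart (by omega) hx.contMDiff hc he hpc hp hinj h2.2
        ((secondFF_posDef_iff ((hX2 c hc _ (c.map_source hpc)).of_le h2m) _).1 (hpos p))
  have smooth : ∀ e ∈ IsManifold.maximalAtlas (𝓡 n) (m : ℕ∞ω) M, ∀ u ∈ e.target,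
      ContDiffAt ℝ (m - 1 : ℕ) (localRep ν e) u := by
    intro e he u hu
    obtain ⟨k1, k2, k3, k4, k5⟩ := key e he u hu
    obtain ⟨N, hN, hNu, hNev⟩ := exists_local_unit_normal (k := m - 1)
      (by rw [Nat.sub_add_cancel (by omega)]; exact hX2 e he u hu)
      (Eventually.of_forall fun v => norm_localRep x e v) k1 k2 (norm_localRep ν e u) k3 k4
    refine hN.congr_of_eventuallyEq ?_
    -- The smooth local normal stays definite near `u` and therefore coincides with `ν` there.
    have hneg := eventually_forall_second_neg ((hX2 e he u hu).of_le h2m) hN.continuousAt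
      (by rwa [hNu])
    have hdiag : Tendsto (fun z : Euc n => (z, z)) (𝓝 u) (𝓝 (u, u)) :=
      (continuous_id.prodMk continuous_id).tendsto u
    filter_upwards [hNev, hdiag.eventually hneg, e.open_target.mem_nhds hu] with z hz hzn hzt
    obtain ⟨l1, l2, l3, l4, l5⟩ := key e he z hzt
    exact eq_of_definite_unit_normals hn l1 (norm_localRep x e z) l2 (norm_localRep ν e z) hz.1
      l3 hz.2.1 l4 hz.2.2 l5 hzn
  have hνs : ContMDiff (𝓡 n) (𝓡 (n + 1)) ((m - 1 : ℕ) : ℕ∞ω) ν :=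
    contMDiff_of_contDiffOn_localRep fun p => smooth _ (IsManifold.chart_mem_maximalAtlas p) _
      (mem_chart_target _ p)
  refine ⟨ν, ⟨hx.contMDiff.of_le h2m, hνs.of_le h2k, fun e he => ?_⟩, hνs⟩
  exact {
    isOpen := e.open_target
    left := fun u hu => ((hX2 e he u hu).of_le h2m).contDiffWithinAt
    right := fun u hu => ((smooth e he u hu).of_le h2k).contDiffWithinAt
    norm_left := fun u _ => norm_localRep x e u
    norm_right := fun u _ => norm_localRep ν e u
    inner_eq := fun u hu => (key e he u hu).2.2.1
    normal := fun u hu => (key e he u hu).2.2.2.1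
    neg := fun u hu => (key e he u hu).2.2.2.2 }

end DualMap

/-! ### Characteristic roots of an inverse matrix -/

section Roots

open Polynomial

theorem roots_reverse_X_sub_C {K : Type*} [Field K] {a : K} (ha : a ≠ 0) :
    (X - C a).reverse.roots = {a⁻¹} := by
  have h1 : (X - C a : K[X]).reverse = C (-a) * X + C 1 := by
    have h2 : (X - C a : K[X]) = C (-a) + 1 * X := by rw [C_neg]; ring
    rw [h2, reverse_C_add, one_mul, natDegree_X, pow_one]
    have h3 : (X : K[X]).reverse = 1 := by
      have := reverse_mul_X (1 : K[X])
      rw [one_mul] at this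
      rw [this, ← C_1, reverse_C]
    rw [h3, C_1]
  rw [h1, roots_C_mul_X_add_C _ (neg_ne_zero.2 ha)]
  rw [mul_one, inv_neg, neg_neg]

/-- Write `f` as a product of linear factors and a rootless `q`. Reversal is multiplicative, inverts
the root of each linear factor and keeps `q` rootless, so `f` need not split. -/
theorem roots_reverse {K : Type*} [Field K] {f : K[X]} (hf : f.coeff 0 ≠ 0) :
    f.reverse.roots = f.roots.map (·⁻¹) := by
  obtain ⟨q, hq, -, hq0⟩ := exists_prod_multiset_X_sub_C_mul f
  have hf0 : f ≠ 0 := by rintro rfl; simp at hf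
  have hqne : q ≠ 0 := by rintro rfl; simp at hq; exact hf0 hq.symm
  have hroots : ∀ s : Multiset K, (∀ a ∈ s, a ≠ 0) →
      (s.map fun a => X - C a).prod.reverse.roots = s.map (·⁻¹) := by
    intro s
    induction s using Multiset.induction with
    | empty => intro _; simpa using congrArg roots (reverse_C (1 : K))
    | cons a s ih =>
      intro hs
      have hne : ((X - C a) * (s.map fun a => X - C a).prod).reverse ≠ 0 := by
        rw [Ne, reverse_eq_zero]
        exact mul_ne_zero (X_sub_C_ne_zero a) (by
          refine Multiset.prod_ne_zero fun h0 => ?_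
          obtain ⟨b, -, hb⟩ := Multiset.mem_map.1 h0
          exact X_sub_C_ne_zero b hb)
      rw [Multiset.map_cons, Multiset.prod_cons]
      rw [reverse_mul_of_domain] at hne ⊢
      rw [roots_mul hne, roots_reverse_X_sub_C (hs a (by simp)),
        ih fun b hb => hs b (by simp [hb])]
      simp
  have hne0 : ∀ a ∈ f.roots, a ≠ 0 := by
    rintro a ha rfl
    exact hf (by rw [coeff_zero_eq_eval_zero]; exact (mem_roots hf0).1 ha)
  have hqr : q.reverse.roots = 0 := by
    rw [Multiset.eq_zero_iff_forall_notMem]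
    intro a ha
    have ha' : q.reverse.eval a = 0 := (mem_roots'.1 ha).2
    have hane : a ≠ 0 := by
      rintro rfl
      rw [← coeff_zero_eq_eval_zero, coeff_zero_reverse, leadingCoeff_eq_zero] at ha'
      exact hqne ha'
    have := invertibleOfNonzero (inv_ne_zero hane)
    have h1 := (eval₂_reverse_eq_zero_iff (RingHom.id K) a⁻¹ q).1 (by
      rw [invOf_eq_inv, inv_inv]; exact ha')
    have h2 : a⁻¹ ∈ q.roots := (mem_roots hqne).2 h1
    rw [hq0] at h2
    exact absurd h2 (Multiset.notMem_zero _)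
  have hrev : f.reverse ≠ 0 := by rwa [Ne, reverse_eq_zero]
  have hmul : f.reverse = (f.roots.map fun a => X - C a).prod.reverse * q.reverse := by
    rw [← reverse_mul_of_domain, hq]
  rw [hmul] at hrev
  conv_lhs => rw [hmul]
  rw [roots_mul hrev, hqr, add_zero, hroots _ hne0]

/-- Up to a nonzero constant, the characteristic polynomial of `A⁻¹` is the reverse of that of `A`.
-/
theorem roots_charpoly_inv {K ι : Type*} [Field K] [Fintype ι] [DecidableEq ι]
    {A : Matrix ι ι K} (hA : IsUnit A) :
    A⁻¹.charpoly.roots = A.charpoly.roots.map (·⁻¹) := by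
  have hdet : A.det ≠ 0 := ((Matrix.isUnit_iff_isUnit_det A).1 hA).ne_zero
  rw [Matrix.charpoly_inv A hA, ← Matrix.reverse_charpoly, Ring.inverse_eq_inv',
    show ((-1 : K[X]) ^ Fintype.card ι * C A.det⁻¹) = C ((-1) ^ Fintype.card ι * A.det⁻¹) by simp,
    roots_C_mul _ (mul_ne_zero (pow_ne_zero _ (by simp)) (inv_ne_zero hdet)), roots_reverse]
  intro h0
  rw [Matrix.det_eq_sign_charpoly_coeff, h0, mul_zero] at hdet
  exact hdet rfl

end Roots

/-! ### Gauss formula, dual metric and dual curvatures -/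

namespace IsDualPair

variable {n : ℕ} {X N : Euc n → Euc (n + 2)} {U : Set (Euc n)}

section

variable (h : IsDualPair X N U) {u : Euc n} (hu : u ∈ U)
include h hu

theorem second_tangent (w w' : Euc n) :
    ⟪fderiv ℝ (fderiv ℝ X) u w w', X u⟫_ℝ = -⟪fderiv ℝ X u w', fderiv ℝ X u w⟫_ℝ := by
  have hd : DifferentiableAt ℝ (fun v => fderiv ℝ X v w') u :=
    (h.differentiableAt_fderiv_left hu).clm_apply (differentiableAt_const w')
  have := inner_fderiv_add_eq_zero hd (h.differentiableAt_left hu)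
    (by filter_upwards [h.isOpen.mem_nhds hu] with v hv using h.tangent_left hv w') w
  rw [fderiv_fderiv_apply_const (h.contDiffAt_left hu)] at this
  linarith

theorem secondFF_apply (i j : Fin n) : secondFF X (N u) u i j = ⟪pd i N u, pd j X u⟫_ℝ := by
  change -⟪pd i (pd j X) u, N u⟫_ℝ = _
  rw [pd_pd (h.contDiffAt_left hu), h.second_left hu, neg_neg, real_inner_comm]
  rfl

theorem secondFF_posDef : (secondFF X (N u) u).PosDef :=
  (secondFF_posDef_iff (h.contDiffAt_left hu) _).2 (h.neg u hu)

theorem secondFF_comm (i j : Fin n) : secondFF X (N u) u i j = secondFF X (N u) u j i := by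
  have := (h.secondFF_posDef hu).1.apply j i
  simpa using this

theorem secondFF_dual : secondFF N (X u) u = secondFF X (N u) u := by
  ext i j
  rw [h.symm.secondFF_apply hu, h.secondFF_comm hu, h.secondFF_apply hu, real_inner_comm]

theorem linearIndependent_pd : LinearIndependent ℝ fun i => pd i X u := by
  have h1 : LinearIndependent ℝ fun i : Fin n => (EuclideanSpace.single i (1 : ℝ) : Euc n) := by
    have hb : (fun i : Fin n => (EuclideanSpace.single i (1 : ℝ) : Euc n)) =
        (EuclideanSpace.basisFun (Fin n) ℝ).toBasis := by
      funext i
      simp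
    rw [hb]
    exact (EuclideanSpace.basisFun (Fin n) ℝ).toBasis.linearIndependent
  exact h1.map' (fderiv ℝ X u).toLinearMap (LinearMap.ker_eq_bot.2 (h.injective_left hu))

theorem metric_posDef : (metric X u).PosDef :=
  Matrix.posDef_gram_of_linearIndependent (h.linearIndependent_pd hu)

theorem isUnit_metric : IsUnit (metric X u) := (h.metric_posDef hu).isUnit

theorem eq_zero_of_orthogonal {z : Euc (n + 2)} (hzX : ⟪z, X u⟫_ℝ = 0) (hzN : ⟪z, N u⟫_ℝ = 0)
    (hz : ∀ l, ⟪z, pd l X u⟫_ℝ = 0) : z = 0 := by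
  refine eq_zero_of_orthogonal_frame (h.frame_injective hu) hzX hzN fun w => ?_
  rw [eq_sum_single w, map_sum, inner_sum]
  refine Finset.sum_eq_zero fun i _ => ?_
  rw [map_smul, inner_smul_right]
  have : ⟪z, fderiv ℝ X u (EuclideanSpace.single i 1)⟫_ℝ = 0 := hz i
  rw [this, mul_zero]

theorem pd_metric (i j l : Fin n) :
    pd i (fun w => metric X w j l) u = ⟪pd i (pd j X) u, pd l X u⟫_ℝ +
      ⟪pd i (pd l X) u, pd j X u⟫_ℝ := by
  have hd : ∀ k, DifferentiableAt ℝ (pd k X) u := fun k =>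
    (h.differentiableAt_fderiv_left hu).clm_apply (differentiableAt_const _)
  have h1 := fderiv_inner_apply ℝ (hd j) (hd l) (EuclideanSpace.single i 1)
  change fderiv ℝ (fun w => ⟪pd j X w, pd l X w⟫_ℝ) u (EuclideanSpace.single i 1) = _
  rw [h1, add_comm, real_inner_comm (pd j X u)]
  rfl

/-- By symmetry of second derivatives the three derivatives of the metric add up to `2⟪X_ij, X_l⟫`.
-/
theorem christoffel_eq (k i j : Fin n) :
    christoffel X u k i j = ((metric X u)⁻¹.mulVec fun l => ⟪pd i (pd j X) u, pd l X u⟫_ℝ) k := by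
  have hs : ∀ a b, pd a (pd b X) u = pd b (pd a X) u := fun a b => by
    rw [pd_pd (h.contDiffAt_left hu), pd_pd (h.contDiffAt_left hu), h.second_symm hu]
  rw [christoffel, Matrix.mulVec, dotProduct, Finset.mul_sum]
  refine Finset.sum_congr rfl fun l _ => ?_
  rw [h.pd_metric hu, h.pd_metric hu, h.pd_metric hu, hs j i, hs l i, hs l j]
  ring

/-- The Gauss formula of a hypersurface of the sphere. -/
theorem covHess_eq (i j : Fin n) :
    covHess X u i j = -(metric X u i j) • X u - secondFF X (N u) u i j • N u := by
  have hXN : ⟪N u, X u⟫_ℝ = 0 := by rw [real_inner_comm, h.inner_eq u hu]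
  have hXX : ⟪X u, X u⟫_ℝ = 1 := by rw [real_inner_self_eq_norm_sq, h.norm_left u hu, one_pow]
  have hNN : ⟪N u, N u⟫_ℝ = 1 := by rw [real_inner_self_eq_norm_sq, h.norm_right u hu, one_pow]
  have hpX : ∀ k, ⟪pd k X u, X u⟫_ℝ = 0 := fun k => h.tangent_left hu _
  have hpN : ∀ k, ⟪pd k X u, N u⟫_ℝ = 0 := fun k => h.normal u hu _
  -- Compare products with `X`, `N` and the tangent vectors; the Christoffel term removes exactly
  -- the tangential part.
  refine sub_eq_zero.1 (h.eq_zero_of_orthogonal hu ?_ ?_ fun l => ?_)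
  · have h1 : ⟪pd i (pd j X) u, X u⟫_ℝ = -metric X u i j := by
      rw [pd_pd (h.contDiffAt_left hu), h.second_tangent hu, real_inner_comm]
      rfl
    simp only [covHess, inner_sub_left, sum_inner, inner_smul_left, conj_trivial, hpX, h1, hXX,
      hXN]
    simp
  · have h1 : ⟪pd i (pd j X) u, N u⟫_ℝ = -secondFF X (N u) u i j := (neg_neg _).symm
    simp only [covHess, inner_sub_left, sum_inner, inner_smul_left, conj_trivial, hpN, h1, hNN,
      h.inner_eq u hu]
    simp
  · have h2 : ∑ k, christoffel X u k i j * ⟪pd k X u, pd l X u⟫_ℝ = ⟪pd i (pd j X) u, pd l X u⟫_ℝ := by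
      have h3 : (metric X u).mulVec ((metric X u)⁻¹.mulVec
          fun l => ⟪pd i (pd j X) u, pd l X u⟫_ℝ) l = ⟪pd i (pd j X) u, pd l X u⟫_ℝ := by
        rw [Matrix.mulVec_mulVec, Matrix.mul_nonsing_inv _
          ((Matrix.isUnit_iff_isUnit_det _).1 (h.isUnit_metric hu)), Matrix.one_mulVec]
      rw [← h3, Matrix.mulVec, dotProduct]
      refine Finset.sum_congr rfl fun k _ => ?_
      rw [h.christoffel_eq hu, mul_comm, real_inner_comm]
      rfl
    have e1 : ⟪X u, pd l X u⟫_ℝ = 0 := by rw [real_inner_comm, hpX]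
    have e2 : ⟪N u, pd l X u⟫_ℝ = 0 := by rw [real_inner_comm, hpN]
    simp only [covHess, inner_sub_left, sum_inner, inner_smul_left, conj_trivial, h2, e1, e2]
    simp

/-- Weingarten's equation expresses `N_i` as `∑ (h g⁻¹)_ik X_k`; pairing with `N_j` produces the
second factor `h`. -/
theorem metric_dual :
    metric N u = secondFF X (N u) u * (metric X u)⁻¹ * secondFF X (N u) u := by
  have hpX : ∀ k, ⟪pd k X u, X u⟫_ℝ = 0 := fun k => h.tangent_left hu _
  have hpN : ∀ k, ⟪pd k X u, N u⟫_ℝ = 0 := fun k => h.normal u hu _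
  have hqX : ∀ k, ⟪pd k N u, X u⟫_ℝ = 0 := fun k => h.conormal hu _
  have hqN : ∀ k, ⟪pd k N u, N u⟫_ℝ = 0 := fun k => h.symm.tangent_left hu _
  set c := secondFF X (N u) u * (metric X u)⁻¹ with hc
  have hN : ∀ i, pd i N u = ∑ k, c i k • pd k X u := by
    intro i
    refine sub_eq_zero.1 (h.eq_zero_of_orthogonal hu ?_ ?_ fun l => ?_)
    · simp [inner_sub_left, sum_inner, inner_smul_left, hqX, hpX]
    · simp [inner_sub_left, sum_inner, inner_smul_left, hqN, hpN]
    · have h1 : (c * metric X u) i l = secondFF X (N u) u i l := by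
        rw [hc, Matrix.mul_assoc, Matrix.nonsing_inv_mul _
          ((Matrix.isUnit_iff_isUnit_det _).1 (h.isUnit_metric hu)), Matrix.mul_one]
      rw [h.secondFF_apply hu, Matrix.mul_apply] at h1
      simp only [inner_sub_left, sum_inner, inner_smul_left, conj_trivial, ← h1]
      exact sub_self _
  ext i j
  rw [Matrix.mul_apply]
  change ⟪pd i N u, pd j N u⟫_ℝ = _
  conv_lhs => rw [hN i]
  rw [sum_inner]
  refine Finset.sum_congr rfl fun k _ => ?_
  rw [inner_smul_left, conj_trivial, h.secondFF_comm hu, h.secondFF_apply hu, real_inner_comm]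

/-- Since the dual metric is `h g⁻¹ h` and the dual form is `h`, the dual mixed tensor is `(g⁻¹
h)⁻¹`. -/
theorem principalCurvatures_dual : principalCurvatures N (X u) u =
    (principalCurvatures X (N u) u).map (fun κ => κ⁻¹) := by
  have hg := (Matrix.isUnit_iff_isUnit_det _).1 (h.isUnit_metric hu)
  have hh := (Matrix.isUnit_iff_isUnit_det _).1 (h.secondFF_posDef hu).isUnit
  have key : (metric N u)⁻¹ * secondFF N (X u) u = ((metric X u)⁻¹ * secondFF X (N u) u)⁻¹ := by
    rw [h.secondFF_dual hu, h.metric_dual hu, Matrix.mul_inv_rev, Matrix.mul_inv_rev,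
      Matrix.mul_inv_rev, Matrix.nonsing_inv_nonsing_inv _ hg, Matrix.mul_assoc, Matrix.mul_assoc,
      Matrix.nonsing_inv_mul _ hh, Matrix.mul_one]
  rw [principalCurvatures, principalCurvatures, key, roots_charpoly_inv]
  refine (Matrix.isUnit_iff_isUnit_det _).2 ?_
  rw [Matrix.det_mul]
  exact ((Matrix.isUnit_nonsing_inv_det _ hg)).mul hh

end

end IsDualPair

/-! ### Points accessible from a set -/

/-- Every neighbourhood of `y` contains a neighbourhood meeting `O` in a path connected set. -/
def IsAccessible {T : Type*} [TopologicalSpace T] (O : Set T) (y : T) : Prop :=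
  ∀ V ∈ 𝓝 y, ∃ W ∈ 𝓝 y, W ⊆ V ∧ IsPathConnected (W ∩ O)

namespace IsAccessible

variable {T : Type*} [TopologicalSpace T] {O O' : Set T} {y : T}

theorem mem_closure (h : IsAccessible O y) : y ∈ closure O := by
  refine mem_closure_iff_nhds.2 fun V hV => ?_
  obtain ⟨W, -, hWV, hc⟩ := h V hV
  exact hc.nonempty.mono (inter_subset_inter_left _ hWV)

theorem exists_nhds (h : IsAccessible O y) :
    y ∈ closure O ∧ ∃ W ∈ 𝓝 y, IsPathConnected (W ∩ O) := by
  obtain ⟨W, hW, -, hc⟩ := h univ univ_mem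
  exact ⟨h.mem_closure, W, hW, hc⟩

theorem congr (h : IsAccessible O y) (hO : ∀ᶠ z in 𝓝 y, z ∈ O ↔ z ∈ O') : IsAccessible O' y := by
  intro V hV
  obtain ⟨W, hW, hWV, hc⟩ := h _ (inter_mem hV hO)
  refine ⟨W, hW, hWV.trans inter_subset_left, ?_⟩
  have : W ∩ O' = W ∩ O := by
    ext z
    refine and_congr_right fun hz => ((hWV hz).2).symm
  rwa [this]

theorem of_mem_nhds [LocallyPathConnectedSpace T] (h : O ∈ 𝓝 y) : IsAccessible O y := by
  intro V hV
  obtain ⟨W, ⟨hW, hWc⟩, hWV⟩ := (path_connected_basis y).mem_iff.1 (inter_mem hV h)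
  refine ⟨W, hW, hWV.trans inter_subset_left, ?_⟩
  have hWO : W ⊆ O := hWV.trans inter_subset_right
  rwa [inter_eq_self_of_subset_left hWO]

theorem of_chart {H : Type*} [TopologicalSpace H] (e : OpenPartialHomeomorph T H)
    (hy : y ∈ e.source) (h : IsAccessible (e.symm ⁻¹' O) (e y)) : IsAccessible O y := by
  intro V hV
  have hV' : e.symm ⁻¹' V ∩ e.target ∈ 𝓝 (e y) :=
    inter_mem (e.continuousAt_symm (e.map_source hy) (by rwa [e.left_inv hy]))
      (e.open_target.mem_nhds (e.map_source hy))
  obtain ⟨W, hW, hWV, hc⟩ := h _ hV'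
  refine ⟨e.symm '' W, ?_, ?_, ?_⟩
  · have := e.symm.image_mem_nhds (by simpa using e.map_source hy) hW
    rwa [e.left_inv hy] at this
  · rintro _ ⟨z, hz, rfl⟩
    exact (hWV hz).1
  · have : e.symm '' W ∩ O = e.symm '' (W ∩ e.symm ⁻¹' O) := image_inter_preimage _ _ _ |>.symm
    rw [this]
    refine hc.image' (e.continuousOn_symm.mono fun z hz => (hWV hz.1).2)

end IsAccessible

/-- A punctured ball is homeomorphic to the punctured space, which is path connected in dimension at
least 2. -/
theorem isAccessible_compl_singleton {E : Type*} [NormedAddCommGroup E] [InnerProductSpace ℝ E]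
    (hE : 1 < Module.rank ℝ E) (u : E) : IsAccessible ({u}ᶜ : Set E) u := by
  intro V hV
  obtain ⟨r, hr, hrV⟩ := Metric.mem_nhds_iff.1 hV
  refine ⟨Metric.ball u r, Metric.ball_mem_nhds u hr, hrV, ?_⟩
  let Φ := OpenPartialHomeomorph.univBall u r
  have hΦ : Metric.ball u r ∩ {u}ᶜ = Φ '' {0}ᶜ := by
    have h1 : Φ '' univ = Metric.ball u r := by
      have := Φ.image_source_eq_target
      rwa [OpenPartialHomeomorph.univBall_source, OpenPartialHomeomorph.univBall_target u hr] at this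
    have h0 : Φ 0 = u := OpenPartialHomeomorph.univBall_apply_zero u r
    have hinj : Function.Injective Φ := fun a b hab =>
      Φ.injOn (by simp [Φ]) (by simp [Φ]) hab
    rw [image_compl_eq_range_sdiff_image hinj, image_singleton, h0, ← image_univ, h1]
    rfl
  rw [hΦ]
  exact (isPathConnected_compl_singleton_of_one_lt_rank hE 0).image
    (OpenPartialHomeomorph.continuous_univBall u r)

/-- By the implicit function theorem `f` is a coordinate near `u`, and in these coordinates the
superlevel set cuts a ball in a convex piece. -/
theorem isAccessible_of_hasStrictFDerivAt {E : Type*} [NormedAddCommGroup E] [NormedSpace ℝ E]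
    [FiniteDimensional ℝ E] {f : E → ℝ} {f' : E →L[ℝ] ℝ} {u : E} (hf : HasStrictFDerivAt f f' u)
    (hf' : f' ≠ 0) : IsAccessible {z | f u < f z} u := by
  have hrange : f'.range = ⊤ := LinearMap.range_eq_top.2 (LinearMap.surjective (by
    intro h0
    exact hf' (ContinuousLinearMap.coe_injective h0)))
  have := FiniteDimensional.complete ℝ E
  let Φ := hf.implicitToOpenPartialHomeomorph f f' hrange
  have hu : u ∈ Φ.source := hf.mem_implicitToOpenPartialHomeomorph_source hrange
  have hΦu : Φ u = (f u, 0) := hf.implicitToOpenPartialHomeomorph_self hrange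
  refine IsAccessible.of_chart Φ hu fun V hV => ?_
  obtain ⟨r, hr, hrV⟩ := Metric.mem_nhds_iff.1
    (inter_mem hV (Φ.open_target.mem_nhds (Φ.map_source hu)))
  refine ⟨Metric.ball (Φ u) r, Metric.ball_mem_nhds _ hr, hrV.trans inter_subset_left, ?_⟩
  have hset : Metric.ball (Φ u) r ∩ Φ.symm ⁻¹' {z | f u < f z} =
      Metric.ball (Φ u) r ∩ {z | f u < z.1} := by
    ext z
    refine and_congr_right fun hz => ?_
    have h1 : f (Φ.symm z) = z.1 := by
      have h2 := hf.implicitToOpenPartialHomeomorph_fst hrange (Φ.symm z)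
      rw [← h2]
      exact congrArg Prod.fst (Φ.right_inv (hrV hz).2)
    change f u < f (Φ.symm z) ↔ f u < z.1
    rw [h1]
  rw [hset]
  refine Convex.isPathConnected ?_ ⟨(f u + r / 2, 0), ?_, ?_⟩
  · refine (convex_ball _ _).inter ?_
    exact (convex_Ioi (f u)).linear_preimage (LinearMap.fst ℝ ℝ f'.ker)
  · rw [hΦu, Metric.mem_ball, Prod.dist_eq]
    simp [abs_of_pos hr, hr]
  · change f u < f u + r / 2
    linarith

section Pair

variable {n : ℕ} {X N : Euc n → Euc (n + 2)} {U : Set (Euc n)}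

theorem IsDualPair.isAccessible_of_fderiv_ne (h : IsDualPair X N U) {u : Euc n} (hu : u ∈ U)
    {a : Euc (n + 2)} (ha : ⟪X u, a⟫_ℝ = 0) {w : Euc n} (hw : ⟪fderiv ℝ X u w, a⟫_ℝ ≠ 0) :
    IsAccessible {z | 0 < ⟪X z, a⟫_ℝ} u := by
  have hs : HasStrictFDerivAt X (fderiv ℝ X u) u :=
    (h.contDiffAt_left hu).hasStrictFDerivAt (by simp)
  have hf : HasStrictFDerivAt (fun z => ⟪a, X z⟫_ℝ) ((innerSL ℝ a).comp (fderiv ℝ X u)) u :=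
    (innerSL ℝ a).hasStrictFDerivAt.comp u hs
  have h1 := isAccessible_of_hasStrictFDerivAt hf (fun h0 => hw (by
    have := congrArg (fun L => L w) h0
    rw [real_inner_comm]
    simpa using this))
  refine h1.congr (Eventually.of_forall fun z => ?_)
  change ⟪a, X u⟫_ℝ < ⟪a, X z⟫_ℝ ↔ 0 < ⟪X z, a⟫_ℝ
  rw [real_inner_comm, ha, real_inner_comm]

theorem IsDualPair.eventually_inner_neg_left (h : IsDualPair X N U) {u : Euc n} (hu : u ∈ U) :
    ∀ᶠ z in 𝓝 u, z ≠ u → ⟪X z, N u⟫_ℝ < 0 := by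
  have ht : Tendsto (fun z : Euc n => (z, u)) (𝓝 u) (𝓝 (u, u)) :=
    (continuous_id.prodMk continuous_const).tendsto u
  exact ht.eventually (h.eventually_inner_neg hu)

end Pair

/-! ### The hypersurface itself is locally convex when `n ≥ 2` -/

section DualMap

variable {n m : ℕ} {M : Type*} [TopologicalSpace M] [ChartedSpace (Euc n) M]
  [IsManifold (𝓡 n) (m : ℕ∞ω) M] {x ν : M → Sph n}

namespace IsDualMap

variable (h : IsDualMap m x ν)
include h

omit [IsManifold (𝓡 n) (m : ℕ∞ω) M] in
theorem continuous_left : Continuous fun q => (x q : Euc (n + 2)) :=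
  continuous_subtype_val.comp h.left.continuous

theorem chart_pair (p : M) : IsDualPair (localRep x (chartAt (Euc n) p))
    (localRep ν (chartAt (Euc n) p)) (chartAt (Euc n) p).target :=
  h.pair _ (IsManifold.chart_mem_maximalAtlas p)

theorem inner_eq_zero (p : M) : ⟪(x p : Euc (n + 2)), (ν p : Euc (n + 2))⟫_ℝ = 0 := by
  have := (h.chart_pair p).inner_eq _ (mem_chart_target (Euc n) p)
  rwa [localRep_apply (mem_chart_source _ p), localRep_apply (mem_chart_source _ p)] at this

/-- Near `p`, the tangent hyperplane at `p` strictly supports the hypersurface. -/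
theorem eventually_inner_neg (p : M) :
    ∀ᶠ q in 𝓝 p, q ≠ p → ⟪(x q : Euc (n + 2)), (ν p : Euc (n + 2))⟫_ℝ < 0 := by
  set e := chartAt (Euc n) p
  have hp : p ∈ e.source := mem_chart_source _ p
  have h1 := (h.chart_pair p).eventually_inner_neg_left (mem_chart_target (Euc n) p)
  filter_upwards [(e.continuousAt hp).eventually h1, e.open_source.mem_nhds hp] with q hq hqs hne
  have h2 := hq fun h0 => hne (e.injOn hqs hp h0)
  rwa [localRep_apply hqs, localRep_apply hp] at h2

/-- Either `a` is normal at `p`, or the hypersurface crosses the hyperplane `a⊥` transversally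
there. -/
theorem eq_smul_or_isAccessible {p : M} {a : Euc (n + 2)} (ha : a ≠ 0)
    (hpa : ⟪(x p : Euc (n + 2)), a⟫_ℝ = 0) :
    (∃ c : ℝ, c ≠ 0 ∧ a = c • (ν p : Euc (n + 2))) ∨
      IsAccessible {q | 0 < ⟪(x q : Euc (n + 2)), a⟫_ℝ} p := by
  set e := chartAt (Euc n) p
  have hp : p ∈ e.source := mem_chart_source _ p
  have hu : e p ∈ e.target := mem_chart_target _ p
  have hX : localRep x e (e p) = x p := localRep_apply hp
  have hN : localRep ν e (e p) = ν p := localRep_apply hp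
  by_cases hw : ∀ w, ⟪fderiv ℝ (localRep x e) (e p) w, a⟫_ℝ = 0
  · left
    have h1 := (h.chart_pair p).eq_smul_normal hu (z := a) (by
      rw [real_inner_comm, hX, hpa]) hw
    rw [hN] at h1
    refine ⟨_, fun h0 => ha ?_, h1⟩
    rw [h1, h0, zero_smul]
  · right
    push Not at hw
    obtain ⟨w, hw⟩ := hw
    exact IsAccessible.of_chart e hp
      ((h.chart_pair p).isAccessible_of_fderiv_ne hu (by rw [hX, hpa]) hw)

theorem isStrictSupport_smul {c : ℝ} (hc : 0 < c) (p : M) :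
    IsStrictSupport (fun q => (x q : Euc (n + 2))) univ p (c • (ν p : Euc (n + 2))) := by
  refine ⟨?_, ?_⟩
  · rw [inner_smul_right, h.inner_eq_zero, mul_zero]
  · filter_upwards [h.eventually_inner_neg p] with q hq _ hne
    rw [inner_smul_right]
    exact mul_neg_of_pos_of_neg hc (hq hne)

/-- Near `p` every other point has positive height, and `p` is not isolated because `n ≥ 1`. -/
theorem frequently_inner_pos (hn : 1 ≤ n) {c : ℝ} (hc : c < 0) (p : M) :
    p ∈ closure {q | 0 < ⟪(x q : Euc (n + 2)), c • (ν p : Euc (n + 2))⟫_ℝ} := by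
  set e := chartAt (Euc n) p
  have hp : p ∈ e.source := mem_chart_source _ p
  have : Nontrivial (Euc n) := by
    have : Nonempty (Fin n) := ⟨⟨0, hn⟩⟩
    infer_instance
  rw [mem_closure_iff_frequently]
  intro hneg
  have h1 : ∀ᶠ q in 𝓝 p, q = p := by
    filter_upwards [hneg, h.eventually_inner_neg p] with q hq1 hq2
    by_contra hne
    refine hq1 ?_
    rw [inner_smul_right]
    exact mul_pos_of_neg_of_neg hc (hq2 hne)
  have h2 : ∀ᶠ u in 𝓝 (e p), u = e p := by
    have h3 : ∀ᶠ u in 𝓝 (e p), e.symm u = p :=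
      (e.continuousAt_symm (e.map_source hp)).eventually (by rwa [e.left_inv hp])
    filter_upwards [h3, e.open_target.mem_nhds (e.map_source hp)] with u hu hut
    rw [← hu, e.right_inv hut]
  have h3 : ∀ᶠ u in 𝓝[≠] (e p), False := by
    filter_upwards [mem_nhdsWithin_of_mem_nhds h2, self_mem_nhdsWithin] with u hu hne
    exact hne hu
  exact (h3.exists).choose_spec

/-- Away from the direction of the definite normal, half spaces are locally accessible. -/
theorem exists_pos_smul_or_mem_closure (hn : 1 ≤ n) {p : M} {a : Euc (n + 2)} (ha : a ≠ 0)
    (hpa : ⟪(x p : Euc (n + 2)), a⟫_ℝ = 0) :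
    (∃ c : ℝ, 0 < c ∧ a = c • (ν p : Euc (n + 2))) ∨
      p ∈ closure {q | 0 < ⟪(x q : Euc (n + 2)), a⟫_ℝ} := by
  rcases h.eq_smul_or_isAccessible ha hpa with ⟨c, hc, rfl⟩ | h'
  · rcases hc.lt_or_gt with hc | hc
    · exact Or.inr (h.frequently_inner_pos hn hc p)
    · exact Or.inl ⟨c, hc, rfl⟩
  · exact Or.inr h'.mem_closure

theorem mem_closure_add (hn : 1 ≤ n) {p : M} {c : ℝ} (hc : 0 < c) {w : Euc (n + 2)}
    (hw : ⟪(x p : Euc (n + 2)), w⟫_ℝ = 0) (hwa : w ∉ ℝ ∙ (c • (ν p : Euc (n + 2)))) :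
    p ∈ closure {q | 0 < ⟪(x q : Euc (n + 2)), c • (ν p : Euc (n + 2)) + w⟫_ℝ} := by
  have h0 : c • (ν p : Euc (n + 2)) + w ≠ 0 := by
    intro h0
    refine hwa (Submodule.mem_span_singleton.2 ⟨-1, ?_⟩)
    rw [neg_one_smul]
    exact neg_eq_of_add_eq_zero_right h0
  have h1 : ⟪(x p : Euc (n + 2)), c • (ν p : Euc (n + 2)) + w⟫_ℝ = 0 := by
    rw [inner_add_right, inner_smul_right, h.inner_eq_zero, hw, mul_zero, add_zero]
  rcases h.exists_pos_smul_or_mem_closure hn h0 h1 with ⟨c', hc', heq⟩ | h'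
  · exfalso
    refine hwa (Submodule.mem_span_singleton.2 ⟨(c' - c) / c, ?_⟩)
    rw [smul_smul, div_mul_cancel₀ _ hc.ne', sub_smul, ← heq, add_sub_cancel_left]
  · exact h'

/-- Dimension at least 2 makes punctured neighbourhoods path connected. This serves negative
multiples of `ν p`, whose positive side near `p` is a punctured neighbourhood, and the removal of a
fibre of `x`, which is discrete because nearby points leave the tangent hyperplane. -/
theorem isLocallyConvex [T2Space M] [CompactSpace M] [ConnectedSpace M] (hn : 2 ≤ n) :
    IsLocallyConvex (fun q => (x q : Euc (n + 2))) (univ : Set M) := by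
  have hrank : 1 < Module.rank ℝ (Euc n) := by
    rw [← Module.finrank_eq_rank, finrank_euclideanSpace_fin]
    exact_mod_cast hn
  have := ChartedSpace.locallyPathConnectedSpace (Euc n) M
  have hpos : ∀ a, posPart (fun q => (x q : Euc (n + 2))) (univ : Set M) a =
      {q | 0 < ⟪(x q : Euc (n + 2)), a⟫_ℝ} := fun a => by ext q; simp [posPart]
  have hcompl : ∀ p : M, IsAccessible ({p}ᶜ : Set M) p := fun p => by
    set e := chartAt (Euc n) p
    have hp : p ∈ e.source := mem_chart_source _ p
    refine IsAccessible.of_chart e hp ((isAccessible_compl_singleton hrank (e p)).congr ?_)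
    filter_upwards [e.open_target.mem_nhds (e.map_source hp)] with u hu
    refine not_congr ⟨fun h0 => ?_, fun h0 => ?_⟩
    · rw [mem_singleton_iff] at h0 ⊢
      rw [h0, e.left_inv hp]
    · rw [mem_singleton_iff] at h0 ⊢
      rw [← h0, e.right_inv hu]
  have hsupp : ∀ p : M, ∀ a ≠ 0, IsStrictSupport (fun q => (x q : Euc (n + 2))) univ p a →
      ∃ c : ℝ, 0 < c ∧ a = c • (ν p : Euc (n + 2)) := by
    intro p a ha hs
    rcases h.exists_pos_smul_or_mem_closure (by omega) ha hs.1 with h' | h'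
    · exact h'
    · obtain ⟨q, hq, hq'⟩ := ((mem_closure_iff_frequently.1 h').and_eventually hs.2).exists
      have hqp : q ≠ p := by
        rintro rfl
        exact hq.ne' hs.1
      exact absurd (hq' trivial hqp) hq.not_gt
  refine ⟨isCompact_univ, h.continuous_left, fun y _ => norm_eq_of_mem_sphere _, ?_, ?_, ?_⟩
  · intro a ha p _ hpa
    rw [hpos]
    rcases hpa.lt_or_eq with hlt | heq
    · exact Or.inr (IsAccessible.of_mem_nhds ((h.continuous_left.inner
        continuous_const).continuousAt.eventually_const_lt hlt)).exists_nhds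
    · rcases h.eq_smul_or_isAccessible ha heq.symm with ⟨c, hc, rfl⟩ | h'
      · rcases hc.lt_or_gt with hc | hc
        · right
          refine ((hcompl p).congr ?_).exists_nhds
          filter_upwards [h.eventually_inner_neg p] with q hq
          constructor
          · intro hne
            rw [inner_smul_right]
            exact mul_pos_of_neg_of_neg hc (hq hne)
          · rintro hlt rfl
            exact hlt.ne heq
        · exact Or.inl (h.isStrictSupport_smul hc p)
      · exact Or.inr h'.exists_nhds
  · intro y₀ _
    have hO : IsOpen (univ \ {y | (x y : Euc (n + 2)) = -(x y₀ : Euc (n + 2))}) :=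
      isOpen_univ.sdiff (isClosed_eq h.continuous_left continuous_const)
    refine isPreconnected_of_forall_pair fun p hp q hq => ?_
    have hacc : ∀ y ∈ (univ : Set M),
        y ∈ closure (univ \ {y | (x y : Euc (n + 2)) = -(x y₀ : Euc (n + 2))}) ∧
          ∃ W ∈ 𝓝 y, IsPathConnected (W ∩ (univ \ {y | (x y : Euc (n + 2)) =
            -(x y₀ : Euc (n + 2))})) := by
      intro y _
      by_cases hy : y ∈ univ \ {y | (x y : Euc (n + 2)) = -(x y₀ : Euc (n + 2))}
      · exact (IsAccessible.of_mem_nhds (hO.mem_nhds hy)).exists_nhds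
      · refine ((hcompl y).congr ?_).exists_nhds
        have hy' : (x y : Euc (n + 2)) = -(x y₀ : Euc (n + 2)) := by
          by_contra hne
          exact hy ⟨mem_univ _, hne⟩
        filter_upwards [h.eventually_inner_neg y] with z hz
        constructor
        · refine fun hne => ⟨mem_univ _, fun heq => ?_⟩
          have h1 := hz hne
          rw [show (x z : Euc (n + 2)) = x y from heq.trans hy'.symm, h.inner_eq_zero] at h1
          exact lt_irrefl _ h1
        · rintro hzO rfl
          exact hzO.2 hy'
    obtain ⟨γ, hγ⟩ := joinedIn_of_isPreconnected isPreconnected_univ hacc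
      (mem_univ p) (mem_univ q) hp hq
    exact ⟨range γ, range_subset_iff.2 hγ, ⟨0, γ.source⟩, ⟨1, γ.target⟩,
      isPreconnected_range γ.continuous⟩
  · intro p _ a ha w hs hw hwa
    rw [hpos]
    obtain ⟨c, hc, rfl⟩ := hsupp p a ha hs
    exact h.mem_closure_add (by omega) hc hw hwa

end IsDualMap

end DualMap

/-! ### Convex cones and spherical caps -/

section Cone

variable {E : Type*} [NormedAddCommGroup E] [InnerProductSpace ℝ E]

theorem exists_cap_subset {y : Metric.sphere (0 : E) 1} {V : Set (Metric.sphere (0 : E) 1)}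
    (hV : V ∈ 𝓝 y) : ∃ c : ℝ, 0 ≤ c ∧ c < 1 ∧ {z : Metric.sphere (0 : E) 1 |
      c < ⟪(z : E), (y : E)⟫_ℝ} ⊆ V := by
  obtain ⟨ε, hε, hV⟩ := Metric.mem_nhds_iff.1 hV
  -- For unit vectors `‖z - y‖² = 2 - 2⟪z, y⟫`. The maximum with 0 keeps `c ≥ 0`, which makes the
  -- cone over the cap convex.
  refine ⟨max 0 (1 - ε ^ 2 / 2), le_max_left _ _, max_lt one_pos (by nlinarith [pow_pos hε 2]),
    fun z hz => hV ?_⟩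
  have hz' : 1 - ε ^ 2 / 2 < ⟪(z : E), (y : E)⟫_ℝ := (le_max_right _ _).trans_lt hz
  have h1 : ‖(z : E)‖ = 1 := norm_eq_of_mem_sphere z
  have h2 : ‖(y : E)‖ = 1 := norm_eq_of_mem_sphere y
  rw [Metric.mem_ball, Subtype.dist_eq, dist_eq_norm]
  have h3 := norm_sub_sq_real (z : E) (y : E)
  rw [h1, h2] at h3
  exact lt_of_pow_lt_pow_left₀ 2 hε.le (by nlinarith)

/-- A convex cone meets small spherical caps in path connected sets. -/
theorem isAccessible_cone {K : Set E} (hK : Convex ℝ K) (hs : ∀ z ∈ K, ∀ t : ℝ, 0 < t → t • z ∈ K)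
    {y : Metric.sphere (0 : E) 1} (hy : y ∈ closure {z : Metric.sphere (0 : E) 1 | (z : E) ∈ K}) :
    IsAccessible {z : Metric.sphere (0 : E) 1 | (z : E) ∈ K} y := by
  intro V hV
  obtain ⟨c, hc0, hc1, hcV⟩ := exists_cap_subset hV
  have hcap : {z : Metric.sphere (0 : E) 1 | c < ⟪(z : E), (y : E)⟫_ℝ} ∈ 𝓝 y := by
    have hcont : Continuous fun z : Metric.sphere (0 : E) 1 => ⟪(z : E), (y : E)⟫_ℝ :=
      continuous_subtype_val.inner continuous_const
    refine hcont.continuousAt.eventually_const_lt ?_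
    change c < ⟪(y : E), (y : E)⟫_ℝ
    rwa [real_inner_self_eq_norm_sq, norm_eq_of_mem_sphere, one_pow]
  refine ⟨_, hcap, hcV, ?_⟩
  -- The part of `K` over the cap: it is convex, and radial projection carries it onto the set in
  -- question.
  let Kc : Set E := {z | z ∈ K ∧ c * ‖z‖ < ⟪z, (y : E)⟫_ℝ}
  have hKc : Convex ℝ Kc := by
    intro a ha b hb s t hs ht hst
    refine ⟨hK ha.1 hb.1 hs ht hst, ?_⟩
    have h1 : ‖s • a + t • b‖ ≤ s * ‖a‖ + t * ‖b‖ := by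
      refine (norm_add_le _ _).trans (le_of_eq ?_)
      rw [norm_smul, norm_smul, Real.norm_of_nonneg hs, Real.norm_of_nonneg ht]
    rw [inner_add_left, inner_smul_left, inner_smul_left]
    simp only [conj_trivial]
    have h2 := mul_le_mul_of_nonneg_left h1 hc0
    rcases hs.eq_or_lt with rfl | hs
    · have : t = 1 := by linarith
      subst this
      nlinarith [hb.2]
    · nlinarith [mul_pos hs (sub_pos.2 ha.2), mul_nonneg ht (sub_pos.2 hb.2).le]
  have h0 : ∀ z ∈ Kc, z ≠ 0 := by
    rintro z hz rfl
    simpa using hz.2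
  have himg : (Subtype.val '' ({z : Metric.sphere (0 : E) 1 | c < ⟪(z : E), (y : E)⟫_ℝ} ∩
      {z : Metric.sphere (0 : E) 1 | (z : E) ∈ K})) = (fun z : E => ‖z‖⁻¹ • z) '' Kc := by
    ext z
    constructor
    · rintro ⟨z, ⟨h1, h2⟩, rfl⟩
      refine ⟨z, ⟨h2, ?_⟩, ?_⟩
      · rwa [norm_eq_of_mem_sphere, mul_one]
      · simp only [norm_eq_of_mem_sphere, inv_one, one_smul]
    · rintro ⟨z, hz, rfl⟩
      have hn : 0 < ‖z‖ := norm_pos_iff.2 (h0 z hz)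
      refine ⟨⟨‖z‖⁻¹ • z, ?_⟩, ⟨?_, hs z hz.1 _ (inv_pos.2 hn)⟩, rfl⟩
      · rw [mem_sphere_zero_iff_norm, norm_smul, norm_inv, norm_norm, inv_mul_cancel₀ hn.ne']
      · change c < ⟪‖z‖⁻¹ • z, (y : E)⟫_ℝ
        rw [inner_smul_left, conj_trivial, ← div_eq_inv_mul, lt_div_iff₀ hn]
        exact hz.2
  rw [Topology.IsInducing.subtypeVal.isPathConnected_iff, himg]
  refine (hKc.isPathConnected ?_).image' ?_
  · obtain ⟨z, hz1, hz2⟩ := mem_closure_iff_nhds.1 hy _ hcap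
    exact ⟨z, hz2, by rw [norm_eq_of_mem_sphere, mul_one]; exact hz1⟩
  · exact (continuousOn_id.norm.inv₀ fun z hz => norm_ne_zero_iff.2 (h0 z hz)).smul continuousOn_id

theorem mem_closure_half_sphere {y : Metric.sphere (0 : E) 1} {a : E} (ha : a ≠ 0)
    (hy : 0 ≤ ⟪(y : E), a⟫_ℝ) :
    y ∈ closure {z : Metric.sphere (0 : E) 1 | 0 < ⟪(z : E), a⟫_ℝ} := by
  have hyn : ‖(y : E)‖ = 1 := norm_eq_of_mem_sphere y
  have hc : ContinuousAt (fun t : ℝ => ‖(y : E) + t • a‖⁻¹ • ((y : E) + t • a)) 0 := by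
    have h1 : Continuous fun t : ℝ => (y : E) + t • a := by fun_prop
    exact (h1.continuousAt.norm.inv₀ (by simp [hyn])).smul h1.continuousAt
  have ht : Tendsto (fun t : ℝ => ‖(y : E) + t • a‖⁻¹ • ((y : E) + t • a)) (𝓝[>] 0) (𝓝 (y : E)) := by
    have := hc.tendsto.mono_left (nhdsWithin_le_nhds (s := Ioi 0))
    simpa [hyn] using this
  rw [Topology.IsInducing.subtypeVal.closure_eq_preimage_closure_image]
  refine mem_closure_of_tendsto ht ?_
  filter_upwards [self_mem_nhdsWithin] with t ht
  have haa : 0 < ⟪a, a⟫_ℝ := real_inner_self_pos.2 ha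
  have hpos : 0 < ⟪(y : E) + t • a, a⟫_ℝ := by
    rw [inner_add_left, inner_smul_left, conj_trivial]
    linarith [mul_pos ht haa]
  have hne : (y : E) + t • a ≠ 0 := by
    intro h0
    rw [h0, inner_zero_left] at hpos
    exact lt_irrefl _ hpos
  have hn : 0 < ‖(y : E) + t • a‖ := norm_pos_iff.2 hne
  refine ⟨⟨_, ?_⟩, ?_, rfl⟩
  · rw [mem_sphere_zero_iff_norm, norm_smul, norm_inv, norm_norm, inv_mul_cancel₀ hn.ne']
  · change 0 < ⟪‖(y : E) + t • a‖⁻¹ • ((y : E) + t • a), a⟫_ℝ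
    rw [inner_smul_left, conj_trivial]
    exact mul_pos (inv_pos.2 hn) hpos

end Cone

/-! ### Tubular neighbourhoods -/

section Tube

variable {n m : ℕ} {M : Type*} [TopologicalSpace M] [ChartedSpace (Euc n) M]
  [IsManifold (𝓡 n) (m : ℕ∞ω) M] {x ν : M → Sph n}

theorem norm_add_smul_of_orthogonal {E : Type*} [NormedAddCommGroup E] [InnerProductSpace ℝ E]
    {a b : E} (ha : ‖a‖ = 1) (hb : ‖b‖ = 1) (hab : ⟪a, b⟫_ℝ = 0) (t : ℝ) :
    ‖a + t • b‖ = √(1 + t ^ 2) := by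
  have h1 : ‖a + t • b‖ ^ 2 = 1 + t ^ 2 := by
    rw [norm_add_sq_real, inner_smul_right, hab, norm_smul, ha, hb, Real.norm_eq_abs, mul_one,
      sq_abs]
    ring
  rw [← h1, Real.sqrt_sq (norm_nonneg _)]

/-- The local polar coordinates `(u, r, t) ↦ r (X(u) + t N(u))` of a dual pair. -/
theorem IsDualPair.hasStrictFDerivAt_polar {X N : Euc n → Euc (n + 2)} {U : Set (Euc n)}
    (h : IsDualPair X N U) {u : Euc n} (hu : u ∈ U) :
    HasStrictFDerivAt (fun p : Euc n × ℝ × ℝ => p.2.1 • (X p.1 + p.2.2 • N p.1))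
      (frameMap (fderiv ℝ X u) (X u) (N u)) (u, 1, 0) := by
  have h1 : HasStrictFDerivAt (fun p : Euc n × ℝ × ℝ => X p.1)
      ((fderiv ℝ X u).comp (ContinuousLinearMap.fst ℝ _ _)) (u, 1, 0) :=
    HasStrictFDerivAt.comp (g := X) (u, 1, 0)
      ((h.contDiffAt_left hu).hasStrictFDerivAt (by simp)) hasStrictFDerivAt_fst
  have h2 : HasStrictFDerivAt (fun p : Euc n × ℝ × ℝ => N p.1)
      ((fderiv ℝ N u).comp (ContinuousLinearMap.fst ℝ _ _)) (u, 1, 0) :=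
    HasStrictFDerivAt.comp (g := N) (u, 1, 0)
      ((h.contDiffAt_right hu).hasStrictFDerivAt (by simp)) hasStrictFDerivAt_fst
  have h3 : HasStrictFDerivAt (fun p : Euc n × ℝ × ℝ => p.2.1)
      ((ContinuousLinearMap.fst ℝ ℝ ℝ).comp (ContinuousLinearMap.snd ℝ _ _)) (u, 1, 0) :=
    ((ContinuousLinearMap.fst ℝ ℝ ℝ).comp
      (ContinuousLinearMap.snd ℝ (Euc n) (ℝ × ℝ))).hasStrictFDerivAt
  have h4 : HasStrictFDerivAt (fun p : Euc n × ℝ × ℝ => p.2.2)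
      ((ContinuousLinearMap.snd ℝ ℝ ℝ).comp (ContinuousLinearMap.snd ℝ _ _)) (u, 1, 0) :=
    ((ContinuousLinearMap.snd ℝ ℝ ℝ).comp
      (ContinuousLinearMap.snd ℝ (Euc n) (ℝ × ℝ))).hasStrictFDerivAt
  -- At `t = 0` the term with `dN` vanishes, which leaves the adapted frame.
  refine (h3.smul (h1.add (h4.smul h2))).congr_fderiv ?_
  refine ContinuousLinearMap.ext fun p => ?_
  simp
  abel

/-- The tube map: the point at signed distance `arctan t` from `x q` along the normal. -/
noncomputable def tube (x ν : M → Sph n) (q : M) (t : ℝ) : Euc (n + 2) :=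
  (√(1 + t ^ 2))⁻¹ • ((x q : Euc (n + 2)) + t • (ν q : Euc (n + 2)))

namespace IsDualMap

variable (h : IsDualMap m x ν)
include h

theorem norm_tube (q : M) (t : ℝ) : ‖tube x ν q t‖ = 1 := by
  have hpos : 0 < √(1 + t ^ 2) := Real.sqrt_pos.2 (by positivity)
  rw [tube, norm_smul, norm_add_smul_of_orthogonal (norm_eq_of_mem_sphere _)
    (norm_eq_of_mem_sphere _) (h.inner_eq_zero q), norm_inv, Real.norm_of_nonneg hpos.le,
    inv_mul_cancel₀ hpos.ne']

omit [IsManifold (𝓡 n) (m : ℕ∞ω) M] in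
theorem continuous_tube : Continuous fun p : M × ℝ => tube x ν p.1 p.2 := by
  have h1 : Continuous fun p : M × ℝ => √(1 + p.2 ^ 2) := by fun_prop
  refine (h1.inv₀ fun p => (Real.sqrt_pos.2 (by positivity)).ne').smul ?_
  exact (h.continuous_left.comp continuous_fst).add
    (continuous_snd.smul (h.symm.continuous_left.comp continuous_fst))

omit [TopologicalSpace M] [ChartedSpace (Euc n) M] [IsManifold (𝓡 n) (m : ℕ∞ω) M] h in
theorem tube_zero (q : M) : tube x ν q 0 = x q := by simp [tube]

theorem exists_polar_chart (p : M) :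
    ∃ Φ : OpenPartialHomeomorph (Euc n × ℝ × ℝ) (Euc (n + 2)),
      (chartAt (Euc n) p p, (1 : ℝ), (0 : ℝ)) ∈ Φ.source ∧
      ∀ z, Φ z = z.2.1 • (localRep x (chartAt (Euc n) p) z.1 +
        z.2.2 • localRep ν (chartAt (Euc n) p) z.1) := by
  have hu := mem_chart_target (Euc n) p
  have h1 := (h.chart_pair p).hasStrictFDerivAt_polar hu
  rw [← coe_frameEquiv ((h.chart_pair p).frame_injective hu)] at h1
  exact ⟨h1.toOpenPartialHomeomorph _, h1.mem_toOpenPartialHomeomorph_source, fun z => rfl⟩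

theorem exists_nhds_injOn_tube (p : M) :
    ∃ O ∈ 𝓝 (p, (0 : ℝ)), InjOn (fun a : M × ℝ => tube x ν a.1 a.2) O := by
  obtain ⟨Φ, hΦs, hΦ⟩ := h.exists_polar_chart p
  set e := chartAt (Euc n) p
  have hp : p ∈ e.source := mem_chart_source _ p
  let j : M × ℝ → Euc n × ℝ × ℝ := fun a => (e a.1, (√(1 + a.2 ^ 2))⁻¹, a.2)
  have hj : ContinuousAt j (p, 0) := by
    have h1 : Continuous fun a : M × ℝ => √(1 + a.2 ^ 2) := by fun_prop
    have h2 : Continuous fun a : M × ℝ => (√(1 + a.2 ^ 2))⁻¹ :=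
      h1.inv₀ fun a => (Real.sqrt_pos.2 (by positivity)).ne'
    refine ContinuousAt.prodMk ?_ (h2.prodMk continuous_snd).continuousAt
    exact ContinuousAt.comp (g := e) (e.continuousAt hp) continuousAt_fst
  have hj0 : j (p, 0) = (e p, 1, 0) := by simp [j]
  refine ⟨_, inter_mem (hj (by rw [hj0]; exact Φ.open_source.mem_nhds hΦs))
    (continuousAt_fst (e.open_source.mem_nhds hp)), ?_⟩
  have htube : ∀ a : M × ℝ, a.1 ∈ e.source → tube x ν a.1 a.2 = Φ (j a) := by
    intro a ha
    rw [hΦ, localRep_apply ha, localRep_apply ha]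
    rfl
  rintro a ⟨ha1, ha2⟩ b ⟨hb1, hb2⟩ hab
  simp only [htube a ha2, htube b hb2] at hab
  have := Φ.injOn ha1 hb1 hab
  simp only [j, Prod.mk.injEq] at this
  exact Prod.ext (e.injOn ha2 hb2 this.1) this.2.2

/-- Invert the polar map; on unit vectors the radial coordinate is forced to be `(1 + t²)^(-1/2)`,
the factor in `tube`. -/
theorem eventually_exists_eq_tube (p : M) {O : Set (M × ℝ)} (hO : O ∈ 𝓝 (p, (0 : ℝ))) :
    ∀ᶠ y : Sph n in 𝓝 (x p), ∃ a ∈ O, (y : Euc (n + 2)) = tube x ν a.1 a.2 := by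
  obtain ⟨Φ, hΦs, hΦ⟩ := h.exists_polar_chart p
  set e := chartAt (Euc n) p
  have hp : p ∈ e.source := mem_chart_source _ p
  have hΦp : Φ (e p, 1, 0) = x p := by
    rw [hΦ, localRep_apply hp]
    simp
  have hxt : (x p : Euc (n + 2)) ∈ Φ.target := hΦp ▸ Φ.map_source hΦs
  have h1 : ContinuousAt (fun y : Sph n => Φ.symm y) (x p) :=
    ContinuousAt.comp (g := Φ.symm) (Φ.continuousAt_symm hxt) continuous_subtype_val.continuousAt
  have h2 : Φ.symm (x p) = (e p, 1, 0) := by rw [← hΦp, Φ.left_inv hΦs]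
  have h3 : ContinuousAt (fun z : Euc n × ℝ × ℝ => (e.symm z.1, z.2.2)) (e p, 1, 0) :=
    (ContinuousAt.comp (g := e.symm) (f := Prod.fst) (x := (e p, (1 : ℝ), (0 : ℝ)))
      (e.continuousAt_symm (e.map_source hp)) continuousAt_fst).prodMk (continuous_snd.comp continuous_snd).continuousAt
  have h4 : ∀ᶠ z : Euc n × ℝ × ℝ in 𝓝 (e p, 1, 0),
      z.1 ∈ e.target ∧ 0 < z.2.1 ∧ (e.symm z.1, z.2.2) ∈ O := by
    refine (Filter.Eventually.prod_inl_nhds (e.open_target.mem_nhds (e.map_source hp)) _).and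
      (((continuous_fst.comp continuous_snd).continuousAt.eventually_const_lt (by simp)).and
      (h3 ?_))
    simpa [e.left_inv hp] using hO
  rw [← h2] at h4
  have h5 : ∀ᶠ y : Sph n in 𝓝 (x p), (y : Euc (n + 2)) ∈ Φ.target :=
    continuous_subtype_val.continuousAt (Φ.open_target.mem_nhds hxt)
  have h6 := h1.eventually h4
  filter_upwards [h6, h5] with y hy hyt
  obtain ⟨hy1, hy2, hy3⟩ := hy
  refine ⟨_, hy3, ?_⟩
  have hy' : (y : Euc (n + 2)) = Φ (Φ.symm y) := (Φ.right_inv hyt).symm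
  rw [hΦ] at hy'
  generalize Φ.symm (y : Euc (n + 2)) = z at hy' hy1 hy2
  have hpair := h.chart_pair p
  have hn : ‖(y : Euc (n + 2))‖ = 1 := norm_eq_of_mem_sphere y
  rw [hy', norm_smul, norm_add_smul_of_orthogonal (hpair.norm_left _ hy1)
    (hpair.norm_right _ hy1) (hpair.inner_eq _ hy1), Real.norm_of_nonneg hy2.le] at hn
  rw [hy', tube, eq_inv_of_mul_eq_one_left hn]
  rfl

/-- A tubular neighbourhood of an embedded compact hypersurface. -/
theorem exists_tube_notMem_range [T2Space M] [CompactSpace M] (hinj : Function.Injective x) :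
    ∃ δ > 0, ∀ q t, t ≠ 0 → |t| < δ → tube x ν q t ∉ range fun q' => (x q' : Euc (n + 2)) := by
  have hloc : ∀ p : M, ∀ᶠ a in 𝓝 (p, (0 : ℝ)), a.2 ≠ 0 →
      tube x ν a.1 a.2 ∉ range fun q' => (x q' : Euc (n + 2)) := by
    intro p
    obtain ⟨O, hO, hinjO⟩ := h.exists_nhds_injOn_tube p
    have hI : {q : M | (q, (0 : ℝ)) ∈ O} ∈ 𝓝 p :=
      (Continuous.prodMk_left (0 : ℝ)).continuousAt.preimage_mem_nhds hO
    obtain ⟨I, hIs, hIo, hpI⟩ := mem_nhds_iff.1 hI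
    have hclosed : IsClosed ((fun q' => (x q' : Euc (n + 2))) '' Iᶜ) :=
      (hIo.isClosed_compl.isCompact.image h.continuous_left).isClosed
    have hmem : tube x ν p 0 ∉ (fun q' => (x q' : Euc (n + 2))) '' Iᶜ := by
      rintro ⟨q', hq', heq⟩
      rw [tube_zero] at heq
      exact hq' (by rwa [hinj (Subtype.ext heq)])
    have h1 := (h.continuous_tube.continuousAt (x := (p, (0 : ℝ)))).eventually
      (hclosed.isOpen_compl.mem_nhds hmem)
    filter_upwards [h1, hO] with a ha haO hne
    rintro ⟨q', hq'⟩
    -- Points near `p` are excluded by local injectivity of the tube map, the others because the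
    -- compact image of `Iᶜ` misses `x p`.
    by_cases hqI : q' ∈ I
    · have h2 := hinjO (hIs hqI) haO (by simp only [tube_zero]; exact hq')
      exact hne (congrArg Prod.snd h2).symm
    · exact ha ⟨q', hqI, hq'⟩
  have h1 : ∀ᶠ t in 𝓝 (0 : ℝ), ∀ q ∈ (univ : Set M), t ≠ 0 →
      tube x ν q t ∉ range fun q' => (x q' : Euc (n + 2)) :=
    isCompact_univ.eventually_forall_of_forall_eventually fun q _ =>
      (continuous_swap.tendsto ((0 : ℝ), q)).eventually (hloc q)
  obtain ⟨δ, hδ, h2⟩ := Metric.eventually_nhds_iff.1 h1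
  exact ⟨δ, hδ, fun q t ht htδ => h2 (by simpa using htδ) q (mem_univ q) ht⟩

end IsDualMap

end Tube

/-! ### A region bounded by the hypersurface is locally convex -/

section Region

variable {n m : ℕ} {M : Type*} [TopologicalSpace M] [ChartedSpace (Euc n) M]
  [IsManifold (𝓡 n) (m : ℕ∞ω) M] {x ν : M → Sph n}

theorem isAccessible_inter_compl_singleton (hn : 1 ≤ n) {O : Set (Sph n)} {y : Sph n}
    (hO : O ∈ 𝓝 y) (w : Sph n) : IsAccessible (O ∩ {w}ᶜ) y := by
  have := fact_finrank_euc n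
  have := ChartedSpace.locallyPathConnectedSpace (Euc (n + 1)) (Sph n)
  rcases eq_or_ne y w with rfl | hne
  · have hrank : 1 < Module.rank ℝ (Euc (n + 1)) := by
      rw [← Module.finrank_eq_rank, finrank_euclideanSpace_fin]
      exact_mod_cast (by omega : 1 < n + 1)
    set e := chartAt (Euc (n + 1)) y
    have hp : y ∈ e.source := mem_chart_source _ y
    have h1 : IsAccessible ({y}ᶜ : Set (Sph n)) y := by
      refine IsAccessible.of_chart e hp ((isAccessible_compl_singleton hrank (e y)).congr ?_)
      filter_upwards [e.open_target.mem_nhds (e.map_source hp)] with u hu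
      refine not_congr ⟨fun h0 => ?_, fun h0 => ?_⟩
      · rw [mem_singleton_iff] at h0 ⊢
        rw [h0, e.left_inv hp]
      · rw [mem_singleton_iff] at h0 ⊢
        rw [← h0, e.right_inv hu]
    refine h1.congr ?_
    filter_upwards [hO] with z hz
    exact (and_iff_right hz).symm
  · exact IsAccessible.of_mem_nhds (inter_mem hO (isOpen_compl_singleton.mem_nhds hne))

theorem IsDualMap.exists_nhds_inner (h : IsDualMap m x ν) (p : M) :
    ∃ I ∈ 𝓝 p, ∀ q ∈ I, ∀ q' ∈ I,
      (q ≠ q' → ⟪(x q : Euc (n + 2)), (ν q' : Euc (n + 2))⟫_ℝ < 0) ∧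
      0 < ⟪(ν q : Euc (n + 2)), (ν q' : Euc (n + 2))⟫_ℝ := by
  set e := chartAt (Euc n) p
  have hp : p ∈ e.source := mem_chart_source _ p
  have h1 := (h.chart_pair p).eventually_inner_neg (mem_chart_target (Euc n) p)
  have he : ContinuousAt (fun a : M × M => (e a.1, e a.2)) (p, p) :=
    (ContinuousAt.comp (g := e) (f := Prod.fst) (x := (p, p)) (e.continuousAt hp)
      continuousAt_fst).prodMk
    (ContinuousAt.comp (g := e) (f := Prod.snd) (x := (p, p)) (e.continuousAt hp)
      continuousAt_snd)
  have h2 : Continuous fun a : M × M => ⟪(ν a.1 : Euc (n + 2)), (ν a.2 : Euc (n + 2))⟫_ℝ :=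
    (h.symm.continuous_left.comp continuous_fst).inner (h.symm.continuous_left.comp continuous_snd)
  have h3 : ∀ᶠ a : M × M in 𝓝 (p, p),
      0 < ⟪(ν a.1 : Euc (n + 2)), (ν a.2 : Euc (n + 2))⟫_ℝ := by
    refine h2.continuousAt.eventually_const_lt ?_
    simp
  obtain ⟨I, hI, J, hJ, hIJ⟩ := mem_nhds_prod_iff.1 ((he.eventually h1).and h3)
  refine ⟨I ∩ J ∩ e.source, inter_mem (inter_mem hI hJ) (e.open_source.mem_nhds hp),
    fun q hq q' hq' => ?_⟩
  obtain ⟨h4, h5⟩ := hIJ (mk_mem_prod hq.1.1 hq'.1.2)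
  refine ⟨fun hne => ?_, h5⟩
  have h6 := h4 fun h0 => hne (e.injOn hq.2 hq'.2 h0)
  rwa [localRep_apply hq.2, localRep_apply hq'.2] at h6

/-- `B` is a closed connected region of the sphere bounded by the hypersurface `x`, with `ν`
pointing out of `B`. -/
structure IsRegion (x ν : M → Sph n) (B : Set (Sph n)) (δ : ℝ) : Prop where
  pos : 0 < δ
  isClosed : IsClosed B
  isPreconnected : IsPreconnected B
  mem : ∀ q, x q ∈ B
  inside : ∀ q t, -δ < t → t < 0 → ∀ y : Sph n, (y : Euc (n + 2)) = tube x ν q t → y ∈ B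
  outside : ∀ q t, 0 < t → t < δ → ∀ y : Sph n, (y : Euc (n + 2)) = tube x ν q t → y ∉ B
  mem_nhds : ∀ y ∈ B, y ∉ range x → B ∈ 𝓝 y

namespace IsDualMap

variable {B : Set (Sph n)} {δ : ℝ} (h : IsDualMap m x ν) (hB : IsRegion x ν B δ)
include h hB

/-- Near `x p` points are positive multiples of `x q + t ν q`, lying in `B` exactly when `t ≤ 0`.
Since `⟪x q, ν q'⟫ ≤ 0` and `⟪ν q, ν q'⟫ > 0` for nearby `q`, `q'`, this sign condition is a family
of linear inequalities: `B` is locally a convex cone. -/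
theorem exists_region_cone (p : M) : ∃ I : Set M,
    (∀ᶠ y : Sph n in 𝓝 (x p), y ∈ B ↔ ∀ q ∈ I, ⟪(y : Euc (n + 2)), (ν q : Euc (n + 2))⟫_ℝ ≤ 0) ∧
    ∀ᶠ y : Sph n in 𝓝 (x p), y ∈ B → y ≠ x p → ⟪(y : Euc (n + 2)), (ν p : Euc (n + 2))⟫_ℝ < 0 := by
  obtain ⟨I, hI, hIn⟩ := h.exists_nhds_inner p
  have hO : I ×ˢ Ioo (-δ) δ ∈ 𝓝 (p, (0 : ℝ)) :=
    prod_mem_nhds hI (Ioo_mem_nhds (neg_lt_zero.2 hB.pos) hB.pos)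
  have key : ∀ᶠ y : Sph n in 𝓝 (x p), ∃ q ∈ I, ∃ t s : ℝ, 0 < s ∧
      (y : Euc (n + 2)) = s • ((x q : Euc (n + 2)) + t • (ν q : Euc (n + 2))) ∧
      (t = 0 → y = x q) ∧ (y ∈ B ↔ t ≤ 0) := by
    filter_upwards [h.eventually_exists_eq_tube p hO] with y hy
    obtain ⟨⟨q, t⟩, ⟨hq, ht⟩, hy⟩ := hy
    have h0 : t = 0 → y = x q := by
      intro ht0
      refine Subtype.ext ?_
      rw [hy]
      simp only [ht0, tube_zero]
    refine ⟨q, hq, t, _, inv_pos.2 (Real.sqrt_pos.2 (by positivity)), hy, h0, ?_⟩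
    rcases lt_trichotomy t 0 with ht0 | ht0 | ht0
    · exact iff_of_true (hB.inside q t ht.1 ht0 y hy) ht0.le
    · exact iff_of_true (h0 ht0 ▸ hB.mem q) ht0.le
    · exact iff_of_false (hB.outside q t ht0 ht.2 y hy) ht0.not_ge
  have inner_eq : ∀ (q q' : M) (s t : ℝ),
      ⟪s • ((x q : Euc (n + 2)) + t • (ν q : Euc (n + 2))), (ν q' : Euc (n + 2))⟫_ℝ =
      s * (⟪(x q : Euc (n + 2)), (ν q' : Euc (n + 2))⟫_ℝ +
        t * ⟪(ν q : Euc (n + 2)), (ν q' : Euc (n + 2))⟫_ℝ) := by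
    intro q q' s t
    rw [inner_smul_left, inner_add_left, inner_smul_left]
    rfl
  refine ⟨I, ?_, ?_⟩
  · filter_upwards [key] with y hy
    obtain ⟨q, hq, t, s, hs, hy, -, hyB⟩ := hy
    rw [hyB, hy]
    constructor
    · intro ht q' hq'
      rw [inner_eq]
      refine mul_nonpos_of_nonneg_of_nonpos hs.le ?_
      have h1 : ⟪(x q : Euc (n + 2)), (ν q' : Euc (n + 2))⟫_ℝ ≤ 0 := by
        rcases eq_or_ne q q' with rfl | hne
        · exact (h.inner_eq_zero q).le
        · exact ((hIn q hq q' hq').1 hne).le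
      nlinarith [(hIn q hq q' hq').2]
    · intro hall
      have h1 := hall q hq
      rw [inner_eq, h.inner_eq_zero] at h1
      have h2 := (hIn q hq q hq).2
      by_contra! ht
      nlinarith [mul_pos hs (mul_pos ht h2)]
  · filter_upwards [key] with y hy hyB hne
    obtain ⟨q, hq, t, s, hs, hy, ht0, hyB'⟩ := hy
    have ht := hyB'.1 hyB
    rw [hy, inner_eq]
    refine mul_neg_of_pos_of_neg hs ?_
    have h2 := (hIn q hq p (mem_of_mem_nhds hI)).2
    rcases eq_or_ne q p with rfl | hqp
    · rw [h.inner_eq_zero]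
      have : t < 0 := lt_of_le_of_ne ht fun h0 => hne (ht0 h0)
      nlinarith
    · have := (hIn q hq p (mem_of_mem_nhds hI)).1 hqp
      nlinarith

theorem isAccessible_region_inter (p : M) {P : Set (Euc (n + 2))} (hP : Convex ℝ P)
    (hs : ∀ z ∈ P, ∀ t : ℝ, 0 < t → t • z ∈ P)
    (hp : x p ∈ closure {y : Sph n | y ∈ B ∧ (y : Euc (n + 2)) ∈ P}) :
    IsAccessible {y : Sph n | y ∈ B ∧ (y : Euc (n + 2)) ∈ P} (x p) := by
  obtain ⟨I, hI, -⟩ := h.exists_region_cone hB p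
  let K : Set (Euc (n + 2)) := {z | ∀ q ∈ I, ⟪z, (ν q : Euc (n + 2))⟫_ℝ ≤ 0} ∩ P
  have heq : ∀ᶠ y : Sph n in 𝓝 (x p), (y : Euc (n + 2)) ∈ K ↔ y ∈ B ∧ (y : Euc (n + 2)) ∈ P := by
    filter_upwards [hI] with y hy
    rw [hy]
    rfl
  refine IsAccessible.congr (isAccessible_cone (K := K) ?_ ?_ ?_) heq
  · refine Convex.inter ?_ hP
    intro a ha b hb s t hs ht hst q hq
    rw [inner_add_left, inner_smul_left, inner_smul_left]
    have h1 := mul_nonpos_of_nonneg_of_nonpos hs (ha q hq)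
    have h2 := mul_nonpos_of_nonneg_of_nonpos ht (hb q hq)
    simp only [conj_trivial]
    linarith
  · rintro z ⟨hz, hzP⟩ t ht
    refine ⟨fun q hq => ?_, hs z hzP t ht⟩
    rw [inner_smul_left]
    exact mul_nonpos_of_nonneg_of_nonpos ht.le (hz q hq)
  · rw [mem_closure_iff_frequently] at hp ⊢
    exact (hp.and_eventually heq).mono fun y hy => hy.2.2 hy.1

omit [ChartedSpace (Euc n) M] h in
theorem mem_closure_region {p : M} {a : Euc (n + 2)} (hx : Continuous x)
    (hp : p ∈ closure {q | 0 < ⟪(x q : Euc (n + 2)), a⟫_ℝ}) :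
    x p ∈ closure (posPart (Subtype.val : Sph n → Euc (n + 2)) B a) :=
  map_mem_closure hx hp fun q hq => ⟨hB.mem q, hq⟩

/-- The region has dimension `n + 1 ≥ 2`, so the case `n = 1` is covered. Interior points have full
spherical neighbourhoods, and at boundary points `B` is a convex cone. -/
theorem isLocallyConvex_region (hn : 1 ≤ n) :
    IsLocallyConvex (Subtype.val : Sph n → Euc (n + 2)) B := by
  have hconv : ∀ a : Euc (n + 2), Convex ℝ {z : Euc (n + 2) | 0 < ⟪z, a⟫_ℝ} := by
    intro a
    have := (convex_Ioi (0 : ℝ)).is_linear_preimage (f := fun z : Euc (n + 2) => ⟪z, a⟫_ℝ)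
      ⟨fun u v => inner_add_left u v a, fun c u => by rw [inner_smul_left]; rfl⟩
    exact this
  have hscale : ∀ a : Euc (n + 2), ∀ z ∈ {z : Euc (n + 2) | 0 < ⟪z, a⟫_ℝ}, ∀ t : ℝ, 0 < t →
      t • z ∈ {z : Euc (n + 2) | 0 < ⟪z, a⟫_ℝ} := by
    intro a z hz t ht
    change 0 < ⟪t • z, a⟫_ℝ
    rw [inner_smul_left]
    exact mul_pos ht hz
  have hint : ∀ y ∈ B, y ∉ range x → ∀ a ≠ 0, 0 ≤ ⟪(y : Euc (n + 2)), a⟫_ℝ →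
      IsAccessible (posPart (Subtype.val : Sph n → Euc (n + 2)) B a) y := by
    intro y hy hyx a ha hya
    refine (isAccessible_cone (hconv a) (hscale a) (mem_closure_half_sphere ha hya)).congr ?_
    filter_upwards [hB.mem_nhds y hy hyx] with z hz
    exact (and_iff_right hz).symm
  have hstrict : ∀ y a, IsStrictSupport (Subtype.val : Sph n → Euc (n + 2)) B y a →
      y ∉ closure (posPart (Subtype.val : Sph n → Euc (n + 2)) B a) := by
    intro y a hs hcl
    obtain ⟨q, hq, hq'⟩ := ((mem_closure_iff_frequently.1 hcl).and_eventually hs.2).exists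
    have hqp : q ≠ y := by
      rintro rfl
      exact hq.2.ne' hs.1
    exact absurd (hq' hq.1 hqp) hq.2.not_gt
  have hxc : Continuous x := h.left.continuous
  refine ⟨hB.isClosed.isCompact, continuous_subtype_val, fun y _ => norm_eq_of_mem_sphere _,
    ?_, ?_, ?_⟩
  · intro a ha y hy hya
    by_cases hyx : y ∈ range x
    · obtain ⟨p, rfl⟩ := hyx
      have hacc : x p ∈ closure (posPart (Subtype.val : Sph n → Euc (n + 2)) B a) →
          IsAccessible (posPart (Subtype.val : Sph n → Euc (n + 2)) B a) (x p) := fun hcl =>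
        h.isAccessible_region_inter hB p (hconv a) (hscale a) hcl
      rcases hya.lt_or_eq with hlt | heq
      · exact Or.inr (hacc (subset_closure ⟨hy, hlt⟩)).exists_nhds
      · rcases h.exists_pos_smul_or_mem_closure hn ha heq.symm with ⟨c, hc, rfl⟩ | hcl
        · left
          refine ⟨heq.symm, ?_⟩
          obtain ⟨-, -, hev⟩ := h.exists_region_cone hB p
          filter_upwards [hev] with z hz hzB hne
          rw [inner_smul_right]
          exact mul_neg_of_pos_of_neg hc (hz hzB hne)
        · exact Or.inr (hacc (mem_closure_region hB hxc hcl)).exists_nhds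
    · exact Or.inr (hint y hy hyx a ha hya).exists_nhds
  · intro y₀ _
    have hset : B \ {y : Sph n | (y : Euc (n + 2)) = -(y₀ : Euc (n + 2))} = B ∩ {-y₀}ᶜ := by
      ext z
      simp only [Set.mem_sdiff, mem_ofPred_eq, mem_inter_iff, mem_compl_iff, mem_singleton_iff,
        Subtype.ext_iff]
      rfl
    rw [hset]
    generalize -y₀ = w
    refine isPreconnected_of_forall_pair fun p hp q hq => ?_
    have hacc : ∀ y ∈ B, IsAccessible (B ∩ {w}ᶜ) y := by
      intro y hy
      by_cases hyw : y = w
      · subst hyw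
        by_cases hyx : y ∈ range x
        · obtain ⟨p, rfl⟩ := hyx
          obtain ⟨-, -, hev⟩ := h.exists_region_cone hB p
          have hcl := mem_closure_region hB hxc
            (h.frequently_inner_pos hn (neg_one_lt_zero (R := ℝ)) p)
          refine (h.isAccessible_region_inter hB p (hconv _) (hscale _) hcl).congr ?_
          filter_upwards [hev] with z hz
          refine and_congr_right fun hzB => ⟨?_, fun hne => ?_⟩
          · rintro hlt rfl
            rw [inner_smul_right, h.inner_eq_zero, mul_zero] at hlt
            exact lt_irrefl _ hlt
          · rw [inner_smul_right]
            linarith [hz hzB hne]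
        · exact isAccessible_inter_compl_singleton hn (hB.mem_nhds y hy hyx) y
      · have hB' : IsAccessible B y := by
          by_cases hyx : y ∈ range x
          · obtain ⟨p, rfl⟩ := hyx
            have := h.isAccessible_region_inter hB p convex_univ (fun _ _ _ _ => mem_univ _)
              (subset_closure ⟨hy, mem_univ _⟩)
            simpa using this
          · have := isAccessible_cone (convex_univ (𝕜 := ℝ)) (fun _ _ _ _ => mem_univ _)
              (subset_closure (mem_univ (y : Euc (n + 2))) : y ∈ closure _)
            refine this.congr ?_
            filter_upwards [hB.mem_nhds y hy hyx] with z hz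
            exact iff_of_true (mem_univ _) hz
        refine hB'.congr ?_
        filter_upwards [isOpen_compl_singleton.mem_nhds hyw] with z hz
        exact (and_iff_left hz).symm
    obtain ⟨γ, hγ⟩ := joinedIn_of_isPreconnected hB.isPreconnected
      (fun y hy => (hacc y hy).exists_nhds) hp.1 hq.1 hp hq
    exact ⟨range γ, range_subset_iff.2 hγ, ⟨0, γ.source⟩, ⟨1, γ.target⟩,
      isPreconnected_range γ.continuous⟩
  · intro y hy a ha w hs hw hwa
    by_cases hyx : y ∈ range x
    · obtain ⟨p, rfl⟩ := hyx
      rcases h.exists_pos_smul_or_mem_closure hn ha hs.1 with ⟨c, hc, rfl⟩ | hcl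
      · exact mem_closure_region hB hxc (h.mem_closure_add hn hc hw hwa)
      · exact absurd (mem_closure_region hB hxc hcl) (hstrict _ _ hs)
    · exact absurd (hint y hy hyx a ha hs.1.ge).mem_closure (hstrict _ _ hs)

theorem inner_neg_of_region (hn : 1 ≤ n) {p : M} {y : Sph n} (hy : y ∈ B) (hne : y ≠ x p) :
    ⟪(y : Euc (n + 2)), (ν p : Euc (n + 2))⟫_ℝ < 0 := by
  have hν : (ν p : Euc (n + 2)) ≠ 0 := ne_zero_of_mem_unit_sphere _
  refine (h.isLocallyConvex_region hB hn).inner_neg_of_isStrictSupport ?_ hν (hB.mem p) hy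
    ⟨h.inner_eq_zero p, ?_⟩ hne
  · rw [finrank_euclideanSpace_fin]
    omega
  · exact (h.exists_region_cone hB p).choose_spec.2

end IsDualMap

end Region

/-! ### Winding numbers and crossings of plane curves -/

section Logarithm

variable {M : Type*} [TopologicalSpace M]

/-- If a curve `ζ` avoids a connected set of points of the plane, its winding numbers about these
points agree: the quotient of the distances to two of them has a continuous logarithm. -/
theorem exists_continuous_log_div [CompactSpace M] {S : Set ℂ} (hS : IsPreconnected S) {ζ : M → ℂ}
    (hζ : Continuous ζ) (h : ∀ q, ζ q ∉ S) {w w' : ℂ} (hw : w ∈ S) (hw' : w' ∈ S) :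
    ∃ l : M → ℂ, Continuous l ∧ ∀ q, Complex.exp (l q) = (ζ q - w) / (ζ q - w') := by
  have hne : ∀ q, ∀ w ∈ S, ζ q - w ≠ 0 := fun q w hw h0 => h q (sub_eq_zero.1 h0 ▸ hw)
  refine hS.induction₂ (fun w w' => ∃ l : M → ℂ, Continuous l ∧
    ∀ q, Complex.exp (l q) = (ζ q - w) / (ζ q - w')) ?_ ?_ ?_ hw hw'
  · intro a ha
    -- For `b` close to `a` the quotient is uniformly close to 1, where the principal logarithm is
    -- continuous.
    have hev : ∀ᶠ b in 𝓝 a, ∀ q ∈ (univ : Set M), (ζ q - a) / (ζ q - b) ∈ Complex.slitPlane := by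
      refine isCompact_univ.eventually_forall_of_forall_eventually fun q _ => ?_
      have hc : ContinuousAt (fun z : ℂ × M => (ζ z.2 - a) / (ζ z.2 - z.1)) (a, q) := by
        refine ContinuousAt.div₀ (by fun_prop) (by fun_prop) (hne q a ha)
      refine hc (Complex.isOpen_slitPlane.mem_nhds ?_)
      simp only [div_self (hne q a ha)]
      exact Complex.one_mem_slitPlane
    filter_upwards [mem_nhdsWithin_of_mem_nhds hev, self_mem_nhdsWithin] with b hb hbS
    refine ⟨fun q => Complex.log ((ζ q - a) / (ζ q - b)), ?_, fun q => ?_⟩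
    · refine Continuous.clog ?_ fun q => hb q (mem_univ q)
      exact (hζ.sub continuous_const).div₀ (hζ.sub continuous_const) fun q => hne q b hbS
    · exact Complex.exp_log (div_ne_zero (hne q a ha) (hne q b hbS))
  · rintro a b c ha hb hc ⟨l, hl, hl'⟩ ⟨k, hk, hk'⟩
    refine ⟨fun q => l q + k q, hl.add hk, fun q => ?_⟩
    rw [Complex.exp_add, hl', hk', div_mul_div_cancel₀ (hne q b hb)]
  · rintro a b ha hb ⟨l, hl, hl'⟩
    refine ⟨fun q => -l q, hl.neg, fun q => ?_⟩
    rw [Complex.exp_neg, hl', inv_div]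

/-- A closed curve crossing the negative real axis exactly once, from one side to the other, has no
continuous logarithm. -/
theorem false_of_continuous_log {p : M} (hP : IsPreconnected ({p}ᶜ : Set M)) {r l : M → ℂ}
    (hr : Continuous r) (hl : Continuous l) (hexp : ∀ q, Complex.exp (l q) = r q)
    (hslit : ∀ q ≠ p, r q ∈ Complex.slitPlane) (hre : (r p).re < 0) (him : (r p).im = 0)
    (h1 : p ∈ closure {q | 0 < (r q).im}) (h2 : p ∈ closure {q | (r q).im < 0}) : False := by
  -- This takes values in `2πℤ` and is continuous off `p`, hence constant on the connected set
  -- `{p}ᶜ`; but the principal argument has limits `π` and `-π` at `p` from the two sides.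
  let κ : M → ℝ := fun q => (l q).im - Complex.arg (r q)
  have hκ : ∀ q, ∃ k : ℤ, κ q = k * (2 * Real.pi) := by
    intro q
    have hr0 : r q ≠ 0 := hexp q ▸ Complex.exp_ne_zero _
    obtain ⟨k, hk⟩ := Complex.exp_eq_exp_iff_exists_int.1
      ((hexp q).trans (Complex.exp_log hr0).symm)
    refine ⟨k, ?_⟩
    have := congrArg Complex.im hk
    simp only [Complex.add_im, Complex.log_im, Complex.mul_im, Complex.intCast_re,
      Complex.intCast_im, Complex.mul_re, Complex.I_re, Complex.I_im] at this
    simp only [κ, this]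
    simp
  have hκc : ContinuousOn κ {p}ᶜ := by
    intro q hq
    exact ((Complex.continuous_im.comp hl).continuousAt.sub
      (ContinuousAt.comp (Complex.continuousAt_arg (hslit q hq)) hr.continuousAt)).continuousWithinAt
  have hle : ∀ q ∈ ({p}ᶜ : Set M), ∀ q' ∈ ({p}ᶜ : Set M), κ q ≤ κ q' := by
    intro q hq q' hq'
    by_contra! hlt
    obtain ⟨k, hk⟩ := hκ q
    obtain ⟨k', hk'⟩ := hκ q'
    have hkk : k' < k := by
      rw [hk, hk'] at hlt
      exact_mod_cast lt_of_mul_lt_mul_right hlt Real.two_pi_pos.le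
    have hkk' : (k' : ℝ) + 1 ≤ k := by exact_mod_cast hkk
    -- The value `κ q' + π` is not a multiple of `2π`, yet it would be attained.
    obtain ⟨q'', -, hq''⟩ := hP.intermediate_value hq' hq hκc
      (show κ q' + Real.pi ∈ Icc (κ q') (κ q) by
        rw [hk, hk']
        constructor <;> nlinarith [Real.pi_pos])
    obtain ⟨k'', hk''⟩ := hκ q''
    rw [hk', hk''] at hq''
    have : (2 * k'' : ℝ) = 2 * k' + 1 := by
      have := Real.pi_pos.ne'
      field_simp at hq''
      linarith
    have : 2 * k'' = 2 * k' + 1 := by exact_mod_cast this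
    omega
  have hlim : ∀ (s : Set M) (c : ℝ), p ∈ closure s → s ⊆ {p}ᶜ →
      Tendsto (fun q => Complex.arg (r q)) (𝓝[s] p) (𝓝 c) → ∀ q ∈ s, (l p).im - c = κ q := by
    intro s c hs hsp ht q hq
    have := mem_closure_iff_nhdsWithin_neBot.1 hs
    have h3 : Tendsto κ (𝓝[s] p) (𝓝 ((l p).im - c)) :=
      ((Complex.continuous_im.comp hl).continuousAt.tendsto.mono_left nhdsWithin_le_nhds).sub ht
    refine tendsto_nhds_unique h3 (tendsto_const_nhds.congr' ?_)
    filter_upwards [self_mem_nhdsWithin] with q' hq'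
    exact le_antisymm (hle _ (hsp hq) _ (hsp hq')) (hle _ (hsp hq') _ (hsp hq))
  have hsub : ∀ s : Set ℂ, r p ∉ s → r ⁻¹' s ⊆ {p}ᶜ := by
    rintro s hs q hq rfl
    exact hs hq
  have hs1 : r ⁻¹' {z | 0 < z.im} ⊆ {p}ᶜ := hsub _ him.not_gt
  have hs2 : r ⁻¹' {z | z.im < 0} ⊆ {p}ᶜ := hsub _ him.not_lt
  have ht : ∀ s : Set ℂ, Tendsto r (𝓝[r ⁻¹' s] p) (𝓝[s] (r p)) := fun s =>
    tendsto_nhdsWithin_iff.2 ⟨hr.continuousAt.tendsto.mono_left nhdsWithin_le_nhds,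
      self_mem_nhdsWithin⟩
  obtain ⟨q₁, hq₁⟩ := closure_nonempty_iff.1 ⟨p, h1⟩
  obtain ⟨q₂, hq₂⟩ := closure_nonempty_iff.1 ⟨p, h2⟩
  have e1 := hlim _ _ h1 hs1 (((Complex.tendsto_arg_nhdsWithin_im_nonneg_of_re_neg_of_im_zero hre
    him).mono_left (nhdsWithin_mono _ fun z (hz : 0 < z.im) => hz.le)).comp (ht _)) q₁ hq₁
  have e2 := hlim _ _ h2 hs2
    ((Complex.tendsto_arg_nhdsWithin_im_neg_of_re_neg_of_im_zero hre him).comp (ht _)) q₂ hq₂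
  have e3 := le_antisymm (hle _ (hs1 hq₁) _ (hs2 hq₂)) (hle _ (hs2 hq₂) _ (hs1 hq₁))
  linarith [Real.pi_pos]

/-- Two points on opposite sides of an arc of a Jordan curve are separated by the curve. -/
theorem false_of_crossing [CompactSpace M] {p : M} (hP : IsPreconnected ({p}ᶜ : Set M)) {S : Set ℂ}
    (hS : IsPreconnected S) {ζ : M → ℂ} (hζ : Continuous ζ) (h : ∀ q, ζ q ∉ S) {a b : ℝ}
    (ha : (a : ℂ) ∈ S) (hb : (b : ℂ) ∈ S) (him : (ζ p).im = 0)
    (hab : (ζ p).re ∈ uIcc a b)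
    (honly : ∀ q, (ζ q).im = 0 → (ζ q).re ∈ uIcc a b → q = p)
    (h1 : p ∈ closure {q | 0 < (ζ q).im}) (h2 : p ∈ closure {q | (ζ q).im < 0}) : False := by
  obtain ⟨l, hl, hexp⟩ := exists_continuous_log_div hS hζ h ha hb
  have hne : ∀ q, ∀ c : ℝ, (c : ℂ) ∈ S → (ζ q).im = 0 → (ζ q).re ≠ c := by
    intro q c hc him heq
    refine h q ?_
    rwa [show ζ q = c from Complex.ext heq him]
  have hre : ∀ q, (ζ q).im = 0 →
      (ζ q - a) / (ζ q - b) = (((ζ q).re - a) / ((ζ q).re - b) : ℝ) := by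
    intro q him
    have : ζ q = ((ζ q).re : ℂ) := Complex.ext rfl him
    rw [this]
    push_cast
    rfl
  have hne' : ∀ q, ζ q - b ≠ 0 := fun q h0 => h q (sub_eq_zero.1 h0 ▸ hb)
  have him' : ∀ q, ((ζ q - a) / (ζ q - b)).im =
      (ζ q).im * ((a - b) / Complex.normSq (ζ q - b)) := by
    intro q
    have := (Complex.normSq_pos.2 (hne' q)).ne'
    rw [Complex.div_im]
    field_simp
    simp
    ring
  have hneg : ∀ q, (ζ q).im = 0 → (ζ q).re ∈ uIcc a b →
      ((ζ q).re - a) / ((ζ q).re - b) < 0 := by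
    intro q h0 h3
    have h4 := hne q a ha h0
    have h5 := hne q b hb h0
    rcases mem_uIcc.1 h3 with h6 | h6
    · exact div_neg_of_pos_of_neg (sub_pos.2 (lt_of_le_of_ne h6.1 h4.symm))
        (sub_neg.2 (lt_of_le_of_ne h6.2 h5))
    · exact div_neg_of_neg_of_pos (sub_neg.2 (lt_of_le_of_ne h6.2 h4))
        (sub_pos.2 (lt_of_le_of_ne h6.1 h5.symm))
  have hab' : a ≠ b := by
    rintro rfl
    rw [uIcc_self, mem_singleton_iff] at hab
    exact hne p a ha him hab
  -- The quotient `(z - a) / (z - b)` is negative real exactly on the open segment between `a` and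
  -- `b`, which the curve meets only at `p`.
  have hslit : ∀ q ≠ p, (ζ q - a) / (ζ q - b) ∈ Complex.slitPlane := by
    intro q hq
    rw [Complex.mem_slitPlane_iff]
    by_cases h0 : (ζ q).im = 0
    · left
      rw [hre q h0, Complex.ofReal_re]
      have h3 : (ζ q).re ∉ uIcc a b := fun h3 => hq (honly q h0 h3)
      have h4 := hne q a ha h0
      have h5 := hne q b hb h0
      rcases lt_or_gt_of_ne h4 with h4 | h4 <;> rcases lt_or_gt_of_ne h5 with h5 | h5
      · exact div_pos_of_neg_of_neg (sub_neg.2 h4) (sub_neg.2 h5)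
      · exact absurd (mem_uIcc.2 (Or.inr ⟨h5.le, h4.le⟩)) h3
      · exact absurd (mem_uIcc.2 (Or.inl ⟨h4.le, h5.le⟩)) h3
      · exact div_pos (sub_pos.2 h4) (sub_pos.2 h5)
    · right
      rw [him']
      exact mul_ne_zero h0 (div_ne_zero (sub_ne_zero.2 hab') (Complex.normSq_pos.2 (hne' q)).ne')
  have hr : Continuous fun q => (ζ q - a) / (ζ q - b) :=
    (hζ.sub continuous_const).div₀ (hζ.sub continuous_const) hne'
  have hp1 : ((ζ p - a) / (ζ p - b)).re < 0 := by
    rw [hre p him, Complex.ofReal_re]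
    exact hneg p him hab
  have hp2 : ((ζ p - a) / (ζ p - b)).im = 0 := by rw [hre p him, Complex.ofReal_im]
  rcases lt_or_gt_of_ne hab' with hlt | hlt
  · refine false_of_continuous_log hP hr hl hexp hslit hp1 hp2 ?_ ?_
    · refine closure_mono (fun q hq => ?_) h2
      change 0 < Complex.im _
      rw [him']
      exact mul_pos_of_neg_of_neg hq (div_neg_of_neg_of_pos (sub_neg.2 hlt)
        (Complex.normSq_pos.2 (hne' q)))
    · refine closure_mono (fun q hq => ?_) h1
      change Complex.im _ < 0
      rw [him']
      exact mul_neg_of_pos_of_neg hq (div_neg_of_neg_of_pos (sub_neg.2 hlt)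
        (Complex.normSq_pos.2 (hne' q)))
  · refine false_of_continuous_log hP hr hl hexp hslit hp1 hp2 ?_ ?_
    · refine closure_mono (fun q hq => ?_) h1
      change 0 < Complex.im _
      rw [him']
      exact mul_pos hq (div_pos (sub_pos.2 hlt) (Complex.normSq_pos.2 (hne' q)))
    · refine closure_mono (fun q hq => ?_) h2
      change Complex.im _ < 0
      rw [him']
      exact mul_neg_of_neg_of_pos hq (div_pos (sub_pos.2 hlt) (Complex.normSq_pos.2 (hne' q)))

end Logarithm

/-! ### Stereographic coordinates -/

section Planar

/-- The stereographic projection from `o`, in coordinates belonging to vectors spanning `o⊥`. -/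
theorem exists_planar_coordinates {E : Type*} [NormedAddCommGroup E] [InnerProductSpace ℝ E]
    (o : Metric.sphere (0 : E) 1) {a b : E} (hb : ⟪(o : E), b⟫_ℝ = 0)
    (hspan : ∀ v : E, ⟪v, (o : E)⟫_ℝ = 0 → ⟪v, a⟫_ℝ = 0 → ⟪v, b⟫_ℝ = 0 → v = 0) :
    ∃ Z : Metric.sphere (0 : E) 1 → ℂ, ContinuousOn Z {o}ᶜ ∧ InjOn Z {o}ᶜ ∧
      ∀ y ≠ o, ∃ s > 0, (Z y).im = s * ⟪(y : E), b⟫_ℝ := by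
  have ho : ‖(o : E)‖ = 1 := norm_eq_of_mem_sphere o
  set st := stereographic ho
  have hst : st.source = {o}ᶜ := stereographic_source ho
  have hmem : ∀ v : E, ⟪(o : E), v⟫_ℝ = 0 → v ∈ (ℝ ∙ (o : E))ᗮ := fun v hv =>
    Submodule.mem_orthogonal_singleton_iff_inner_right.2 hv
  refine ⟨fun y => ⟨⟪(st y : E), a⟫_ℝ, ⟪(st y : E), b⟫_ℝ⟩, ?_, ?_, ?_⟩
  · rw [← hst]
    have h1 : ContinuousOn (fun y => (st y : E)) st.source :=
      continuous_subtype_val.comp_continuousOn st.continuousOn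
    exact Complex.equivRealProdCLM.symm.continuous.comp_continuousOn
      ((h1.inner continuousOn_const).prodMk (h1.inner continuousOn_const))
  · intro y hy y' hy' heq
    rw [← hst] at hy hy'
    simp only [Complex.mk.injEq] at heq
    refine st.injOn hy hy' (Subtype.ext (sub_eq_zero.1 (hspan _ ?_ ?_ ?_)))
    · have h1 := Submodule.mem_orthogonal_singleton_iff_inner_left.1 (st y - st y').2
      simpa using h1
    · rw [inner_sub_left, heq.1, sub_self]
    · rw [inner_sub_left, heq.2, sub_self]
  · intro y hy
    have h1 : ⟪(o : E), (y : E)⟫_ℝ < 1 := by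
      refine inner_lt_one_iff_real_of_norm_eq_one ho (norm_eq_of_mem_sphere y) |>.2 ?_
      exact fun h0 => hy (Subtype.ext h0.symm)
    refine ⟨2 / (1 - ⟪(o : E), (y : E)⟫_ℝ), div_pos two_pos (sub_pos.2 h1), ?_⟩
    simp only [st, stereographic_apply, Submodule.coe_smul, inner_smul_left, conj_trivial]
    congr 1
    exact Submodule.inner_orthogonalProjectionOnto_eq_of_mem_right ⟨b, hmem b hb⟩ (y : E)

end Planar

/-! ### Separation of the sphere by the curve, `n = 1` -/

section Jordan

variable {m : ℕ} {M : Type*} [TopologicalSpace M] [ChartedSpace (Euc 1) M]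
  [IsManifold (𝓡 1) (m : ℕ∞ω) M] {x ν : M → Sph 1}

namespace IsDualMap

theorem exists_tangent (h : IsDualMap m x ν) (p : M) : ∃ T : Euc 3, T ≠ 0 ∧
    ⟪(x p : Euc 3), T⟫_ℝ = 0 ∧ ⟪(ν p : Euc 3), T⟫_ℝ = 0 ∧
    ∀ v : Euc 3, ⟪v, (x p : Euc 3)⟫_ℝ = 0 → ⟪v, (ν p : Euc 3)⟫_ℝ = 0 → ⟪v, T⟫_ℝ = 0 → v = 0 := by
  have hp : p ∈ (chartAt (Euc 1) p).source := mem_chart_source _ p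
  have hpair := h.chart_pair p
  have hu := mem_chart_target (Euc 1) p
  have hX : localRep x (chartAt (Euc 1) p) (chartAt (Euc 1) p p) = x p := localRep_apply hp
  have hN : localRep ν (chartAt (Euc 1) p) (chartAt (Euc 1) p p) = ν p := localRep_apply hp
  refine ⟨pd 0 (localRep x (chartAt (Euc 1) p)) (chartAt (Euc 1) p p), fun h0 => ?_, ?_, ?_, ?_⟩
  · have h1 := hpair.injective_left hu (h0.trans (map_zero _).symm)
    simpa using congrArg norm h1
  · rw [real_inner_comm, ← hX]
    exact hpair.tangent_left hu _
  · rw [real_inner_comm, ← hN]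
    exact hpair.normal _ hu _
  · intro v h1 h2 h3
    refine hpair.eq_zero_of_orthogonal hu (by rwa [hX]) (by rwa [hN]) fun l => ?_
    rwa [Subsingleton.elim l 0]

variable (h : IsDualMap m x ν)
include h

/-- The two sides of a strictly convex Jordan curve on the sphere lie in different components of
the complement. -/
theorem false_of_isPreconnected_sides [T2Space M] [CompactSpace M] [ConnectedSpace M]
    (hinj : Function.Injective x) {δ : ℝ} (hδ : 0 < δ)
    (htube : ∀ q t, t ≠ 0 → |t| < δ → tube x ν q t ∉ range fun q' => (x q' : Euc 3))
    {O : Set (Sph 1)} (hO : IsOpen O) (hOc : IsPreconnected O) (hOx : Disjoint O (range x))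
    (hmem : ∀ q t, t ≠ 0 → |t| < δ → ∀ y : Sph 1, (y : Euc 3) = tube x ν q t → y ∈ O) : False := by
  -- The crossing is placed at a non-cut point, so it need not be known that `M` is a circle.
  obtain ⟨p, hp⟩ := exists_isPreconnected_compl_singleton (T := M)
  obtain ⟨T, hT0, hxT, hνT, hspan⟩ := h.exists_tangent p
  obtain ⟨τ, hτ, hτδ⟩ : ∃ τ : ℝ, 0 < τ ∧ 2 * τ < δ := ⟨δ / 3, by linarith, by linarith⟩
  have hxν := h.inner_eq_zero p
  have hxx : ⟪(x p : Euc 3), (x p : Euc 3)⟫_ℝ = 1 := by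
    rw [real_inner_self_eq_norm_sq, norm_eq_of_mem_sphere, one_pow]
  have hνν : ⟪(ν p : Euc 3), (ν p : Euc 3)⟫_ℝ = 1 := by
    rw [real_inner_self_eq_norm_sq, norm_eq_of_mem_sphere, one_pow]
  have hs : ∀ t : ℝ, 0 < (√(1 + t ^ 2))⁻¹ := fun t =>
    inv_pos.2 (Real.sqrt_pos.2 (by positivity))
  let γ : ℝ → Sph 1 := fun t => ⟨tube x ν p t, mem_sphere_zero_iff_norm.2 (h.norm_tube p t)⟩
  have hγ : Continuous γ :=
    (h.continuous_tube.comp (Continuous.prodMk_right p)).subtype_mk _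
  have hγT : ∀ t, ⟪(γ t : Euc 3), T⟫_ℝ = 0 := fun t => by
    simp [γ, tube, inner_smul_left, inner_add_left, hxT, hνT]
  have hγx : ∀ t, ⟪(γ t : Euc 3), (x p : Euc 3)⟫_ℝ = (√(1 + t ^ 2))⁻¹ := fun t => by
    simp only [γ, tube, inner_smul_left, inner_add_left, hxx, real_inner_comm, hxν, conj_trivial]
    ring
  have hγν : ∀ t, ⟪(γ t : Euc 3), (ν p : Euc 3)⟫_ℝ = (√(1 + t ^ 2))⁻¹ * t := fun t => by
    simp only [γ, tube, inner_smul_left, inner_add_left, hνν, hxν, conj_trivial]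
    ring
  have hγ_inj : Function.Injective γ := by
    intro t t' heq
    have h1 := hγx t
    have h2 := hγν t
    rw [heq, hγx] at h1
    rw [heq, hγν, h1] at h2
    exact (mul_left_cancel₀ (hs t).ne' h2).symm
  -- The pole lies on the normal great circle, beyond the arc `[-τ, τ]`. With `ν p - 2τ x p` tangent
  -- to that circle at the pole and `T` orthogonal to its plane, the circle is sent to the real
  -- axis.
  obtain ⟨Z, hZc, hZinj, hZim⟩ := exists_planar_coordinates (γ (2 * τ))
    (a := (ν p : Euc 3) - (2 * τ) • (x p : Euc 3)) (b := T) (hγT _) (by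
      intro v h1 h2 h3
      have h4 : ⟪v, (x p : Euc 3)⟫_ℝ + 2 * τ * ⟪v, (ν p : Euc 3)⟫_ℝ = 0 := by
        simp only [γ, tube, inner_smul_right, inner_add_right] at h1
        exact (mul_eq_zero.1 h1).resolve_left (hs _).ne'
      rw [inner_sub_right, inner_smul_right] at h2
      have h5 : ⟪v, (x p : Euc 3)⟫_ℝ * (1 + (2 * τ) ^ 2) = 0 := by linear_combination h4 - 2 * τ * h2
      have h6 : ⟪v, (x p : Euc 3)⟫_ℝ = 0 :=
        (mul_eq_zero.1 h5).resolve_right (by positivity)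
      exact hspan v h6 (by rw [h6] at h2; linarith) h3)
  have hZim0 : ∀ y ≠ γ (2 * τ), (Z y).im = 0 ↔ ⟪(y : Euc 3), T⟫_ℝ = 0 := fun y hy => by
    obtain ⟨s, hs, he⟩ := hZim y hy
    rw [he, mul_eq_zero, or_iff_right hs.ne']
  have hoff : ∀ q t, |t| < δ → t ≠ 0 → x q ≠ γ t := fun q t ht ht0 heq =>
    htube p t ht0 ht ⟨q, congrArg Subtype.val heq⟩
  have habs : |2 * τ| < δ := by rwa [abs_of_pos (by linarith)]
  have hxo : ∀ q, x q ≠ γ (2 * τ) := fun q => hoff q _ habs (by linarith)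
  have hγo : ∀ t ∈ Icc (-τ) τ, γ t ≠ γ (2 * τ) := fun t ht heq => by
    have := hγ_inj heq
    linarith [ht.2]
  have hγ0 : γ 0 = x p := Subtype.ext (tube_zero p)
  let f : ℝ → ℝ := fun t => (Z (γ t)).re
  have hγf : ∀ t ∈ Icc (-τ) τ, Z (γ t) = (f t : ℂ) := fun t ht =>
    Complex.ext rfl (by rw [Complex.ofReal_im, hZim0 _ (hγo t ht), hγT])
  have hfc : ContinuousOn f (Icc (-τ) τ) :=
    Complex.continuous_re.comp_continuousOn (hZc.comp hγ.continuousOn fun t ht => hγo t ht)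
  have hfinj : InjOn f (Icc (-τ) τ) := by
    intro t ht t' ht' heq
    refine hγ_inj (hZinj (hγo t ht) (hγo t' ht') ?_)
    rw [hγf t ht, hγf t' ht', heq]
  have hneg : -τ ∈ Icc (-τ) τ := ⟨le_rfl, by linarith⟩
  have hpos : τ ∈ Icc (-τ) τ := ⟨by linarith, le_rfl⟩
  have hzero : (0 : ℝ) ∈ Icc (-τ) τ := ⟨by linarith, hτ.le⟩
  have hτ_lt : |τ| < δ := by rw [abs_of_pos hτ]; linarith
  -- The pole has to be deleted from `O`; in an open subset of a 2-sphere this keeps connectedness.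
  have hO' : IsPreconnected (O ∩ {γ (2 * τ)}ᶜ) := by
    refine isPreconnected_of_forall_pair fun y hy z hz => ?_
    obtain ⟨c, hc⟩ := joinedIn_of_isPreconnected hOc (fun w hw =>
      (isAccessible_inter_compl_singleton le_rfl (hO.mem_nhds hw) (γ (2 * τ))).exists_nhds) hy.1 hz.1 hy hz
    exact ⟨range c, range_subset_iff.2 hc, ⟨0, c.source⟩, ⟨1, c.target⟩,
      isPreconnected_range c.continuous⟩
  refine false_of_crossing (p := p) hp (hO'.image Z (hZc.mono inter_subset_right))
    (ζ := fun q => Z (x q)) (a := f τ) (b := f (-τ)) ?_ ?_ ?_ ?_ ?_ ?_ ?_ ?_ ?_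
  · exact hZc.comp_continuous h.left.continuous hxo
  · rintro q ⟨y, hy, heq⟩
    have := hZinj hy.2 (hxo q) heq
    exact disjoint_left.1 hOx hy.1 ⟨q, this.symm⟩
  · exact ⟨γ τ, ⟨hmem p τ hτ.ne' hτ_lt _ rfl, hγo τ hpos⟩, hγf τ hpos⟩
  · exact ⟨γ (-τ), ⟨hmem p (-τ) (neg_ne_zero.2 hτ.ne') (by rwa [abs_neg]) _ rfl, hγo _ hneg⟩,
      hγf _ hneg⟩
  · rw [hZim0 _ (hxo p), hxT]
  · rw [← hγ0]
    change f 0 ∈ _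
    rcases hfc.strictMonoOn_of_injOn_Icc' (by linarith) hfinj with hm | hm
    · exact mem_uIcc.2 (Or.inr ⟨(hm hneg hzero (by linarith)).le, (hm hzero hpos hτ).le⟩)
    · exact mem_uIcc.2 (Or.inl ⟨(hm hzero hpos hτ).le, (hm hneg hzero (by linarith)).le⟩)
  · intro q him hre
    have huIcc : uIcc (-τ) τ = Icc (-τ) τ := uIcc_of_le (by linarith)
    obtain ⟨t, ht, hft⟩ := intermediate_value_uIcc (by rwa [huIcc]) (uIcc_comm (f τ) _ ▸ hre)
    rw [huIcc] at ht
    have h1 : x q = γ t := hZinj (hxo q) (hγo t ht) (by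
      rw [hγf t ht, hft]
      exact Complex.ext rfl him)
    have ht0 : t = 0 := by
      by_contra hne
      exact hoff q t ((abs_le.2 ht).trans_lt (by linarith)) hne h1
    rw [ht0, hγ0] at h1
    exact hinj h1
  -- The tangent `T` is not a multiple of `ν p`, so the curve has points on both sides of the great
  -- circle arbitrarily near `p`.
  · rcases h.exists_pos_smul_or_mem_closure le_rfl hT0 hxT with ⟨c, hc, rfl⟩ | hcl
    · rw [inner_smul_right, hνν, mul_one] at hνT
      exact absurd hνT hc.ne'
    · refine closure_mono (fun q hq => ?_) hcl
      obtain ⟨s, hs, he⟩ := hZim _ (hxo q)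
      change 0 < Complex.im _
      rw [he]
      exact mul_pos hs hq
  · rcases h.exists_pos_smul_or_mem_closure le_rfl (a := -T) (neg_ne_zero.2 hT0)
      (by rw [inner_neg_right, hxT, neg_zero]) with ⟨c, hc, heq⟩ | hcl
    · have h1 : ⟪(ν p : Euc 3), -T⟫_ℝ = c := by rw [heq, inner_smul_right, hνν, mul_one]
      rw [inner_neg_right, hνT, neg_zero] at h1
      exact absurd h1 hc.ne
    · refine closure_mono (fun q hq => ?_) hcl
      obtain ⟨s, hs, he⟩ := hZim _ (hxo q)
      change Complex.im _ < 0
      rw [he]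
      refine mul_neg_of_pos_of_neg hs ?_
      rw [mem_ofPred_eq, inner_neg_right] at hq
      linarith

theorem exists_isRegion [T2Space M] [CompactSpace M] [ConnectedSpace M]
    (hinj : Function.Injective x) : ∃ B δ, IsRegion x ν B δ := by
  have := fact_finrank_euc 1
  have := ChartedSpace.locallyPathConnectedSpace (Euc (1 + 1)) (Sph 1)
  obtain ⟨δ, hδ, htube⟩ := h.exists_tube_notMem_range hinj
  let Ψ : M × ℝ → Sph 1 := fun a =>
    ⟨tube x ν a.1 a.2, mem_sphere_zero_iff_norm.2 (h.norm_tube a.1 a.2)⟩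
  have hΨ : Continuous Ψ := h.continuous_tube.subtype_mk _
  have hC : IsClosed (range x) := (isCompact_range h.left.continuous).isClosed
  have hΨC : ∀ q t, t ≠ 0 → |t| < δ → Ψ (q, t) ∈ (range x)ᶜ := fun q t ht htδ ⟨q', hq'⟩ =>
    htube q t ht htδ ⟨q', congrArg Subtype.val hq'⟩
  obtain ⟨p⟩ : Nonempty M := inferInstance
  set O := connectedComponentIn (range x)ᶜ (Ψ (p, -(δ / 2)))
  have hO : IsOpen O := hC.isOpen_compl.connectedComponentIn
  have hOc : IsPreconnected O := isPreconnected_connectedComponentIn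
  have hOx : O ⊆ (range x)ᶜ := connectedComponentIn_subset _ _
  -- Each one-sided collar is connected and misses the curve, so it lies in `O` as soon as one of
  -- its points does.
  have hside : ∀ (a b : ℝ), (∀ t ∈ Ioo a b, t ≠ 0 ∧ |t| < δ) → ∀ q₀, ∀ t₀ ∈ Ioo a b,
      Ψ (q₀, t₀) ∈ O → ∀ q, ∀ t ∈ Ioo a b, Ψ (q, t) ∈ O := by
    intro a b hab q₀ t₀ ht₀ hmem q t ht
    have h1 : IsPreconnected (Ψ '' (univ ×ˢ Ioo a b)) :=
      (isPreconnected_univ.prod isPreconnected_Ioo).image _ hΨ.continuousOn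
    have h2 : Ψ '' (univ ×ˢ Ioo a b) ⊆ (range x)ᶜ := by
      rintro _ ⟨⟨q', t'⟩, ⟨-, ht'⟩, rfl⟩
      exact hΨC q' t' (hab t' ht').1 (hab t' ht').2
    have h3 := h1.subset_connectedComponentIn ⟨(q₀, t₀), ⟨mem_univ _, ht₀⟩, rfl⟩ h2
    rw [← connectedComponentIn_eq hmem] at h3
    exact h3 ⟨(q, t), ⟨mem_univ _, ht⟩, rfl⟩
  have hin : ∀ q, ∀ t ∈ Ioo (-δ) 0, Ψ (q, t) ∈ O := by
    refine hside (-δ) 0 (fun t ht => ⟨ht.2.ne, abs_lt.2 ⟨ht.1, ht.2.trans hδ⟩⟩) p (-(δ / 2))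
      ⟨by linarith, by linarith⟩ (mem_connectedComponentIn (hΨC _ _ (by linarith) ?_))
    rw [abs_neg, abs_of_pos (by linarith)]
    linarith
  have hout : ∀ q, ∀ t ∈ Ioo 0 δ, Ψ (q, t) ∉ O := by
    intro q t ht hmem
    have hpos := hside 0 δ (fun t ht => ⟨ht.1.ne', abs_lt.2 ⟨by linarith [ht.1], ht.2⟩⟩) q t ht hmem
    refine h.false_of_isPreconnected_sides hinj hδ htube hO hOc
      (disjoint_left.2 fun y hy => hOx hy) fun q' t' ht' htδ y hy => ?_
    rw [show y = Ψ (q', t') from Subtype.ext hy]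
    rcases lt_or_gt_of_ne ht' with h0 | h0
    · exact hin q' t' ⟨(abs_lt.1 htδ).1, h0⟩
    · exact hpos q' t' ⟨h0, (abs_lt.1 htδ).2⟩
  have hclosure : ∀ q, x q ∈ closure O := by
    intro q
    have h1 : Tendsto (fun t : ℝ => Ψ (q, t)) (𝓝[<] 0) (𝓝 (x q)) := by
      have h2 := (hΨ.comp (Continuous.prodMk_right q)).tendsto (0 : ℝ)
      have h3 : Ψ (q, 0) = x q := Subtype.ext (tube_zero q)
      rw [Function.comp_apply, h3] at h2
      exact h2.mono_left nhdsWithin_le_nhds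
    refine mem_closure_of_tendsto h1 ?_
    filter_upwards [Ioo_mem_nhdsLT (neg_lt_zero.2 hδ)] with t ht
    exact hin q t ht
  refine ⟨O ∪ range x, δ, hδ, ?_, ?_, fun q => Or.inr ⟨q, rfl⟩, ?_, ?_, ?_⟩
  · rw [← isOpen_compl_iff, isOpen_iff_mem_nhds]
    intro y hy
    have hyx : y ∈ (range x)ᶜ := fun h0 => hy (Or.inr h0)
    refine mem_of_superset (hC.isOpen_compl.connectedComponentIn.mem_nhds
      (mem_connectedComponentIn hyx)) fun z hz h0 => ?_
    rcases h0 with h0 | h0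
    · refine hy (Or.inl ?_)
      have h1 := connectedComponentIn_eq hz
      have h2 := connectedComponentIn_eq h0
      change y ∈ connectedComponentIn _ _
      rw [h2, ← h1]
      exact mem_connectedComponentIn hyx
    · exact connectedComponentIn_subset _ _ hz h0
  · refine hOc.subset_closure subset_union_left (union_subset subset_closure ?_)
    rintro _ ⟨q, rfl⟩
    exact hclosure q
  · intro q t h1 h2 y hy
    rw [show y = Ψ (q, t) from Subtype.ext hy]
    exact Or.inl (hin q t ⟨h1, h2⟩)
  · intro q t h1 h2 y hy
    rw [show y = Ψ (q, t) from Subtype.ext hy]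
    rintro (h0 | h0)
    · exact hout q t ⟨h1, h2⟩ h0
    · exact hΨC q t h1.ne' (abs_lt.2 ⟨by linarith, h2⟩) h0
  · rintro y (hy | hy) hyx
    · exact mem_of_superset (hO.mem_nhds hy) subset_union_left
    · exact absurd hy hyx

end IsDualMap

end Jordan

/-! ### The exterior normal and the Gauss map -/

section GaussMap

variable {n m : ℕ} {M : Type*} [TopologicalSpace M] [ChartedSpace (Euc n) M]
  [IsManifold (𝓡 n) (m : ℕ∞ω) M] {x ν : M → Sph n}

namespace IsDualMap

/-- A closed strictly convex hypersurface of the sphere lies strictly on one side of each of its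
tangent great spheres. -/
theorem inner_neg [T2Space M] [CompactSpace M] [ConnectedSpace M] (h : IsDualMap m x ν)
    (hn : 1 ≤ n) (hinj : n = 1 → Function.Injective x) {p q : M} (hqp : q ≠ p) :
    ⟪(x q : Euc (n + 2)), (ν p : Euc (n + 2))⟫_ℝ < 0 := by
  -- For `n = 1` the local-to-global principle is applied to the bounded region, otherwise to `M`.
  rcases hn.eq_or_lt with rfl | hn
  · obtain ⟨B, δ, hB⟩ := h.exists_isRegion (hinj rfl)
    exact h.inner_neg_of_region hB le_rfl (hB.mem q) fun heq => hqp (hinj rfl heq)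
  · have h1 := h.isStrictSupport_smul one_pos p
    rw [one_smul] at h1
    refine (h.isLocallyConvex hn).inner_neg_of_isStrictSupport ?_
      (ne_zero_of_mem_unit_sphere _) (mem_univ p) (mem_univ q) h1 hqp
    rw [finrank_euclideanSpace_fin]
    omega

theorem isUnitNormal (h : IsDualMap m x ν) (hm : m ≠ 0) (p : M) : IsUnitNormal x p (ν p) := by
  have := IsManifold.of_le (I := 𝓡 n) (M := M)
    (show (1 : ℕ∞ω) ≤ m by exact_mod_cast Nat.one_le_iff_ne_zero.2 hm)
  have hp : p ∈ (chartAt (Euc n) p).source := mem_chart_source _ p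
  refine (isUnitNormal_iff (h.left.of_le one_le_two) (mdifferentiable_of_mem_maximalAtlas hm
    (IsManifold.chart_mem_maximalAtlas p)) hp).2 ⟨h.inner_eq_zero p, ?_⟩
  rw [← localRep_apply (x := ν) hp]
  exact (h.chart_pair p).normal _ (mem_chart_target _ p)

/-- The only unit normals are `±ν p`, and `-ν p` is not exterior because nearby points of the
hypersurface have positive product with it. -/
theorem isExteriorNormal_iff (h : IsDualMap m x ν) (hn : 1 ≤ n) (hm : m ≠ 0)
    (hneg : ∀ p q, q ≠ p → ⟪(x q : Euc (n + 2)), (ν p : Euc (n + 2))⟫_ℝ < 0) (p : M) (v : Sph n) :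
    IsExteriorNormal x p v ↔ v = ν p := by
  have := IsManifold.of_le (I := 𝓡 n) (M := M)
    (show (1 : ℕ∞ω) ≤ m by exact_mod_cast Nat.one_le_iff_ne_zero.2 hm)
  have hp : p ∈ (chartAt (Euc n) p).source := mem_chart_source _ p
  constructor
  · rintro ⟨hv, hext⟩
    obtain ⟨h1, h2⟩ := (isUnitNormal_iff (h.left.of_le one_le_two)
      (mdifferentiable_of_mem_maximalAtlas hm (IsManifold.chart_mem_maximalAtlas p)) hp).1 hv
    have h3 := (h.chart_pair p).eq_smul_normal (mem_chart_target _ p)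
      (by rwa [localRep_apply hp, real_inner_comm]) h2
    rw [localRep_apply hp] at h3
    set c := ⟪(v : Euc (n + 2)), (ν p : Euc (n + 2))⟫_ℝ
    have hc : |c| = 1 := by
      have := congrArg norm h3
      rw [norm_smul, norm_eq_of_mem_sphere, norm_eq_of_mem_sphere, mul_one] at this
      exact this.symm
    obtain ⟨q, hq⟩ := closure_nonempty_iff.1 ⟨p, h.frequently_inner_pos hn neg_one_lt_zero p⟩
    rw [mem_ofPred_eq, inner_smul_right] at hq
    have h4 := hext q
    rw [h3, inner_smul_right] at h4
    rcases eq_or_eq_neg_of_abs_eq hc with hc | hc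
    · rw [hc, one_smul] at h3
      exact Subtype.ext h3
    · rw [hc] at h4
      linarith
  · rintro rfl
    refine ⟨h.isUnitNormal hm p, fun q => ?_⟩
    rcases eq_or_ne q p with rfl | hne
    · exact (h.inner_eq_zero q).le
    · exact (hneg p q hne).le

theorem gaussMap_eq (hext : ∀ p v, IsExteriorNormal x p v ↔ v = ν p) : gaussMap x = ν := by
  funext p
  have hex : ∃ v, IsExteriorNormal x p v := ⟨ν p, (hext p _).2 rfl⟩
  rw [gaussMap, dif_pos hex]
  exact (hext p _).1 hex.choose_spec

omit [ChartedSpace (Euc n) M] [IsManifold (𝓡 n) (m : ℕ∞ω) M] in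
theorem isEmbedding_of_inner_neg [CompactSpace M] (hx : Continuous x)
    (hxν : ∀ p, ⟪(x p : Euc (n + 2)), (ν p : Euc (n + 2))⟫_ℝ = 0)
    (hneg : ∀ p q, q ≠ p → ⟪(x q : Euc (n + 2)), (ν p : Euc (n + 2))⟫_ℝ < 0) :
    IsEmbedding x := by
  refine (hx.isClosedEmbedding fun q p heq => ?_).isEmbedding
  by_contra hne
  have h1 := hneg p q hne
  rw [heq, hxν] at h1
  exact lt_irrefl _ h1

/-- The class `k` is independent of the class `m` of the atlas, since the Gauss map has one
derivative less than the manifold. -/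
theorem isStrictlyConvexHypersurface (h : IsDualMap m x ν) (hm : m ≠ 0) {k : ℕ}
    (hx : ContMDiff (𝓡 n) (𝓡 (n + 1)) (k : ℕ∞ω) x) : IsStrictlyConvexHypersurface k x := by
  have := IsManifold.of_le (I := 𝓡 n) (M := M)
    (show (1 : ℕ∞ω) ≤ m by exact_mod_cast Nat.one_le_iff_ne_zero.2 hm)
  refine ⟨hx, fun p => ?_, fun p => ⟨ν p, h.isUnitNormal hm p, ?_⟩⟩
  · exact (injective_mfderiv_iff (h.left.of_le one_le_two) (mdifferentiable_of_mem_maximalAtlas hm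
      (IsManifold.chart_mem_maximalAtlas p)) (mem_chart_source _ p)).2
      ((h.chart_pair p).injective_left (mem_chart_target _ p))
  · rw [← localRep_apply (x := ν) (mem_chart_source (Euc n) p)]
    exact (h.chart_pair p).secondFF_posDef (mem_chart_target _ p)

end IsDualMap

end GaussMap

end SphericalGauss

open SphericalGauss
theorem theorem2p4 {n m : ℕ} (hn : 1 ≤ n) (hm : 3 ≤ m)
    {M : Type*} [TopologicalSpace M] [T2Space M] [CompactSpace M] [ConnectedSpace M]
    [ChartedSpace (Euc n) M] [IsManifold (𝓡 n) (m : ℕ∞ω) M]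
    (x : M → Sph n) (hx : IsStrictlyConvexHypersurface m x)
    (hinj : n = 1 → Function.Injective x) :
    -- `x` is an embedding and the Gauss map is well defined
    Topology.IsEmbedding x ∧
    (∀ p v, IsExteriorNormal x p v ↔ v = gaussMap x p) ∧
    -- the Gauss map embeds `M` as a strictly convex hypersurface of class `C^{m-1}`
    Topology.IsEmbedding (gaussMap x) ∧
    IsStrictlyConvexHypersurface (m - 1) (gaussMap x) ∧
    -- its exterior unit normal is `x`, so applying the Gauss map twice gives `x` back
    (∀ p v, IsExteriorNormal (gaussMap x) p v ↔ v = x p) ∧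
    gaussMap (gaussMap x) = x ∧
    -- formulas in arbitrary local coordinates
    ∀ e ∈ IsManifold.maximalAtlas (𝓡 n) (m : ℕ∞ω) M, ∀ p ∈ e.source,
      let X := localRep x e
      let X' := localRep (gaussMap x) e
      let u := e p
      let h := secondFF X (X' u) u
      let h' := secondFF X' (X u) u
      -- Gauss formulas of the two submanifolds of codimension two
      (∀ i j, covHess X u i j = -(metric X u i j) • X u - h i j • X' u) ∧
      (∀ i j, covHess X' u i j = -(metric X' u i j) • X' u - h' i j • X u) ∧
      -- second fundamental forms and principal curvatures
      h.PosDef ∧ h' = h ∧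
      (∀ i j, h i j = ⟪pd i X' u, pd j X u⟫_ℝ) ∧
      principalCurvatures X' (X u) u =
        (principalCurvatures X (X' u) u).map (fun κ => κ⁻¹) := by
  obtain ⟨ν, h, hν⟩ := exists_isDualMap hn hm hx
  have hm0 : m ≠ 0 := by omega
  have hneg : ∀ p q, q ≠ p → ⟪(x q : Euc (n + 2)), (ν p : Euc (n + 2))⟫_ℝ < 0 :=
    fun p q hqp => h.inner_neg hn hinj hqp
  -- The same inequality with `p` and `q` exchanged, so the swapped pair needs no second global
  -- argument.
  have hneg' : ∀ p q, q ≠ p → ⟪(ν q : Euc (n + 2)), (x p : Euc (n + 2))⟫_ℝ < 0 :=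
    fun p q hqp => by
      rw [real_inner_comm]
      exact hneg q p hqp.symm
  have hext := h.isExteriorNormal_iff hn hm0 hneg
  have hext' := h.symm.isExteriorNormal_iff hn hm0 hneg'
  rw [IsDualMap.gaussMap_eq hext]
  refine ⟨IsDualMap.isEmbedding_of_inner_neg h.left.continuous h.inner_eq_zero hneg, hext,
    IsDualMap.isEmbedding_of_inner_neg h.right.continuous h.symm.inner_eq_zero hneg',
    h.symm.isStrictlyConvexHypersurface hm0 hν, hext', IsDualMap.gaussMap_eq hext', ?_⟩
  intro e he p hp X X' u k k'
  have hpair : IsDualPair X X' e.target := h.pair e he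
  have hu : u ∈ e.target := e.map_source hp
  exact ⟨hpair.covHess_eq hu, hpair.symm.covHess_eq hu, hpair.secondFF_posDef hu,
    hpair.secondFF_dual hu, hpair.secondFF_apply hu, hpair.principalCurvatures_dual hu⟩
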